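/- **Setting.** Let $d$ be the spacetime dimension, $g_{ab}$ a Lorentzian metric of signature $(-,+,\dots,+)$ (with smooth components on an open coordinate domain $U\subset\mathbb R^d$), $\nabla$ its Levi-Civita connection. A conformal change is $g\mapsto\hat g=\Omega^2g$ with $\Omega>0$ smooth; a quantity $Q$ has conformal weight $n$ if $\hat Q=\Omega^{-n}Q$. Round brackets denote symmetrization with weight one. **(I) Requirements of conformal invariance.** (a) Let $T^{ab}$ be a differentiable symmetric tensor field on $U$ and $\alpha\in\mathbb R$. If $\alpha=-(d+2)$ and $g_{ab}T^{ab}=0$, then $\hat\nabla_a(\Omega^\alpha T^{ab})=\Omega^\alpha\nabla_aT^{ab}$ for all $\Omega$. Conversely, if this holds for all $\Omega$ and $T^{ab}$ is not everywhere of the form $\varphi g^{ab}$, then $\alpha=-(d+2)$ and $g_{ab}T^{ab}=0$ on $U$. (b) Let $A^{abc}$ be a differentiable tensor field on $U$, symmetric and trace-free in the last two indices, and $\beta\in\mathbb R$. If $\beta=-(d+4)$, all traces of $A^{abc}$ vanish and $$n_aA^{abc}=n_aA^{(bc)a}\quad\text{for all covectors }n_a,\qquad(\ast)$$ then $\hat\nabla_a(\Omega^\beta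 A^{abc})=\Omega^\beta\nabla_aA^{abc}$ for all $\Omega$. Conversely, if this holds for all $\Omega$ and $A^{(abc)}$ is not everywhere of the form $g^{(ab}w^{c)}$, then $\beta=-(d+4)$, all traces of $A^{abc}$ vanish and $(\ast)$ holds on $U$. **(II) Generating function.** Let $d\ge3$. The fluid variables are a covector $\xi_a$ and a symmetric trace-free tensor $\xi_{ab}$. Put $\mu=\xi^a\xi_a$, $\ell^a=\xi^{ab}\xi_b$, $\nu=\xi^{ab}\xi_a\xi_b$, $\psi_1=\xi^{ab}\xi_{ab}$, $\psi_2=\ell^a\ell_a$, $\psi_3=\nu^2$, $D_j=\frac d2+j$. Let $J$ be $(-\infty,0)$ (time-like $\xi^a$) or $(0,\infty)$ (space-like $\xi^a$), let $\chi^0,\chi^1,\chi^2_1,\chi^2_2,\chi^2_3$ be $C^2$ on $J$, and $$\chi=\chi^0(\mu)+\chi^1(\mu)\nu+\sum_{i=1}^3\chi^2_i(\mu)\psi_i,\quad T^{ab}=\frac{\partial^2\chi}{\partial\xi_a\partial\xi_b},\quad A^{abc}=\frac{\partial^2\chi}{\partial\xi_a\partial\xi_{bc}},\quad S^a=\frac{\partial\chi}{\partial\xi_a}-\xi_bT^{ab}-\xi_{bc}A^{abc},$$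 where derivatives with respect to $\xi_{bc}$ are taken within symmetric trace-free tensors. The subscripts $0,1,2$ below denote the contributions of $\chi^0$, $\chi^1\nu$, $\sum_i\chi^2_i\psi_i$. Under conformal changes $\hat\xi_a=\Omega^2\xi_a$, $\hat\xi_{ab}=\Omega^4\xi_{ab}$. Powers $\mu^s$ mean $|\mu|^s$ when $s$ involves $d$. The following are equivalent: 1. for one (equivalently, every) Lorentzian metric and all $\xi_a,\xi_{ab}$ with $\mu\in J$: $T^{ab}$ is trace-free, and $A^{abc}$ is totally trace-free and satisfies $(\ast)$; 2. for all metrics and all smooth fields $\xi_a,\xi_{ab}$ with $\mu\in J$, $T^{ab}$ and $\nabla_aT^{ab}$ have conformal weight $d+2$, and $A^{abc}$ and $\nabla_aA^{abc}$ have conformal weight $d+4$; 3. there are real constants $c_0,\chi^0_o,\chi^1_o,\chi^2_{1o},\chi^2_o$ such that on $J$ $$\chi^0=c_0+\chi^0_o\mu^{1-d/2},\quad\chi^1=\chi^1_o\mu^{-(d+2)/2},\quad\chi^2_1=\chi^2_{1o}+\chi^2_o\mu^{-D_1},$$ $$\chi^2_2=-\tfrac{4D_1}{\mu}(\chi^2_1-\chi^2_{1o}),\qquad\chi^2_3=\tfrac{2D_1D_2}{\mu^2}(\chi^2_1-\chi^2_{1o}).$$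 In this case $\chi$ has conformal weight $d-2$ if and only if $c_0=\chi^2_{1o}=0$. **(III) Consequences.** Assume 3. Put $f_0=\chi^0-c_0$, $f_2=\chi^2_1-\chi^2_{1o}$, $r^a=\ell^a-\frac\nu\mu\xi^a$, $h^{ab}=g^{ab}-\frac1\mu\xi^a\xi^b$, $\tilde\tau^{ab}=\xi^{ab}-\frac d{d-1}\frac\nu{\mu^2}(\xi^a\xi^b-\frac\mu dg^{ab})-\frac2\mu\xi^{(a}r^{b)}$, and $$X=\psi_1-\tfrac{4D_1}\mu\psi_2+\tfrac{2D_1D_2}{\mu^2}\psi_3,\quad X^a=\frac{\partial X}{\partial\xi_a},\quad X^{ab}=\frac{\partial^2X}{\partial\xi_a\partial\xi_b},\quad Y^{ab}=X^{ab}+\tfrac2\mu X^{(a}\xi^{b)},\quad\tilde Y^{ab}=Y^{ab}-\tfrac{g_{cd}Y^{cd}}{d-1}h^{ab}.$$ Then $T^{ab}$, $A^{abc}$, $S^a$ are the sums of their contributions of orders $0,1,2$, $S^a$ has conformal weight $d$, and: - *Order 0:* $T_0^{ab}=\frac{d(d-2)f_0}{\mu^2}(\xi^a\xi^b-\frac\mu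 dg^{ab})$, $A_0^{abc}=0$, $S_0^a=-\frac{d(d-2)f_0}\mu\xi^a$. - *Order 1:* $$T_1^{ab}=\chi^1\Big[\tfrac{(d+2)(d+4)}{\mu^2}\nu\xi^a\xi^b-\tfrac{4(d+2)}\mu\xi^{(a}\ell^{b)}-\tfrac{d+2}\mu\nu g^{ab}+2\xi^{ab}\Big]$$ $$=\chi^1\tfrac\nu{\mu^2}\tfrac{d^2(d+1)}{d-1}\big(\xi^a\xi^b-\tfrac\mu dg^{ab}\big)-\tfrac{4(d+1)\chi^1}\mu\xi^{(a}r^{b)}+2\chi^1\tilde\tau^{ab},$$ $$A_1^{abc}=\chi^1\Big[2g^{a(b}\xi^{c)}+\xi^ag^{bc}-\tfrac{d+2}\mu\xi^a\xi^b\xi^c\Big],\quad S_1^a=-d(d+1)\chi^1\tfrac\nu\mu\xi^a+2(d+1)\chi^1r^a.$$ - *Order 2:* $X^a=\frac{8D_1}{\mu^2}(\ell^2\xi^a+D_2\nu r^a-\mu\xi^{ac}\ell_c)$, $$X^{ab}=\tfrac{8D_1}{\mu^3}\Big[-\mu^2\xi^{ac}\xi^b{}_c+4\mu\xi^{(a}\xi^{b)c}\ell_c+\ell^2\mu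 g^{ab}-4\ell^2\xi^a\xi^b+D_2\big(-8\nu\xi^{(a}\ell^{b)}-\nu^2g^{ab}+\tfrac{6\nu^2}\mu\xi^a\xi^b+2\mu\ell^a\ell^b+\nu\mu\xi^{ab}\big)\Big],$$ where $\ell^2=\ell_a\ell^a$; moreover $Y^{ab}\xi_b=0$, and $$T_2^{ab}=\tfrac{2D_1Xf_2}{\mu^2}(2D_2\xi^a\xi^b-\mu g^{ab})-\tfrac{4D_1f_2}\mu X^{(a}\xi^{b)}+f_2X^{ab}$$ $$=\tfrac{f_2X}{\mu^2}\tfrac{d(d+2)(d+3)}{d-1}\big(\xi^a\xi^b-\tfrac\mu dg^{ab}\big)-\tfrac{2(d+3)f_2}\mu X^{(a}\xi^{b)}+f_2\tilde Y^{ab},$$ $$A_2^{abc}=\tfrac{4D_1f_2}{\mu^3}\xi^a\Big[-\mu^2\xi^{bc}+4D_2\mu\big(\xi^{(b}\ell^{c)}-\tfrac\nu dg^{bc}\big)-2D_2D_3\nu\big(\xi^b\xi^c-\tfrac\mu dg^{bc}\big)\Big]-\tfrac{8D_1f_2}\mu\Big[g^{a(b}\ell^{c)}+\xi^{(b}\xi^{c)a}-\tfrac2dg^{bc}\ell^a\Big]$$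 $$+\tfrac{8D_1D_2f_2}{\mu^2}\Big[\ell^a\big(\xi^b\xi^c-\tfrac\mu dg^{bc}\big)+\nu\big(g^{a(b}\xi^{c)}-\tfrac1d\xi^ag^{bc}\big)\Big],$$ $$S_2^a=-\tfrac{(d+2)^2f_2}\mu\Big[\big(\psi_1-\tfrac{4D_2}\mu\psi_2+\tfrac{2D_2D_3}{\mu^2}\psi_3\big)\xi^a-\tfrac{2(d+4)\nu}\mu\ell^a+4\xi^{ab}\ell_b\Big]$$ $$=-\tfrac{(d+2)^2f_2}\mu\Big[\Big(\tfrac{d^2(d+1)}{2(d-1)}\tfrac{\nu^2}{\mu^2}-\tfrac{2(d+1)}\mu r^cr_c+\tilde\tau^{bc}\tilde\tau_{bc}\Big)\xi^a-\tfrac{2d(d+1)}{d-1}\tfrac\nu\mu r^a+4\tilde\tau^{ab}r_b\Big].$$ - *Thermodynamics* (time-like $\xi^a$, $u^a=\xi^a/\sqrt{-\mu}$, temperature $\Theta=1/\sqrt{-\mu}$): with $\rho=T^{ab}u_au_b$ and $p=T^{ab}(g_{ab}+u_au_b)/(d-1)$, the equation of state $p=\rho/(d-1)$ holds for $T^{ab}$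 and at each order, with $p_0=2\,d\chi^0/d\mu$, $\rho_0=-\frac{(d-1)(d-2)f_0}\mu$, $\rho_1=-d(d+1)\chi^1\frac\nu\mu$, $\rho_2=-(d+2)(d+3)\frac{f_2X}\mu$; $T_0^{ab}=(\rho_0+p_0)u^au^b+p_0g^{ab}$; the heat flux $q^a=-(\delta^a_b+u^au_b)T_1^{bc}u_c$ equals $\frac{2(d+1)\chi^1}{\sqrt{-\mu}}r^a$; and $S_0^a=\frac d{d-1}\frac{\rho_0}\Theta u^a$, $S_1^a=\frac{\rho_1}\Theta u^a+\frac{q^a}\Theta$. -/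

import Mathlib

open scoped ContDiff

namespace ConformalFluid

noncomputable section

/-! ### Tensors in components -/

/-- Vectors or covectors in `d` dimensions, given by their components. -/
abbrev Vec (d : ℕ) := Fin d → ℝ

/-- Tensors of rank two, given by their components. -/
abbrev Mat (d : ℕ) := Matrix (Fin d) (Fin d) ℝ

/-- Tensors of rank three, given by their components. -/
abbrev Ten (d : ℕ) := Fin d → Fin d → Fin d → ℝ

variable {d : ℕ}

/-- The partial derivative `∂f/∂x_a`. -/
def pd (f : Vec d → ℝ) (a : Fin d) (x : Vec d) : ℝ :=
  lineDeriv ℝ f x (Pi.single a 1)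

/-- The standard Minkowski matrix `diag(-1, 1, …, 1)`. -/
def minkowski (d : ℕ) : Mat d :=
  Matrix.diagonal fun i => if (i : ℕ) = 0 then -1 else 1

/-- `g` is the component matrix `g_ab` of a Lorentzian metric of signature `(-,+,…,+)`. -/
def IsLorentzian (g : Mat d) : Prop :=
  ∃ P : Mat d, IsUnit P.det ∧ g = P.transpose * minkowski d * P

/-- Full contraction `Σ_ab G_ab M^ab` of two tensors of rank two. -/
def contract (G M : Mat d) : ℝ := ∑ a, ∑ b, G a b * M a b

/-- The symmetrized product `v^(a w^b)`. -/
def sprod (v w : Vec d) (a b : Fin d) : ℝ := (v a * w b + v b * w a) / 2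

/-- Trace-freeness of `A^abc` in every pair of indices. -/
def IsTotallyTraceFree (g : Mat d) (A : Ten d) : Prop :=
  ∀ c, contract g (fun a b => A a b c) = 0 ∧ contract g (fun a b => A a c b) = 0 ∧
    contract g (A c) = 0

/-- The condition `n_a A^abc = n_a A^(bc)a` for all covectors `n_a`. -/
def SymmetryCondition (A : Ten d) : Prop :=
  ∀ (n : Vec d) (b c : Fin d),
    ∑ a, n a * A a b c = ∑ a, n a * ((A b c a + A c b a) / 2)

/-! ### Covariant divergences on a coordinate domain and conformal changes of the metric -/

/-- `g` is a smooth Lorentzian metric on the coordinate domain `U`. -/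
def IsMetricOn (U : Set (Vec d)) (g : Vec d → Mat d) : Prop :=
  (∀ a b, ContDiffOn ℝ ∞ (fun x => g x a b) U) ∧ ∀ x ∈ U, IsLorentzian (g x)

/-- The Christoffel symbols `Γ^a_bc` of the Levi-Civita connection of `g`. -/
def christoffel (g : Vec d → Mat d) (x : Vec d) (a b c : Fin d) : ℝ :=
  ∑ e, (g x)⁻¹ a e / 2 *
    (pd (fun y => g y e c) b x + pd (fun y => g y b e) c x - pd (fun y => g y b c) e x)

/-- The covariant divergence `∇_a T^ab`. -/
def divT (g : Vec d → Mat d) (T : Vec d → Mat d) (x : Vec d) (b : Fin d) : ℝ :=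
  ∑ a, pd (fun y => T y a b) a x +
    ∑ a, ∑ c, (christoffel g x a a c * T x c b + christoffel g x b a c * T x a c)

/-- The covariant divergence `∇_a A^abc`. -/
def divA (g : Vec d → Mat d) (A : Vec d → Ten d) (x : Vec d) (b c : Fin d) : ℝ :=
  ∑ a, pd (fun y => A y a b c) a x +
    ∑ a, ∑ e, (christoffel g x a a e * A x e b c + christoffel g x b a e * A x a e c +
      christoffel g x c a e * A x a b e)

/-- `Ω` is an admissible conformal factor on `U`. -/
def IsConformalFactor (U : Set (Vec d)) (Ω : Vec d → ℝ) : Prop :=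
  ContDiffOn ℝ ∞ Ω U ∧ ∀ x ∈ U, 0 < Ω x

/-- The conformally related metric `Ω² g`. -/
def rescale (Ω : Vec d → ℝ) (g : Vec d → Mat d) : Vec d → Mat d :=
  fun x => Ω x ^ 2 • g x

/-- The divergence of `T^ab` is unaffected (up to the overall factor) by every conformal change
`g ↦ Ω² g`, `T^ab ↦ Ω^α T^ab`. -/
def ConformallyInvariantT (U : Set (Vec d)) (g T : Vec d → Mat d) (α : ℝ) : Prop :=
  ∀ Ω : Vec d → ℝ, IsConformalFactor U Ω → ∀ x ∈ U, ∀ b,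
    divT (rescale Ω g) (fun y => Ω y ^ α • T y) x b = Ω x ^ α * divT g T x b

/-- The divergence of `A^abc` is unaffected (up to the overall factor) by every conformal change
`g ↦ Ω² g`, `A^abc ↦ Ω^β A^abc`. -/
def ConformallyInvariantA (U : Set (Vec d)) (g : Vec d → Mat d) (A : Vec d → Ten d)
    (β : ℝ) : Prop :=
  ∀ Ω : Vec d → ℝ, IsConformalFactor U Ω → ∀ x ∈ U, ∀ b c,
    divA (rescale Ω g) (fun y => Ω y ^ β • A y) x b c = Ω x ^ β * divA g A x b c

/-! ### The fluid variables `ξ_a`, `ξ_ab` and the scalars built from them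

`ξ` stands for the components `ξ_a` and `Ξ` for the components `ξ_ab` (lower indices). -/

/-- `ξ_ab` is symmetric and trace-free. -/
def IsSTF (g : Mat d) (Ξ : Mat d) : Prop := Ξ.IsSymm ∧ contract g⁻¹ Ξ = 0

/-- `ξ^a`. -/
def up (g : Mat d) (ξ : Vec d) : Vec d := g⁻¹.mulVec ξ

/-- Lowering of an index. -/
def low (g : Mat d) (v : Vec d) : Vec d := g.mulVec v

/-- `ξ^ab`. -/
def upM (g : Mat d) (Ξ : Mat d) : Mat d := g⁻¹ * Ξ * g⁻¹

/-- `μ = ξ^a ξ_a`. -/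
def mu (g : Mat d) (ξ : Vec d) : ℝ := ∑ a, up g ξ a * ξ a

/-- `ℓ^a = ξ^ab ξ_b`. -/
def ell (g : Mat d) (ξ : Vec d) (Ξ : Mat d) : Vec d := (upM g Ξ).mulVec ξ

/-- `ξ^ab ℓ_b`. -/
def ell2 (g : Mat d) (ξ : Vec d) (Ξ : Mat d) : Vec d := (upM g Ξ).mulVec (low g (ell g ξ Ξ))

/-- `ν = ξ^ab ξ_a ξ_b`. -/
def nu (g : Mat d) (ξ : Vec d) (Ξ : Mat d) : ℝ := ∑ a, ∑ b, upM g Ξ a b * ξ a * ξ b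

/-- `ψ₁ = ξ^ab ξ_ab`. -/
def psi1 (g : Mat d) (Ξ : Mat d) : ℝ := contract (upM g Ξ) Ξ

/-- `ψ₂ = ξ^ab ξ_b ξ_ac ξ^c`. -/
def psi2 (g : Mat d) (ξ : Vec d) (Ξ : Mat d) : ℝ := ∑ a, ell g ξ Ξ a * Ξ.mulVec (up g ξ) a

/-- `ψ₃ = ν²`. -/
def psi3 (g : Mat d) (ξ : Vec d) (Ξ : Mat d) : ℝ := nu g ξ Ξ ^ 2

/-! ### The generating function and the tensors derived from it -/

/-- The coefficient functions `χ⁰, χ¹, χ²₁, χ²₂, χ²₃` of `μ`. -/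
structure Coeffs where
  zero : ℝ → ℝ
  one : ℝ → ℝ
  two1 : ℝ → ℝ
  two2 : ℝ → ℝ
  two3 : ℝ → ℝ

namespace Coeffs

/-- All coefficient functions are twice continuously differentiable on `J`. -/
def IsC2On (K : Coeffs) (J : Set ℝ) : Prop :=
  ContDiffOn ℝ 2 K.zero J ∧ ContDiffOn ℝ 2 K.one J ∧ ContDiffOn ℝ 2 K.two1 J ∧
    ContDiffOn ℝ 2 K.two2 J ∧ ContDiffOn ℝ 2 K.two3 J

/-- Order zero: `χ⁰(μ)`. -/
def ord0 (K : Coeffs) (g : Mat d) (ξ : Vec d) (_Ξ : Mat d) : ℝ := K.zero (mu g ξ)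

/-- Order one: `χ¹(μ) ν`. -/
def ord1 (K : Coeffs) (g : Mat d) (ξ : Vec d) (Ξ : Mat d) : ℝ := K.one (mu g ξ) * nu g ξ Ξ

/-- Order two: `Σ_i χ²_i(μ) ψ_i`. -/
def ord2 (K : Coeffs) (g : Mat d) (ξ : Vec d) (Ξ : Mat d) : ℝ :=
  K.two1 (mu g ξ) * psi1 g Ξ + K.two2 (mu g ξ) * psi2 g ξ Ξ + K.two3 (mu g ξ) * psi3 g ξ Ξ

/-- The generating function `χ = χ⁰(μ) + χ¹(μ) ν + Σ_i χ²_i(μ) ψ_i`. -/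
def chi (K : Coeffs) (g : Mat d) (ξ : Vec d) (Ξ : Mat d) : ℝ :=
  K.ord0 g ξ Ξ + K.ord1 g ξ Ξ + K.ord2 g ξ Ξ

end Coeffs

/-- The vector `∂χ/∂ξ_a`. -/
def gradXi (χ : Vec d → Mat d → ℝ) (ξ : Vec d) (Ξ : Mat d) : Vec d :=
  fun a => pd (fun η => χ η Ξ) a ξ

/-- `T^ab = ∂²χ / ∂ξ_a ∂ξ_b`. -/
def stress (χ : Vec d → Mat d → ℝ) (ξ : Vec d) (Ξ : Mat d) : Mat d :=
  fun a b => pd (fun η => pd (fun ζ => χ ζ Ξ) b η) a ξ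

/-- The direction `∂ξ_ae / ∂ξ_bc = δ_a^(b δ_e^c) - g_ae g^bc / d` in the space of symmetric
trace-free tensors. -/
def stfUnit (g : Mat d) (b c : Fin d) : Mat d := fun a e =>
  ((if a = b ∧ e = c then 1 else 0) + (if a = c ∧ e = b then 1 else 0)) / 2
    - g a e * g⁻¹ b c / d

/-- `A^abc = ∂²χ / ∂ξ_a ∂ξ_bc`, where the derivative with respect to the symmetric trace-free
tensor `ξ_bc` is symmetric and trace-free. -/
def dissip (g : Mat d) (χ : Vec d → Mat d → ℝ) (ξ : Vec d) (Ξ : Mat d) : Ten d :=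
  fun a b c => pd (fun η => lineDeriv ℝ (χ η) Ξ (stfUnit g b c)) a ξ

/-- The entropy current `S^a = ∂χ/∂ξ_a - ξ_b T^ab - ξ_bc A^abc`. -/
def entropy (g : Mat d) (χ : Vec d → Mat d → ℝ) (ξ : Vec d) (Ξ : Mat d) : Vec d := fun a =>
  gradXi χ ξ Ξ a - ∑ b, ξ b * stress χ ξ Ξ a b - ∑ b, ∑ c, Ξ b c * dissip g χ ξ Ξ a b c

/-! ### Conformal invariance of the theory -/

/-- At the metric `g` and for all values of the fluid variables with `μ ∈ J`: `T^ab` is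
trace-free, `A^abc` is totally trace-free, and `n_a A^abc = n_a A^(bc)a`. -/
def ConformalConditions (K : Coeffs) (J : Set ℝ) (g : Mat d) : Prop :=
  ∀ ξ Ξ, mu g ξ ∈ J → IsSTF g Ξ →
    contract g (stress (K.chi g) ξ Ξ) = 0 ∧
    IsTotallyTraceFree g (dissip g (K.chi g) ξ Ξ) ∧
    SymmetryCondition (dissip g (K.chi g) ξ Ξ)

/-- Conformal invariance of the fluid equations in dimension `d`: for all metrics and all fields
`ξ_a, ξ_ab` with `μ ∈ J`, under `g ↦ Ω² g`, `ξ_a ↦ Ω² ξ_a`, `ξ_ab ↦ Ω⁴ ξ_ab` the tensor `T^ab` has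
conformal weight `d + 2`, the tensor `A^abc` has conformal weight `d + 4`, and so have their
covariant divergences. -/
def IsConformalFluid (d : ℕ) (K : Coeffs) (J : Set ℝ) : Prop :=
  ∀ (U : Set (Vec d)) (g : Vec d → Mat d) (ξ : Vec d → Vec d) (Ξ : Vec d → Mat d)
    (Ω : Vec d → ℝ),
    IsOpen U → IsMetricOn U g → IsConformalFactor U Ω →
    (∀ a, ContDiffOn ℝ ∞ (fun x => ξ x a) U) →
    (∀ a b, ContDiffOn ℝ ∞ (fun x => Ξ x a b) U) →
    (∀ x ∈ U, mu (g x) (ξ x) ∈ J ∧ IsSTF (g x) (Ξ x)) →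
    let T : Vec d → Mat d := fun x => stress (K.chi (g x)) (ξ x) (Ξ x)
    let A : Vec d → Ten d := fun x => dissip (g x) (K.chi (g x)) (ξ x) (Ξ x)
    let g' : Vec d → Mat d := rescale Ω g
    let T' : Vec d → Mat d := fun x => stress (K.chi (g' x)) (Ω x ^ 2 • ξ x) (Ω x ^ 4 • Ξ x)
    let A' : Vec d → Ten d :=
      fun x => dissip (g' x) (K.chi (g' x)) (Ω x ^ 2 • ξ x) (Ω x ^ 4 • Ξ x)
    ∀ x ∈ U,
      T' x = Ω x ^ (-((d : ℝ) + 2)) • T x ∧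
      A' x = Ω x ^ (-((d : ℝ) + 4)) • A x ∧
      (∀ b, divT g' T' x b = Ω x ^ (-((d : ℝ) + 2)) * divT g T x b) ∧
      (∀ b c, divA g' A' x b c = Ω x ^ (-((d : ℝ) + 4)) * divA g A x b c)

/-- `D_j = d/2 + j`. -/
def D (d j : ℕ) : ℝ := (d : ℝ) / 2 + j

/-- The coefficient functions have the conformal form with constants `c₀` (additive constant of
`χ⁰`), `a = χ⁰_o`, `b = χ¹_o`, `k = χ²_1o`, `e = χ²_o`; powers of `μ` are powers of `|μ|`. -/
def HasConformalForm (d : ℕ) (K : Coeffs) (J : Set ℝ) (c₀ a b k e : ℝ) : Prop :=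
  ∀ μ ∈ J,
    K.zero μ = c₀ + a * |μ| ^ (1 - (d : ℝ) / 2) ∧
    K.one μ = b * |μ| ^ (-((d : ℝ) + 2) / 2) ∧
    K.two1 μ = k + e * |μ| ^ (-D d 1) ∧
    K.two2 μ = -(4 * D d 1 / μ) * (K.two1 μ - k) ∧
    K.two3 μ = 2 * D d 1 * D d 2 / μ ^ 2 * (K.two1 μ - k)

/-! ### Auxiliary tensors for the explicit expressions -/

/-- `r^a = ℓ^a - (ν/μ) ξ^a`. -/
def rvec (g : Mat d) (ξ : Vec d) (Ξ : Mat d) : Vec d :=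
  fun a => ell g ξ Ξ a - nu g ξ Ξ / mu g ξ * up g ξ a

/-- `h^ab = g^ab - ξ^a ξ^b / μ`. -/
def hproj (g : Mat d) (ξ : Vec d) : Mat d :=
  fun a b => g⁻¹ a b - up g ξ a * up g ξ b / mu g ξ

/-- `ξ^a ξ^b - (μ/d) g^ab`. -/
def xixi (g : Mat d) (ξ : Vec d) : Mat d :=
  fun a b => up g ξ a * up g ξ b - mu g ξ / d * g⁻¹ a b

/-- `τ̃^ab`, the trace-free part of `ξ^ab` that is orthogonal to `ξ_a`. -/
def tauT (g : Mat d) (ξ : Vec d) (Ξ : Mat d) : Mat d := fun a b =>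
  upM g Ξ a b - d / ((d : ℝ) - 1) * (nu g ξ Ξ / mu g ξ ^ 2) * xixi g ξ a b
    - 2 / mu g ξ * sprod (up g ξ) (rvec g ξ Ξ) a b

/-- `X = ψ₁ - (4 D₁/μ) ψ₂ + (2 D₁ D₂/μ²) ψ₃`. -/
def Xs (g : Mat d) (ξ : Vec d) (Ξ : Mat d) : ℝ :=
  psi1 g Ξ - 4 * D d 1 / mu g ξ * psi2 g ξ Ξ
    + 2 * D d 1 * D d 2 / mu g ξ ^ 2 * psi3 g ξ Ξ

/-- `X^a = (8 D₁/μ²) (ℓ² ξ^a + D₂ ν r^a - μ ξ^ac ℓ_c)`. -/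
def Xv (g : Mat d) (ξ : Vec d) (Ξ : Mat d) : Vec d := fun a =>
  8 * D d 1 / mu g ξ ^ 2 *
    (psi2 g ξ Ξ * up g ξ a + D d 2 * nu g ξ Ξ * rvec g ξ Ξ a - mu g ξ * ell2 g ξ Ξ a)

/-- `X^ab = (8 D₁/μ³) [-μ² ξ^ac ξ^b_c + 4 μ ξ^(a ξ^b)c ℓ_c + ℓ² μ g^ab - 4 ℓ² ξ^a ξ^b
+ D₂ (-8 ν ξ^(a ℓ^b) - ν² g^ab + 6 (ν²/μ) ξ^a ξ^b + 2 μ ℓ^a ℓ^b + ν μ ξ^ab)]`. -/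
def Xt (g : Mat d) (ξ : Vec d) (Ξ : Mat d) : Mat d := fun a b =>
  8 * D d 1 / mu g ξ ^ 3 *
    (-(mu g ξ ^ 2 * (upM g Ξ * g * upM g Ξ) a b)
      + 4 * mu g ξ * sprod (up g ξ) (ell2 g ξ Ξ) a b
      + psi2 g ξ Ξ * mu g ξ * g⁻¹ a b - 4 * psi2 g ξ Ξ * (up g ξ a * up g ξ b)
      + D d 2 * (-(8 * nu g ξ Ξ * sprod (up g ξ) (ell g ξ Ξ) a b)
        - nu g ξ Ξ ^ 2 * g⁻¹ a b + 6 * (nu g ξ Ξ ^ 2 / mu g ξ) * (up g ξ a * up g ξ b)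
        + 2 * mu g ξ * (ell g ξ Ξ a * ell g ξ Ξ b) + nu g ξ Ξ * mu g ξ * upM g Ξ a b))

/-- `Y^ab = X^ab + (2/μ) X^(a ξ^b)`, the part of `X^ab` orthogonal to `ξ_a`. -/
def Yt (g : Mat d) (ξ : Vec d) (Ξ : Mat d) : Mat d := fun a b =>
  Xt g ξ Ξ a b + 2 / mu g ξ * sprod (Xv g ξ Ξ) (up g ξ) a b

/-- `Ỹ^ab`, the trace-free part of `Y^ab` in the space orthogonal to `ξ_a`. -/
def YtT (g : Mat d) (ξ : Vec d) (Ξ : Mat d) : Mat d := fun a b =>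
  Yt g ξ Ξ a b - contract g (Yt g ξ Ξ) / ((d : ℝ) - 1) * hproj g ξ a b

/-- `G^a = G ξ^a - (2 (d+4) ν/μ) ℓ^a + 4 ξ^ab ℓ_b` with
`G = ψ₁ - (4 D₂/μ) ψ₂ + (2 D₂ D₃/μ²) ψ₃`. -/
def Gv (g : Mat d) (ξ : Vec d) (Ξ : Mat d) : Vec d := fun a =>
  (psi1 g Ξ - 4 * D d 2 / mu g ξ * psi2 g ξ Ξ
      + 2 * D d 2 * D d 3 / mu g ξ ^ 2 * psi3 g ξ Ξ) * up g ξ a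
    - 2 * ((d : ℝ) + 4) * nu g ξ Ξ / mu g ξ * ell g ξ Ξ a + 4 * ell2 g ξ Ξ a

/-! ### Thermodynamic variables for time-like `ξ_a` -/

/-- The temperature `1/√(-μ)`. -/
def temperature (g : Mat d) (ξ : Vec d) : ℝ := 1 / √(-mu g ξ)

/-- The velocity `u^a = ξ^a/√(-μ)`. -/
def vel (g : Mat d) (ξ : Vec d) : Vec d := fun a => up g ξ a / √(-mu g ξ)

/-- `u_a`. -/
def velLow (g : Mat d) (ξ : Vec d) : Vec d := fun a => ξ a / √(-mu g ξ)

/-- The energy density `ρ = T^ab u_a u_b`. -/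
def density (g : Mat d) (ξ : Vec d) (T : Mat d) : ℝ :=
  ∑ a, ∑ b, T a b * velLow g ξ a * velLow g ξ b

/-- The pressure `p = T^ab (g_ab + u_a u_b) / (d - 1)`. -/
def pressure (g : Mat d) (ξ : Vec d) (T : Mat d) : ℝ :=
  (∑ a, ∑ b, T a b * (g a b + velLow g ξ a * velLow g ξ b)) / ((d : ℝ) - 1)

/-- The heat flux `q^a = -(δ^a_b + u^a u_b) T^bc u_c`. -/
def heatFlux (g : Mat d) (ξ : Vec d) (T : Mat d) : Vec d := fun a =>
  -(∑ c, T a c * velLow g ξ c + vel g ξ a * density g ξ T)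

end

end ConformalFluid

namespace ConformalFluid

variable {d : ℕ}

/-! ### Algebra of a Lorentzian metric -/

/-! Requirements on tensor fields. Under g ↦ Ω²g the Levi-Civita connection changes by a tensor that
is algebraic in g and linear in Υ = d log Ω (`christoffel_rescale`). A rescaled divergence is
therefore the old one, times a power of Ω, plus a term linear in Υ (`divT_rescale`, `divA_rescale`).
The factors exp(n·y) realise every constant Υ = n, so invariance is equivalent to an identity at
each point: (α+d+2) T^ab = (tr T) g^ab, respectively (β+d+2) A^abc + A^bca + A^cab = g^ab t^c + g^ac
t^b with t^c = g_pq A^pqc. The statements on weights, traces and symmetry are linear algebra on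
these two identities.

Generating function. All derivatives of χ are combinations of ξ^a, ℓ^a, ξ^ac ℓ_c, g^ab, ξ^ab, ξ^ac
ξ^b_c with scalar coefficients, recorded in `hess0`, `hess1`, `hess2`, `mixed1`, `mixed2`. The
derivatives K', K'' of the coefficient functions enter there as free parameters, so the same
formulas serve arbitrary C² coefficients, the conformal ones, and the scalar X.

For necessity, total symmetry of A^abc is evaluated on three mutually orthogonal non-null covectors,
which exist because d ≥ 3. This yields four linear relations among χ¹, χ²_i and their first
derivatives (`ConformalConditions.relations`); the trace of T^ab is needed only at ξ_ab = 0, where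
it gives an equation for χ⁰. These are Euler equations on a half-line, and their solutions are
powers of |μ| up to two additive constants (`exists_conformalForm_of_relations`). For sufficiency,
each nonconstant part f satisfies f' = (s/μ) f, so every condition becomes a rational identity in μ
and f.

For field equations, T and A involve no derivatives of the fields, so their weights are statements
about rescaling by the constant c = Ω(x); the weights of the divergences then follow from the first
part. Conversely, constant fields with arbitrary Ω already bring the pointwise conditions back.

Explicit expressions. At order two, χ equals f₂X + kψ₁, and kψ₁ is invisible to ∂/∂ξ_a. The scalar X
is homogeneous of degree zero in ξ_a, which explains X^a ξ_a = 0 and Y^ab ξ_b = 0. -/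

theorem minkowski_mul_self (d : ℕ) : minkowski d * minkowski d = 1 := by
  rw [minkowski, Matrix.diagonal_mul_diagonal, ← Matrix.diagonal_one]
  congr 1
  funext i
  split_ifs <;> norm_num

theorem IsLorentzian.isSymm {g : Mat d} (hg : IsLorentzian g) : g.IsSymm := by
  obtain ⟨P, -, rfl⟩ := hg
  simp [Matrix.IsSymm, Matrix.transpose_mul, minkowski, Matrix.mul_assoc]

theorem IsLorentzian.isUnit_det {g : Mat d} (hg : IsLorentzian g) : IsUnit g.det := by
  obtain ⟨P, hP, rfl⟩ := hg
  have h : IsUnit (minkowski d).det := by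
    refine IsUnit.of_mul_eq_one (minkowski d).det ?_
    rw [← Matrix.det_mul, minkowski_mul_self, Matrix.det_one]
  rw [Matrix.det_mul, Matrix.det_mul, Matrix.det_transpose]
  exact (hP.mul h).mul hP

theorem IsLorentzian.mul_inv {g : Mat d} (hg : IsLorentzian g) : g * g⁻¹ = 1 :=
  Matrix.mul_nonsing_inv _ hg.isUnit_det

theorem IsLorentzian.inv_mul {g : Mat d} (hg : IsLorentzian g) : g⁻¹ * g = 1 :=
  Matrix.nonsing_inv_mul _ hg.isUnit_det

theorem IsLorentzian.inv_isSymm {g : Mat d} (hg : IsLorentzian g) : (g⁻¹).IsSymm := by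
  rw [Matrix.IsSymm, Matrix.transpose_nonsing_inv, hg.isSymm]

theorem IsLorentzian.smul {g : Mat d} (hg : IsLorentzian g) {c : ℝ} (hc : 0 < c) :
    IsLorentzian (c ^ 2 • g) := by
  obtain ⟨P, hP, rfl⟩ := hg
  refine ⟨c • P, ?_, ?_⟩
  · rw [Matrix.det_smul]
    exact (IsUnit.mk0 _ (pow_ne_zero _ hc.ne')).mul hP
  · simp only [Matrix.transpose_smul, Matrix.smul_mul, Matrix.mul_smul, smul_smul, sq]

theorem inv_smul_of_isLorentzian {g : Mat d} (hg : IsLorentzian g) {c : ℝ} (hc : c ≠ 0) :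
    (c • g)⁻¹ = c⁻¹ • g⁻¹ := by
  refine Matrix.inv_eq_right_inv ?_
  rw [Matrix.smul_mul, Matrix.mul_smul, smul_smul, hg.mul_inv, mul_inv_cancel₀ hc, one_smul]

theorem IsLorentzian.sum_inv_mul {g : Mat d} (hg : IsLorentzian g) (a c : Fin d) :
    ∑ e, g⁻¹ a e * g e c = if a = c then 1 else 0 := by
  rw [← Matrix.mul_apply, hg.inv_mul, Matrix.one_apply]

theorem IsLorentzian.sum_mul_inv {g : Mat d} (hg : IsLorentzian g) (a c : Fin d) :
    ∑ e, g a e * g⁻¹ e c = if a = c then 1 else 0 := by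
  rw [← Matrix.mul_apply, hg.mul_inv, Matrix.one_apply]

theorem contract_inv {g : Mat d} (hg : IsLorentzian g) : contract g g⁻¹ = d := by
  have h : ∀ a, ∑ b, g a b * g⁻¹ a b = 1 := fun a => by
    simpa [hg.inv_isSymm.apply] using hg.sum_mul_inv a a
  simp [contract, h]

theorem low_up {g : Mat d} (hg : IsLorentzian g) (v : Vec d) : low g (up g v) = v := by
  rw [low, up, Matrix.mulVec_mulVec, hg.mul_inv, Matrix.one_mulVec]

theorem up_low {g : Mat d} (hg : IsLorentzian g) (v : Vec d) : up g (low g v) = v := by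
  rw [low, up, Matrix.mulVec_mulVec, hg.inv_mul, Matrix.one_mulVec]

theorem contract_smul_left (c : ℝ) (G M : Mat d) : contract (c • G) M = c * contract G M := by
  simp [contract, Finset.mul_sum, mul_assoc]

/-! ### Partial derivatives -/

theorem pd_eq_fderiv {f : Vec d → ℝ} {x : Vec d} (hf : DifferentiableAt ℝ f x) (a : Fin d) :
    pd f a x = fderiv ℝ f x (Pi.single a 1) := hf.lineDeriv_eq_fderiv

theorem pd_congr {f h : Vec d → ℝ} {x : Vec d} (hfh : f =ᶠ[nhds x] h) (a : Fin d) :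
    pd f a x = pd h a x := hfh.lineDeriv_eq

theorem pd_mul {f h : Vec d → ℝ} {x : Vec d} (hf : DifferentiableAt ℝ f x)
    (hh : DifferentiableAt ℝ h x) (a : Fin d) :
    pd (fun y => f y * h y) a x = pd f a x * h x + f x * pd h a x := by
  rw [pd_eq_fderiv (hf.fun_mul hh), pd_eq_fderiv hf, pd_eq_fderiv hh, fderiv_fun_mul hf hh]
  simp [mul_comm, add_comm]

/-- Written with the factor f^s in front and the logarithmic derivative behind, so that a power of Ω
can be pulled out of a whole divergence. -/
theorem pd_rpow {f : Vec d → ℝ} {x : Vec d} (hf : DifferentiableAt ℝ f x) (h0 : 0 < f x) (s : ℝ)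
    (a : Fin d) : pd (fun y => f y ^ s) a x = f x ^ s * (s * (pd f a x / f x)) := by
  have h := (hf.hasFDerivAt.rpow_const (p := s) (Or.inl h0.ne'))
  rw [pd_eq_fderiv h.differentiableAt, pd_eq_fderiv hf, h.fderiv, Real.rpow_sub_one h0.ne']
  simp
  field_simp

theorem pd_sq {f : Vec d → ℝ} {x : Vec d} (hf : DifferentiableAt ℝ f x) (a : Fin d) :
    pd (fun y => f y ^ 2) a x = 2 * f x * pd f a x := by
  simp only [sq]
  rw [pd_mul hf hf]
  ring

/-! ### Conformal changes of the metric -/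

/-- The gradient `∂_a log Ω`. -/
noncomputable def logGrad (Ω : Vec d → ℝ) (x : Vec d) : Vec d := fun a => pd Ω a x / Ω x

/-- The difference of the Levi-Civita connections of `Ω² g` and `g`, where `Υ = ∂ log Ω`. -/
noncomputable def connDiff (g : Mat d) (Υ : Vec d) (a b c : Fin d) : ℝ :=
  (if a = c then Υ b else 0) + (if a = b then Υ c else 0) - g b c * up g Υ a

/-- In ∂(Ω²g) = Ω²∂g + 2Ω ∂Ω g the first term reproduces the old symbols, since Ω² cancels against
the inverse metric. The second leaves Υ contracted with g⁻¹g, which produces the Kronecker deltas.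
-/
theorem christoffel_rescale {g : Vec d → Mat d} {Ω : Vec d → ℝ} {x : Vec d}
    (hg : IsLorentzian (g x)) (hgd : ∀ a b, DifferentiableAt ℝ (fun y => g y a b) x)
    (hΩ : DifferentiableAt ℝ Ω x) (h0 : Ω x ≠ 0) (a b c : Fin d) :
    christoffel (rescale Ω g) x a b c = christoffel g x a b c +
      connDiff (g x) (logGrad Ω x) a b c := by
  have hinv : ∀ a e, (rescale Ω g x)⁻¹ a e = (Ω x ^ 2)⁻¹ * (g x)⁻¹ a e := fun a e => by
    rw [rescale, inv_smul_of_isLorentzian hg (pow_ne_zero 2 h0)]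
    rfl
  have hpd : ∀ p q r, pd (fun y => rescale Ω g y p q) r x =
      2 * Ω x * pd Ω r x * g x p q + Ω x ^ 2 * pd (fun y => g y p q) r x := fun p q r => by
    rw [← pd_sq hΩ, ← pd_mul (hΩ.fun_pow 2) (hgd p q)]
    rfl
  have hterm : ∀ e, (rescale Ω g x)⁻¹ a e / 2 * (pd (fun y => rescale Ω g y e c) b x +
      pd (fun y => rescale Ω g y b e) c x - pd (fun y => rescale Ω g y b c) e x) =
      (g x)⁻¹ a e / 2 * (pd (fun y => g y e c) b x + pd (fun y => g y b e) c x
        - pd (fun y => g y b c) e x) + (logGrad Ω x b * ((g x)⁻¹ a e * g x e c)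
        + logGrad Ω x c * ((g x)⁻¹ a e * g x e b)
        - g x b c * ((g x)⁻¹ a e * logGrad Ω x e)) := fun e => by
    rw [hinv, hpd, hpd, hpd, hg.isSymm.apply e b]
    simp only [logGrad]
    field_simp
    ring
  simp only [christoffel, hterm]
  rw [Finset.sum_add_distrib, Finset.sum_sub_distrib, Finset.sum_add_distrib, ← Finset.mul_sum,
    ← Finset.mul_sum, ← Finset.mul_sum, hg.sum_inv_mul, hg.sum_inv_mul]
  simp [connDiff, up, Matrix.mulVec, dotProduct]

theorem sum_connDiff {g : Mat d} (hg : IsLorentzian g) (Υ : Vec d) (c : Fin d) :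
    ∑ a, connDiff g Υ a a c = d * Υ c := by
  have h : ∑ a, g a c * up g Υ a = Υ c := by
    have := congrFun (low_up hg Υ) c
    simpa [low, Matrix.mulVec, dotProduct, hg.isSymm.apply] using this
  simp only [connDiff]
  rw [Finset.sum_sub_distrib, Finset.sum_add_distrib, h]
  simp

/-- No symmetry of S is assumed, so the formula also applies to the slices of A^abc with one index
held fixed. -/
theorem sum_connDiff_mul (g S : Mat d) (Υ : Vec d) (b : Fin d) :
    ∑ a, ∑ c, connDiff g Υ b a c * S a c =
      ∑ a, Υ a * S a b + ∑ a, Υ a * S b a - contract g S * up g Υ b := by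
  simp only [connDiff, sub_mul, add_mul, ite_mul, zero_mul, Finset.sum_sub_distrib,
    Finset.sum_add_distrib]
  congr 1
  · congr 1
    · simp
    · rw [Finset.sum_comm]
      simp
  · simp only [contract, Finset.sum_mul]
    exact Finset.sum_congr rfl fun a _ => Finset.sum_congr rfl fun c _ => by ring

/-- The coefficient α + d has two sources: α from differentiating Ω^α and d from the traced
connection difference. Symmetry of T would add the remaining 2. -/
theorem divT_rescale {g T : Vec d → Mat d} {Ω : Vec d → ℝ} {x : Vec d}
    (hg : IsLorentzian (g x)) (hgd : ∀ a b, DifferentiableAt ℝ (fun y => g y a b) x)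
    (hT : ∀ a b, DifferentiableAt ℝ (fun y => T y a b) x)
    (hΩ : DifferentiableAt ℝ Ω x) (h0 : 0 < Ω x) (α : ℝ) (b : Fin d) :
    divT (rescale Ω g) (fun y => Ω y ^ α • T y) x b = Ω x ^ α * (divT g T x b
      + ((α + d) * ∑ a, logGrad Ω x a * T x a b
        + (∑ a, logGrad Ω x a * T x a b + ∑ a, logGrad Ω x a * T x b a
        - contract (g x) (T x) * up (g x) (logGrad Ω x) b))) := by
  have hpd : ∀ a, pd (fun y => (Ω y ^ α • T y) a b) a x =
      Ω x ^ α * (pd (fun y => T y a b) a x + α * (logGrad Ω x a * T x a b)) := fun a => by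
    have : (fun y => (Ω y ^ α • T y) a b) = fun y => Ω y ^ α * T y a b := rfl
    rw [this, pd_mul (hΩ.rpow_const (Or.inl h0.ne')) (hT a b), pd_rpow hΩ h0, logGrad]
    ring
  have h1 := sum_connDiff_mul (g x) (T x) (logGrad Ω x) b
  have h2 : ∑ a, ∑ c, connDiff (g x) (logGrad Ω x) a a c * T x c b =
      d * ∑ c, logGrad Ω x c * T x c b := by
    rw [Finset.sum_comm, Finset.mul_sum]
    refine Finset.sum_congr rfl fun c _ => ?_
    rw [← Finset.sum_mul, sum_connDiff hg]
    ring
  simp only [divT, hpd, christoffel_rescale hg hgd hΩ h0.ne']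
  have h3 : ∀ a c, (christoffel g x a a c + connDiff (g x) (logGrad Ω x) a a c) *
        (Ω x ^ α • T x) c b + (christoffel g x b a c + connDiff (g x) (logGrad Ω x) b a c) *
        (Ω x ^ α • T x) a c = Ω x ^ α * (
        (christoffel g x a a c * T x c b + christoffel g x b a c * T x a c)
        + (connDiff (g x) (logGrad Ω x) a a c * T x c b
        + connDiff (g x) (logGrad Ω x) b a c * T x a c)) :=
    fun a c => by
      simp only [Matrix.smul_apply, smul_eq_mul]
      ring
  simp only [h3, ← Finset.mul_sum, Finset.sum_add_distrib] at h1 h2 ⊢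
  rw [h2, h1]
  ring

/-- Each of the two free indices contributes one connection term of the kind that occurs for T^ab.
-/
theorem divA_rescale {g : Vec d → Mat d} {A : Vec d → Ten d} {Ω : Vec d → ℝ} {x : Vec d}
    (hg : IsLorentzian (g x)) (hgd : ∀ a b, DifferentiableAt ℝ (fun y => g y a b) x)
    (hA : ∀ a b c, DifferentiableAt ℝ (fun y => A y a b c) x)
    (hΩ : DifferentiableAt ℝ Ω x) (h0 : 0 < Ω x) (β : ℝ) (b c : Fin d) :
    divA (rescale Ω g) (fun y => Ω y ^ β • A y) x b c = Ω x ^ β * (divA g A x b c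
      + ((β + d) * ∑ a, logGrad Ω x a * A x a b c
        + (∑ a, logGrad Ω x a * A x a b c + ∑ a, logGrad Ω x a * A x b a c
        - contract (g x) (fun a e => A x a e c) * up (g x) (logGrad Ω x) b)
        + (∑ a, logGrad Ω x a * A x a b c + ∑ a, logGrad Ω x a * A x c b a
        - contract (g x) (fun a e => A x a b e) * up (g x) (logGrad Ω x) c))) := by
  have hpd : ∀ a, pd (fun y => (Ω y ^ β • A y) a b c) a x =
      Ω x ^ β * (pd (fun y => A y a b c) a x + β * (logGrad Ω x a * A x a b c)) := fun a => by
    have : (fun y => (Ω y ^ β • A y) a b c) = fun y => Ω y ^ β * A y a b c := rfl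
    rw [this, pd_mul (hΩ.rpow_const (Or.inl h0.ne')) (hA a b c), pd_rpow hΩ h0, logGrad]
    ring
  have h1 := sum_connDiff_mul (g x) (fun a e => A x a e c) (logGrad Ω x) b
  have h1' := sum_connDiff_mul (g x) (fun a e => A x a b e) (logGrad Ω x) c
  have h2 : ∑ a, ∑ e, connDiff (g x) (logGrad Ω x) a a e * A x e b c =
      d * ∑ e, logGrad Ω x e * A x e b c := by
    rw [Finset.sum_comm, Finset.mul_sum]
    refine Finset.sum_congr rfl fun e _ => ?_
    rw [← Finset.sum_mul, sum_connDiff hg]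
    ring
  simp only [divA, hpd, christoffel_rescale hg hgd hΩ h0.ne']
  have h3 : ∀ a e, (christoffel g x a a e + connDiff (g x) (logGrad Ω x) a a e) *
        (Ω x ^ β • A x) e b c + (christoffel g x b a e + connDiff (g x) (logGrad Ω x) b a e) *
        (Ω x ^ β • A x) a e c + (christoffel g x c a e + connDiff (g x) (logGrad Ω x) c a e) *
        (Ω x ^ β • A x) a b e = Ω x ^ β * (
        (christoffel g x a a e * A x e b c + christoffel g x b a e * A x a e c +
          christoffel g x c a e * A x a b e)
        + (connDiff (g x) (logGrad Ω x) a a e * A x e b c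
        + connDiff (g x) (logGrad Ω x) b a e * A x a e c
        + connDiff (g x) (logGrad Ω x) c a e * A x a b e)) :=
    fun a e => by
      simp only [Pi.smul_apply, smul_eq_mul]
      ring
  simp only [h3, ← Finset.mul_sum, Finset.sum_add_distrib] at h1 h1' h2 ⊢
  rw [h2, h1, h1']
  ring

/-! ### Requirements of conformal invariance on tensor fields -/

theorem isConformalFactor_exp (U : Set (Vec d)) (n : Vec d) :
    IsConformalFactor U fun y => Real.exp (n ⬝ᵥ y) := by
  refine ⟨ContDiff.contDiffOn ?_, fun x _ => Real.exp_pos _⟩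
  unfold dotProduct
  fun_prop

/-- These test factors make Υ an arbitrary constant covector, so an identity linear in Υ can be read
off coefficient by coefficient. -/
theorem logGrad_exp (n x : Vec d) : logGrad (fun y => Real.exp (n ⬝ᵥ y)) x = n := by
  funext a
  have h : HasLineDerivAt ℝ (fun y => Real.exp (n ⬝ᵥ y)) (Real.exp (n ⬝ᵥ x) * n a) x
      (Pi.single a 1) := by
    have h1 : HasDerivAt (fun t : ℝ => n ⬝ᵥ (x + t • Pi.single a 1)) (n a) 0 := by
      simp only [dotProduct_add, dotProduct_smul, dotProduct_single, smul_eq_mul, mul_one]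
      simpa using ((hasDerivAt_id (0 : ℝ)).mul_const (n a)).const_add (n ⬝ᵥ x)
    simpa [HasLineDerivAt] using h1.exp
  rw [logGrad, pd, h.lineDeriv, mul_div_cancel_left₀ _ (Real.exp_ne_zero _)]

section Fields

variable {U : Set (Vec d)} {g : Vec d → Mat d}

theorem IsMetricOn.differentiableAt (hU : IsOpen U) (hg : IsMetricOn U g) {x : Vec d}
    (hx : x ∈ U) (a b : Fin d) : DifferentiableAt ℝ (fun y => g y a b) x :=
  ((hg.1 a b).contDiffAt (hU.mem_nhds hx)).differentiableAt (by simp)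

theorem IsConformalFactor.differentiableAt {Ω : Vec d → ℝ} (hU : IsOpen U)
    (hΩ : IsConformalFactor U Ω) {x : Vec d} (hx : x ∈ U) : DifferentiableAt ℝ Ω x :=
  (hΩ.1.contDiffAt (hU.mem_nhds hx)).differentiableAt (by simp)

/-- The correction to the divergence is Υ_a times the difference of the two sides. It vanishes for
all Ω exactly when this difference vanishes, by testing with Υ equal to each coordinate covector. -/
theorem conformallyInvariantT_iff {T : Vec d → Mat d} {α : ℝ} (hU : IsOpen U)
    (hg : IsMetricOn U g) (hT : ∀ a b, DifferentiableOn ℝ (fun x => T x a b) U)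
    (hs : ∀ x ∈ U, (T x).IsSymm) :
    ConformallyInvariantT U g T α ↔ ∀ x ∈ U, ∀ a b,
      (α + (d + 2)) * T x a b = contract (g x) (T x) * (g x)⁻¹ a b := by
  have key : ∀ Ω : Vec d → ℝ, IsConformalFactor U Ω → ∀ x ∈ U, ∀ b,
      divT (rescale Ω g) (fun y => Ω y ^ α • T y) x b = Ω x ^ α * (divT g T x b
      + ∑ a, logGrad Ω x a * ((α + (d + 2)) * T x a b
        - contract (g x) (T x) * (g x)⁻¹ a b)) := fun Ω hΩ x hx b => by
    rw [divT_rescale (hg.2 x hx) (hg.differentiableAt hU hx)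
      (fun a b => (hT a b).differentiableAt (hU.mem_nhds hx)) (hΩ.differentiableAt hU hx)
      (hΩ.2 x hx)]
    congr 2
    simp only [fun a => (hs x hx).apply a b, up, Matrix.mulVec, dotProduct, Finset.mul_sum,
      ← Finset.sum_add_distrib, ← Finset.sum_sub_distrib,
      fun a => (hg.2 x hx).inv_isSymm.apply a b]
    exact Finset.sum_congr rfl fun a _ => by ring
  constructor
  · intro h x hx a b
    have h1 := h _ (isConformalFactor_exp U (Pi.single a 1)) x hx b
    rw [key _ (isConformalFactor_exp U (Pi.single a 1)) x hx b, logGrad_exp] at h1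
    have h2 := mul_left_cancel₀ (Real.rpow_pos_of_pos (Real.exp_pos _) α).ne' h1
    simpa [Pi.single_apply, sub_eq_zero] using h2
  · intro h Ω hΩ x hx b
    rw [key Ω hΩ x hx b]
    simp [h x hx]

theorem conformallyInvariantT_of_traceFree {T : Vec d → Mat d} {α : ℝ} (hU : IsOpen U)
    (hg : IsMetricOn U g) (hT : ∀ a b, DifferentiableOn ℝ (fun x => T x a b) U)
    (hs : ∀ x ∈ U, (T x).IsSymm) (hα : α = -((d : ℝ) + 2))
    (htr : ∀ x ∈ U, contract (g x) (T x) = 0) : ConformallyInvariantT U g T α := by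
  rw [conformallyInvariantT_iff hU hg hT hs]
  intro x hx a b
  rw [htr x hx, hα]
  ring

theorem contract_eq_zero_of_smul_inv {g : Mat d} (hg : IsLorentzian g) {T : Mat d}
    (h : ∀ a b, contract g T * g⁻¹ a b = 0) : contract g T = 0 := by
  by_contra hne
  have h0 : ∀ a b, g⁻¹ a b = 0 := fun a b => (mul_eq_zero.1 (h a b)).resolve_left hne
  -- Each index a yields a contradiction, because g⁻¹ = 0 violates g⁻¹g = 1; for d = 0 the sum is
  -- empty, so that case needs no separate treatment.
  refine hne (Finset.sum_eq_zero fun a _ => ?_)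
  simpa [h0] using hg.sum_inv_mul a a

theorem ConformallyInvariantT.weight {T : Vec d → Mat d} {α : ℝ} (hU : IsOpen U)
    (hg : IsMetricOn U g) (hT : ∀ a b, DifferentiableOn ℝ (fun x => T x a b) U)
    (hs : ∀ x ∈ U, (T x).IsSymm) (hinv : ConformallyInvariantT U g T α)
    (hne : ∃ x ∈ U, ¬ ∃ φ : ℝ, T x = φ • (g x)⁻¹) : α = -((d : ℝ) + 2) := by
  rw [conformallyInvariantT_iff hU hg hT hs] at hinv
  obtain ⟨x, hx, hne⟩ := hne
  by_contra hα
  have hα' : α + (d + 2) ≠ 0 := fun h => hα (by linarith)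
  refine hne ⟨contract (g x) (T x) / (α + (d + 2)), ?_⟩
  ext a b
  have := hinv x hx a b
  simp only [Matrix.smul_apply, smul_eq_mul]
  field_simp
  linarith

theorem ConformallyInvariantT.traceFree {T : Vec d → Mat d} (hU : IsOpen U)
    (hg : IsMetricOn U g) (hT : ∀ a b, DifferentiableOn ℝ (fun x => T x a b) U)
    (hs : ∀ x ∈ U, (T x).IsSymm) (hinv : ConformallyInvariantT U g T (-((d : ℝ) + 2))) :
    ∀ x ∈ U, contract (g x) (T x) = 0 := by
  rw [conformallyInvariantT_iff hU hg hT hs] at hinv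
  intro x hx
  refine contract_eq_zero_of_smul_inv (hg.2 x hx) fun a b => ?_
  rw [← hinv x hx a b]
  ring

/-- As for T^ab, but each free index also contributes a term in which Υ is contracted with another
slot of A. This is why cyclic permutations of A appear. -/
theorem conformallyInvariantA_iff {A : Vec d → Ten d} {β : ℝ} (hU : IsOpen U)
    (hg : IsMetricOn U g) (hA : ∀ a b c, DifferentiableOn ℝ (fun x => A x a b c) U)
    (hs : ∀ x ∈ U, ∀ a b c, A x a b c = A x a c b) :
    ConformallyInvariantA U g A β ↔ ∀ x ∈ U, ∀ a b c,
      (β + (d + 2)) * A x a b c + A x b c a + A x c a b =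
        (g x)⁻¹ a b * contract (g x) (fun p q => A x p q c)
          + (g x)⁻¹ a c * contract (g x) (fun p q => A x p q b) := by
  have key : ∀ Ω : Vec d → ℝ, IsConformalFactor U Ω → ∀ x ∈ U, ∀ b c,
      divA (rescale Ω g) (fun y => Ω y ^ β • A y) x b c = Ω x ^ β * (divA g A x b c
      + ∑ a, logGrad Ω x a * ((β + (d + 2)) * A x a b c + A x b c a + A x c a b
        - ((g x)⁻¹ a b * contract (g x) (fun p q => A x p q c)
          + (g x)⁻¹ a c * contract (g x) (fun p q => A x p q b)))) := fun Ω hΩ x hx b c => by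
    rw [divA_rescale (hg.2 x hx) (hg.differentiableAt hU hx)
      (fun a b c => (hA a b c).differentiableAt (hU.mem_nhds hx)) (hΩ.differentiableAt hU hx)
      (hΩ.2 x hx)]
    congr 2
    have e : (fun a e => A x a b e) = fun a e => A x a e b :=
      funext fun a => funext fun e => hs x hx a b e
    rw [e]
    simp only [fun a => hs x hx b a c, fun a => hs x hx c b a, up, Matrix.mulVec, dotProduct,
      Finset.mul_sum, ← Finset.sum_add_distrib, ← Finset.sum_sub_distrib,
      fun a => (hg.2 x hx).inv_isSymm.apply a b, fun a => (hg.2 x hx).inv_isSymm.apply a c]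
    exact Finset.sum_congr rfl fun a _ => by ring
  constructor
  · intro h x hx a b c
    have h1 := h _ (isConformalFactor_exp U (Pi.single a 1)) x hx b c
    rw [key _ (isConformalFactor_exp U (Pi.single a 1)) x hx b c, logGrad_exp] at h1
    have h2 := mul_left_cancel₀ (Real.rpow_pos_of_pos (Real.exp_pos _) β).ne' h1
    simpa [Pi.single_apply, sub_eq_zero] using h2
  · intro h Ω hΩ x hx b c
    rw [key Ω hΩ x hx b c]
    simp [h x hx]

/-- A tensor that is symmetric in the last two indices satisfies the symmetry condition if and
only if it is totally symmetric. -/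
theorem symmetryCondition_iff {A : Ten d} (hs : ∀ a b c, A a b c = A a c b) :
    SymmetryCondition A ↔ ∀ a b c, A a b c = A b a c := by
  constructor
  · intro h a b c
    have h1 : ∀ a b c, A a b c = (A b c a + A c b a) / 2 := fun a b c => by
      simpa [Pi.single_apply] using h (Pi.single a 1) b c
    -- By symmetry in the last two slots only the first index matters. With p, q, r the values for
    -- first index a, b, c, the condition gives p = (q+r)/2 and q = (p+r)/2, hence p = q.
    linarith [h1 a b c, h1 b a c, hs b a c, hs a c b, hs c a b]
  · intro h n b c
    refine Finset.sum_congr rfl fun a _ => ?_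
    rw [hs b c a, h b a c, hs c b a, h c a b, hs a c b]
    ring

theorem isTotallyTraceFree_of_symmetric {g : Mat d} {A : Ten d} (hs : ∀ a b c, A a b c = A a c b)
    (hs' : ∀ a b c, A a b c = A b a c) (h : ∀ a, contract g (A a) = 0) :
    IsTotallyTraceFree g A := by
  have h1 : ∀ c, (fun a b => A a b c) = A c := fun c =>
    funext fun a => funext fun b => by rw [hs, hs']
  have h2 : ∀ c, (fun a b => A a c b) = A c := fun c =>
    funext fun a => funext fun b => hs' a c b
  intro c
  rw [h1, h2]
  exact ⟨h c, h c, h c⟩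

theorem conformallyInvariantA_of_traceFree {A : Vec d → Ten d} {β : ℝ} (hU : IsOpen U)
    (hg : IsMetricOn U g) (hA : ∀ a b c, DifferentiableOn ℝ (fun x => A x a b c) U)
    (hs : ∀ x ∈ U, ∀ a b c, A x a b c = A x a c b) (hβ : β = -((d : ℝ) + 4))
    (h : ∀ x ∈ U, IsTotallyTraceFree (g x) (A x) ∧ SymmetryCondition (A x)) :
    ConformallyInvariantA U g A β := by
  rw [conformallyInvariantA_iff hU hg hA hs]
  intro x hx a b c
  obtain ⟨htr, hsym⟩ := h x hx
  rw [(htr c).1, (htr b).1, hβ]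
  rw [symmetryCondition_iff (hs x hx)] at hsym
  linarith [hs x hx b c a, hsym b a c, hsym c a b, hs x hx a c b]

/-- Contraction with g_ab turns the three terms into d t, t and t, and d + 2 is positive. -/
theorem eq_zero_of_symmetrized_inv_eq_zero {g : Mat d} (hg : IsLorentzian g) {t : Vec d}
    (h : ∀ a b c, g⁻¹ a b * t c + g⁻¹ b c * t a + g⁻¹ c a * t b = 0) : t = 0 := by
  funext c
  have h1 : ∑ a, ∑ b, g a b * (g⁻¹ a b * t c + g⁻¹ b c * t a + g⁻¹ c a * t b) = 0 := by
    simp [h]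
  have e1 : ∑ a, ∑ b, g a b * (g⁻¹ a b * t c) = d * t c := by
    rw [← contract_inv hg, contract, Finset.sum_mul]
    exact Finset.sum_congr rfl fun a _ => by
      rw [Finset.sum_mul]
      exact Finset.sum_congr rfl fun b _ => by ring
  have e2 : ∑ a, ∑ b, g a b * (g⁻¹ b c * t a) = t c := by
    simp only [← mul_assoc, ← Finset.sum_mul, hg.sum_mul_inv]
    simp
  have e3 : ∑ a, ∑ b, g a b * (g⁻¹ c a * t b) = t c := by
    rw [Finset.sum_comm]
    simp only [← mul_assoc, ← Finset.sum_mul, fun a b => mul_comm (g a b) (g⁻¹ c a),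
      hg.sum_inv_mul]
    simp
  simp only [mul_add, Finset.sum_add_distrib, e1, e2, e3] at h1
  have h2 : ((d : ℝ) + 2) * t c = 0 := by linarith
  exact (mul_eq_zero.1 h2).resolve_left (by positivity)

theorem ConformallyInvariantA.weight {A : Vec d → Ten d} {β : ℝ} (hU : IsOpen U)
    (hg : IsMetricOn U g) (hA : ∀ a b c, DifferentiableOn ℝ (fun x => A x a b c) U)
    (hs : ∀ x ∈ U, ∀ a b c, A x a b c = A x a c b) (hinv : ConformallyInvariantA U g A β)
    (hne : ∃ x ∈ U, ¬ ∃ w : Vec d, ∀ a b c, A x a b c + A x b c a + A x c a b =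
      (g x)⁻¹ a b * w c + (g x)⁻¹ b c * w a + (g x)⁻¹ c a * w b) : β = -((d : ℝ) + 4) := by
  rw [conformallyInvariantA_iff hU hg hA hs] at hinv
  obtain ⟨x, hx, hne⟩ := hne
  by_contra hβ
  have hβ' : β + (d + 4) ≠ 0 := fun h => hβ (by linarith)
  -- The cyclic sum of the pointwise identity is (β+d+4) times the cyclic sum of A on the left and
  -- twice the cyclic sum of g^ab t^c on the right. A nonzero prefactor would make the symmetric
  -- part of A pure trace.
  refine hne ⟨fun c => 2 * contract (g x) (fun p q => A x p q c) / (β + (d + 4)), ?_⟩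
  intro a b c
  have hi := (hg.2 x hx).inv_isSymm.apply
  field_simp
  linarith [hinv x hx a b c, hinv x hx b c a, hinv x hx c a b, hi a b, hi b c, hi c a,
    congrArg (· * contract (g x) (fun p q => A x p q c)) (hi a b),
    congrArg (· * contract (g x) (fun p q => A x p q a)) (hi b c),
    congrArg (· * contract (g x) (fun p q => A x p q b)) (hi c a)]

theorem ConformallyInvariantA.traceFree {A : Vec d → Ten d} (hU : IsOpen U)
    (hg : IsMetricOn U g) (hA : ∀ a b c, DifferentiableOn ℝ (fun x => A x a b c) U)
    (hs : ∀ x ∈ U, ∀ a b c, A x a b c = A x a c b)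
    (htr : ∀ x ∈ U, ∀ a, contract (g x) (A x a) = 0)
    (hinv : ConformallyInvariantA U g A (-((d : ℝ) + 4))) :
    ∀ x ∈ U, IsTotallyTraceFree (g x) (A x) ∧ SymmetryCondition (A x) := by
  rw [conformallyInvariantA_iff hU hg hA hs] at hinv
  intro x hx
  have hi := (hg.2 x hx).inv_isSymm.apply
  have ht : (fun c => contract (g x) (fun p q => A x p q c)) = 0 := by
    refine eq_zero_of_symmetrized_inv_eq_zero (hg.2 x hx) fun a b c => ?_
    linarith [hinv x hx a b c, hinv x hx b c a, hinv x hx c a b,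
      congrArg (· * contract (g x) (fun p q => A x p q c)) (hi a b),
      congrArg (· * contract (g x) (fun p q => A x p q a)) (hi b c),
      congrArg (· * contract (g x) (fun p q => A x p q b)) (hi c a)]
  have ht' : ∀ c, contract (g x) (fun p q => A x p q c) = 0 := congrFun ht
  -- With t = 0 the identity reads A^bca + A^cab = 2A^abc. Subtracting its version with a and b
  -- exchanged leaves 3(A^bac − A^abc) = 0.
  have hsym : ∀ a b c, A x a b c = A x b a c := fun a b c => by
    have h1 := hinv x hx a b c
    have h2 := hinv x hx b a c
    rw [ht', ht'] at h1 h2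
    linarith [hs x hx b c a, hs x hx a c b, hs x hx c a b]
  exact ⟨isTotallyTraceFree_of_symmetric (hs x hx) hsym (htr x hx),
    (symmetryCondition_iff (hs x hx)).2 hsym⟩

end Fields

/-! ### Contractions -/

theorem contract_add (S P Q : Mat d) : contract S (P + Q) = contract S P + contract S Q := by
  simp [contract, mul_add, Finset.sum_add_distrib]

theorem contract_sub (S P Q : Mat d) : contract S (P - Q) = contract S P - contract S Q := by
  simp [contract, mul_sub, Finset.sum_sub_distrib]

theorem contract_smul (S : Mat d) (c : ℝ) (P : Mat d) : contract S (c • P) = c * contract S P := by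
  simp only [contract, Finset.mul_sum, Matrix.smul_apply, smul_eq_mul]
  exact Finset.sum_congr rfl fun a _ => Finset.sum_congr rfl fun b _ => by ring

theorem contract_comm (P Q : Mat d) : contract P Q = contract Q P :=
  Finset.sum_congr rfl fun _ _ => Finset.sum_congr rfl fun _ _ => mul_comm _ _

theorem contract_vecMulVec (S : Mat d) (u w : Vec d) :
    contract S (Matrix.vecMulVec u w) = u ⬝ᵥ S.mulVec w := by
  simp only [contract, dotProduct, Matrix.mulVec, Matrix.vecMulVec_apply, Finset.mul_sum]
  exact Finset.sum_congr rfl fun a _ => Finset.sum_congr rfl fun b _ => by ring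

theorem contract_eq_trace (P Q : Mat d) : contract P Q = (P.transpose * Q).trace := by
  rw [contract, Finset.sum_comm]
  rfl

theorem dotProduct_mulVec_comm {S : Mat d} (hS : S.IsSymm) (u w : Vec d) :
    u ⬝ᵥ S.mulVec w = w ⬝ᵥ S.mulVec u := by
  conv_lhs => rw [← hS]
  rw [Matrix.dotProduct_transpose_mulVec]

theorem row_dotProduct (S : Mat d) (a : Fin d) (w : Vec d) : S a ⬝ᵥ w = S.mulVec w a := rfl

/-- `ξ^ac ξ^b_c`. -/
noncomputable def upM2 (g Ξ : Mat d) : Mat d := upM g Ξ * g * upM g Ξ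

/-! ### Raised fluid variables and their scalar contractions -/

section Algebra

variable {g : Mat d} {ξ : Vec d} {Ξ : Mat d}

theorem upM_isSymm (hg : IsLorentzian g) (hΞ : Ξ.IsSymm) : (upM g Ξ).IsSymm := by
  rw [Matrix.IsSymm, upM, Matrix.transpose_mul, Matrix.transpose_mul, hΞ, hg.inv_isSymm,
    Matrix.mul_assoc]

theorem upM2_isSymm (hg : IsLorentzian g) (hΞ : Ξ.IsSymm) : (upM2 g Ξ).IsSymm := by
  rw [Matrix.IsSymm, upM2, Matrix.transpose_mul, Matrix.transpose_mul, upM_isSymm hg hΞ, hg.isSymm,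
    Matrix.mul_assoc]

theorem ell2_eq (g : Mat d) (ξ : Vec d) (Ξ : Mat d) : ell2 g ξ Ξ = (upM2 g Ξ).mulVec ξ := by
  simp only [ell2, low, ell, upM2, Matrix.mulVec_mulVec, Matrix.mul_assoc]

theorem mulVec_up (hg : IsLorentzian g) (ξ : Vec d) (Ξ : Mat d) :
    Ξ.mulVec (up g ξ) = g.mulVec (ell g ξ Ξ) := by
  rw [ell, up, upM, Matrix.mulVec_mulVec, Matrix.mulVec_mulVec, Matrix.mul_assoc,
    ← Matrix.mul_assoc g, hg.mul_inv, Matrix.one_mul]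

theorem mulVec_ell (hg : IsLorentzian g) (ξ : Vec d) (Ξ : Mat d) :
    Ξ.mulVec (ell g ξ Ξ) = g.mulVec (ell2 g ξ Ξ) := by
  rw [ell2, low, Matrix.mulVec_mulVec, Matrix.mulVec_mulVec, upM, ← Matrix.mul_assoc g,
    ← Matrix.mul_assoc g, hg.mul_inv, Matrix.one_mul, Matrix.mul_assoc, hg.inv_mul, Matrix.mul_one]

theorem mulVec_inv_row (hg : IsLorentzian g) (w : Vec d) (a : Fin d) :
    g⁻¹ a ⬝ᵥ g.mulVec w = w a := congrFun (up_low hg w) a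

theorem up_dotProduct (g : Mat d) (ξ : Vec d) : up g ξ ⬝ᵥ ξ = mu g ξ := rfl

theorem ell_dotProduct (g : Mat d) (ξ : Vec d) (Ξ : Mat d) : ell g ξ Ξ ⬝ᵥ ξ = nu g ξ Ξ := by
  simp only [dotProduct, ell, Matrix.mulVec, nu, Finset.sum_mul]
  exact Finset.sum_congr rfl fun a _ => Finset.sum_congr rfl fun b _ => by ring

theorem psi2_eq (hg : IsLorentzian g) (ξ : Vec d) (Ξ : Mat d) :
    psi2 g ξ Ξ = ell g ξ Ξ ⬝ᵥ g.mulVec (ell g ξ Ξ) := by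
  rw [← mulVec_up hg]
  rfl

theorem ell2_dotProduct (hg : IsLorentzian g) (hΞ : Ξ.IsSymm) (ξ : Vec d) :
    ell2 g ξ Ξ ⬝ᵥ ξ = psi2 g ξ Ξ := by
  rw [psi2_eq hg, ell2, dotProduct_comm, dotProduct_mulVec_comm (upM_isSymm hg hΞ), dotProduct_comm]
  rfl

theorem mulVec_g_up (hg : IsLorentzian g) (ξ : Vec d) : g.mulVec (up g ξ) = ξ := low_up hg ξ

theorem up_dotProduct_g (hg : IsLorentzian g) (w ξ : Vec d) :
    up g ξ ⬝ᵥ g.mulVec w = w ⬝ᵥ ξ := by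
  rw [dotProduct_mulVec_comm hg.isSymm, mulVec_g_up hg]

theorem upM_row_dotProduct_g (g : Mat d) (ξ : Vec d) (Ξ : Mat d) (a : Fin d) :
    upM g Ξ a ⬝ᵥ g.mulVec (ell g ξ Ξ) = ell2 g ξ Ξ a := rfl

theorem contract_upM (hg : IsLorentzian g) (Ξ : Mat d) :
    contract g (upM g Ξ) = contract g⁻¹ Ξ := by
  rw [contract_eq_trace, contract_eq_trace, hg.isSymm, hg.inv_isSymm, upM, ← Matrix.mul_assoc,
    ← Matrix.mul_assoc, hg.mul_inv, Matrix.one_mul, Matrix.trace_mul_comm]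

theorem contract_upM2 (hg : IsLorentzian g) (hΞ : Ξ.IsSymm) :
    contract g (upM2 g Ξ) = psi1 g Ξ := by
  rw [psi1, contract_eq_trace, contract_eq_trace, hg.isSymm, upM_isSymm hg hΞ, upM2, upM]
  simp only [Matrix.mul_assoc, hg.inv_mul, Matrix.mul_one]
  simp only [← Matrix.mul_assoc, hg.mul_inv, Matrix.one_mul]
  simp only [Matrix.mul_assoc]
  rw [Matrix.trace_mul_comm]
  simp only [Matrix.mul_assoc]

theorem contract_upM_self (Ξ : Mat d) : contract Ξ (upM g Ξ) = psi1 g Ξ := contract_comm _ _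

theorem contract_inv_comm (Ξ : Mat d) : contract Ξ g⁻¹ = contract g⁻¹ Ξ := contract_comm _ _

/-! ### Partial derivatives with respect to the fluid variables -/

/-- The function `f` has the partial derivative `f'` in the direction `a` at `x`. -/
def HasPd (f : Vec d → ℝ) (f' : ℝ) (a : Fin d) (x : Vec d) : Prop :=
  HasLineDerivAt ℝ f f' x (Pi.single a 1)

namespace HasPd

variable {f h : Vec d → ℝ} {f' h' : ℝ} {a : Fin d} {x : Vec d}

theorem pd_eq (hf : HasPd f f' a x) : pd f a x = f' := hf.lineDeriv

theorem congr_deriv (hf : HasPd f f' a x) (he : f' = h') : HasPd f h' a x := he ▸ hf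

theorem congr_of_eventuallyEq (hf : HasPd f f' a x) (he : h =ᶠ[nhds x] f) : HasPd h f' a x :=
  HasLineDerivAt.congr_of_eventuallyEq hf he

theorem add (hf : HasPd f f' a x) (hh : HasPd h h' a x) :
    HasPd (fun y => f y + h y) (f' + h') a x := HasDerivAt.fun_add hf hh

theorem sub (hf : HasPd f f' a x) (hh : HasPd h h' a x) :
    HasPd (fun y => f y - h y) (f' - h') a x := HasDerivAt.fun_sub hf hh

theorem mul (hf : HasPd f f' a x) (hh : HasPd h h' a x) :
    HasPd (fun y => f y * h y) (f' * h x + f x * h') a x := by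
  have := HasDerivAt.fun_mul hf hh
  simpa [HasPd, HasLineDerivAt] using this

theorem const (c : ℝ) : HasPd (fun _ => c) 0 a x := hasDerivAt_const _ _

theorem const_mul (c : ℝ) (hf : HasPd f f' a x) : HasPd (fun y => c * f y) (c * f') a x :=
  HasDerivAt.const_mul c hf

theorem mul_const (hf : HasPd f f' a x) (c : ℝ) : HasPd (fun y => f y * c) (f' * c) a x :=
  HasDerivAt.mul_const hf c

theorem comp {k : ℝ → ℝ} {k' : ℝ} (hk : HasDerivAt k k' (f x)) (hf : HasPd f f' a x) :
    HasPd (fun y => k (f y)) (k' * f') a x := by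
  have hk' : HasDerivAt k k' (f (x + (0 : ℝ) • Pi.single a 1)) := by simpa using hk
  exact hk'.comp (0 : ℝ) hf

theorem mulVec (S : Mat d) (b a : Fin d) (x : Vec d) :
    HasPd (fun y => S.mulVec y b) (S b a) a x := by
  have : HasDerivAt (fun t : ℝ => S.mulVec x b + t * S b a) (S b a) 0 := by
    simpa using ((hasDerivAt_id (0 : ℝ)).mul_const (S b a)).const_add (S.mulVec x b)
  simpa [HasPd, HasLineDerivAt, Matrix.mulVec_add, Matrix.mulVec_smul, Matrix.col_apply] using this

/-- The scalars μ, ν, ψ₂ are all quadratic forms in ξ_a, with symmetric matrices g^ab, ξ^ab, ξ^ac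
ξ^b_c, so this one rule supplies their gradients. -/
theorem quadratic {S : Mat d} (hS : S.IsSymm) (a : Fin d) (x : Vec d) :
    HasPd (fun y => S.mulVec y ⬝ᵥ y) (2 * S.mulVec x a) a x := by
  have e : ∀ t : ℝ, S.mulVec (x + t • Pi.single a 1) ⬝ᵥ (x + t • Pi.single a 1) =
      S.mulVec x ⬝ᵥ x + t * (2 * S.mulVec x a) + t ^ 2 * S a a := fun t => by
    have : S.mulVec (Pi.single a 1) ⬝ᵥ x = S.mulVec x a := by
      rw [dotProduct_comm, dotProduct_mulVec_comm hS, single_one_dotProduct]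
    rw [Matrix.mulVec_add, Matrix.mulVec_smul, dotProduct_add, add_dotProduct, add_dotProduct,
      dotProduct_smul, smul_dotProduct, dotProduct_smul, smul_dotProduct, this,
      dotProduct_single_one, dotProduct_single_one]
    simp only [smul_eq_mul, Matrix.mulVec_single_one, Matrix.col_apply]
    ring
  have h1 : HasDerivAt (fun t : ℝ => S.mulVec x ⬝ᵥ x + t * (2 * S.mulVec x a) + t ^ 2 * S a a)
      (2 * S.mulVec x a) 0 := by
    simpa using (((hasDerivAt_id (0 : ℝ)).mul_const (2 * S.mulVec x a)).const_add
      (S.mulVec x ⬝ᵥ x)).fun_add ((hasDerivAt_pow 2 (0 : ℝ)).mul_const (S a a))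
  simpa only [HasPd, HasLineDerivAt, e] using h1

end HasPd

theorem hasPd_mu (hg : IsLorentzian g) (ξ : Vec d) (a : Fin d) :
    HasPd (fun η => mu g η) (2 * up g ξ a) a ξ := HasPd.quadratic hg.inv_isSymm a ξ

theorem hasPd_up (g : Mat d) (ξ : Vec d) (a b : Fin d) :
    HasPd (fun η => up g η b) (g⁻¹ b a) a ξ := HasPd.mulVec _ b a ξ

theorem hasPd_nu (hg : IsLorentzian g) (hΞ : Ξ.IsSymm) (ξ : Vec d) (a : Fin d) :
    HasPd (fun η => nu g η Ξ) (2 * ell g ξ Ξ a) a ξ := by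
  simp only [← ell_dotProduct]
  exact HasPd.quadratic (upM_isSymm hg hΞ) a ξ

theorem hasPd_ell (g : Mat d) (ξ : Vec d) (Ξ : Mat d) (a b : Fin d) :
    HasPd (fun η => ell g η Ξ b) (upM g Ξ b a) a ξ := HasPd.mulVec _ b a ξ

theorem hasPd_psi2 (hg : IsLorentzian g) (hΞ : Ξ.IsSymm) (ξ : Vec d) (a : Fin d) :
    HasPd (fun η => psi2 g η Ξ) (2 * ell2 g ξ Ξ a) a ξ := by
  simp only [← ell2_dotProduct hg hΞ, ell2_eq]
  exact HasPd.quadratic (upM2_isSymm hg hΞ) a ξ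

theorem hasPd_ell2 (g : Mat d) (ξ : Vec d) (Ξ : Mat d) (a b : Fin d) :
    HasPd (fun η => ell2 g η Ξ b) (upM2 g Ξ b a) a ξ := by
  simp only [ell2_eq]
  exact HasPd.mulVec _ b a ξ

theorem hasPd_psi3 (hg : IsLorentzian g) (hΞ : Ξ.IsSymm) (ξ : Vec d) (a : Fin d) :
    HasPd (fun η => psi3 g η Ξ) (4 * (nu g ξ Ξ * ell g ξ Ξ a)) a ξ := by
  simp only [psi3, sq]
  exact ((hasPd_nu hg hΞ ξ a).mul (hasPd_nu hg hΞ ξ a)).congr_deriv (by ring)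

theorem continuous_mu (g : Mat d) : Continuous fun η : Vec d => mu g η := by
  unfold mu up Matrix.mulVec dotProduct
  fun_prop

end Algebra

/-! ### Derivatives of the generating function -/

/-- The coefficient functions `K'` are the derivatives of `K` on `J`. -/
def Coeffs.HasDerivOn (K K' : Coeffs) (J : Set ℝ) : Prop :=
  ∀ μ ∈ J, HasDerivAt K.zero (K'.zero μ) μ ∧ HasDerivAt K.one (K'.one μ) μ ∧
    HasDerivAt K.two1 (K'.two1 μ) μ ∧ HasDerivAt K.two2 (K'.two2 μ) μ ∧
    HasDerivAt K.two3 (K'.two3 μ) μ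

noncomputable section

/-- The gradient `∂χ/∂ξ_a` at order zero, where `K'` is the derivative of `K`. -/
def grad0 (K' : Coeffs) (g : Mat d) (ξ : Vec d) : Vec d := fun a =>
  2 * K'.zero (mu g ξ) * up g ξ a

/-- The gradient `∂χ/∂ξ_a` at order one. -/
def grad1 (K K' : Coeffs) (g : Mat d) (ξ : Vec d) (Ξ : Mat d) : Vec d := fun a =>
  2 * K'.one (mu g ξ) * up g ξ a * nu g ξ Ξ + 2 * K.one (mu g ξ) * ell g ξ Ξ a

/-- The gradient `∂χ/∂ξ_a` at order two. -/
def grad2 (K K' : Coeffs) (g : Mat d) (ξ : Vec d) (Ξ : Mat d) : Vec d := fun a =>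
  2 * K'.two1 (mu g ξ) * up g ξ a * psi1 g Ξ
    + (2 * K'.two2 (mu g ξ) * up g ξ a * psi2 g ξ Ξ + 2 * K.two2 (mu g ξ) * ell2 g ξ Ξ a)
    + (2 * K'.two3 (mu g ξ) * up g ξ a * psi3 g ξ Ξ
      + 4 * K.two3 (mu g ξ) * (nu g ξ Ξ * ell g ξ Ξ a))

/-- The second derivative `∂²χ/∂ξ_a∂ξ_b` at order zero. -/
def hess0 (K' K'' : Coeffs) (g : Mat d) (ξ : Vec d) : Mat d :=
  (4 * K''.zero (mu g ξ)) • Matrix.vecMulVec (up g ξ) (up g ξ) + (2 * K'.zero (mu g ξ)) • g⁻¹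

/-- The second derivative `∂²χ/∂ξ_a∂ξ_b` at order one. -/
def hess1 (K K' K'' : Coeffs) (g : Mat d) (ξ : Vec d) (Ξ : Mat d) : Mat d :=
  (4 * K''.one (mu g ξ) * nu g ξ Ξ) • Matrix.vecMulVec (up g ξ) (up g ξ)
    + (2 * K'.one (mu g ξ) * nu g ξ Ξ) • g⁻¹
    + (4 * K'.one (mu g ξ)) •
      (Matrix.vecMulVec (up g ξ) (ell g ξ Ξ) + Matrix.vecMulVec (ell g ξ Ξ) (up g ξ))
    + (2 * K.one (mu g ξ)) • upM g Ξ

/-- The second derivative `∂²χ/∂ξ_a∂ξ_b` at order two. -/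
def hess2 (K K' K'' : Coeffs) (g : Mat d) (ξ : Vec d) (Ξ : Mat d) : Mat d :=
  (4 * K''.two1 (mu g ξ) * psi1 g Ξ + 4 * K''.two2 (mu g ξ) * psi2 g ξ Ξ
      + 4 * K''.two3 (mu g ξ) * psi3 g ξ Ξ) • Matrix.vecMulVec (up g ξ) (up g ξ)
    + (2 * K'.two1 (mu g ξ) * psi1 g Ξ + 2 * K'.two2 (mu g ξ) * psi2 g ξ Ξ
      + 2 * K'.two3 (mu g ξ) * psi3 g ξ Ξ) • g⁻¹
    + (4 * K'.two2 (mu g ξ)) •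
      (Matrix.vecMulVec (up g ξ) (ell2 g ξ Ξ) + Matrix.vecMulVec (ell2 g ξ Ξ) (up g ξ))
    + (8 * K'.two3 (mu g ξ) * nu g ξ Ξ) •
      (Matrix.vecMulVec (up g ξ) (ell g ξ Ξ) + Matrix.vecMulVec (ell g ξ Ξ) (up g ξ))
    + (2 * K.two2 (mu g ξ)) • upM2 g Ξ
    + (8 * K.two3 (mu g ξ)) • Matrix.vecMulVec (ell g ξ Ξ) (ell g ξ Ξ)
    + (4 * K.two3 (mu g ξ) * nu g ξ Ξ) • upM g Ξ

/-- The derivative `∂χ/∂ξ_bc` at order one. -/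
def stfGrad1 (K : Coeffs) (g : Mat d) (ξ : Vec d) (b c : Fin d) : ℝ :=
  K.one (mu g ξ) * (up g ξ b * up g ξ c - mu g ξ * (g⁻¹ b c / d))

/-- The derivative `∂χ/∂ξ_bc` at order two. -/
def stfGrad2 (K : Coeffs) (g : Mat d) (ξ : Vec d) (Ξ : Mat d) (b c : Fin d) : ℝ :=
  K.two1 (mu g ξ) * (2 * upM g Ξ b c)
    + K.two2 (mu g ξ) * (ell g ξ Ξ b * up g ξ c + ell g ξ Ξ c * up g ξ b
      - 2 * nu g ξ Ξ * (g⁻¹ b c / d))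
    + K.two3 (mu g ξ) * (2 * nu g ξ Ξ * (up g ξ b * up g ξ c - mu g ξ * (g⁻¹ b c / d)))

/-- The second derivative `∂²χ/∂ξ_a∂ξ_bc` at order one. -/
def mixed1 (K K' : Coeffs) (g : Mat d) (ξ : Vec d) (a : Fin d) : Mat d :=
  (2 * K'.one (mu g ξ) * up g ξ a) • (Matrix.vecMulVec (up g ξ) (up g ξ) - (mu g ξ / d) • g⁻¹)
    + K.one (mu g ξ) • (Matrix.vecMulVec (g⁻¹ a) (up g ξ) + Matrix.vecMulVec (up g ξ) (g⁻¹ a)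
      - (2 * up g ξ a / d) • g⁻¹)

/-- The second derivative `∂²χ/∂ξ_a∂ξ_bc` at order two. -/
def mixed2 (K K' : Coeffs) (g : Mat d) (ξ : Vec d) (Ξ : Mat d) (a : Fin d) : Mat d :=
  (4 * K'.two1 (mu g ξ) * up g ξ a) • upM g Ξ
    + (2 * K'.two2 (mu g ξ) * up g ξ a) •
      (Matrix.vecMulVec (ell g ξ Ξ) (up g ξ) + Matrix.vecMulVec (up g ξ) (ell g ξ Ξ)
        - (2 * nu g ξ Ξ / d) • g⁻¹)
    + K.two2 (mu g ξ) • (Matrix.vecMulVec (g⁻¹ a) (ell g ξ Ξ) + Matrix.vecMulVec (ell g ξ Ξ) (g⁻¹ a)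
      + Matrix.vecMulVec (up g ξ) (upM g Ξ a) + Matrix.vecMulVec (upM g Ξ a) (up g ξ)
      - (4 * ell g ξ Ξ a / d) • g⁻¹)
    + (4 * K'.two3 (mu g ξ) * up g ξ a * nu g ξ Ξ + 4 * K.two3 (mu g ξ) * ell g ξ Ξ a) •
      (Matrix.vecMulVec (up g ξ) (up g ξ) - (mu g ξ / d) • g⁻¹)
    + (2 * K.two3 (mu g ξ) * nu g ξ Ξ) •
      (Matrix.vecMulVec (g⁻¹ a) (up g ξ) + Matrix.vecMulVec (up g ξ) (g⁻¹ a)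
      - (2 * up g ξ a / d) • g⁻¹)

end

section Derivatives

variable {g : Mat d} {ξ : Vec d} {Ξ : Mat d} {K K' K'' : Coeffs} {J : Set ℝ}

theorem hasPd_ord0 (hg : IsLorentzian g) (hK : K.HasDerivOn K' J) (hξ : mu g ξ ∈ J) (Ξ : Mat d)
    (a : Fin d) : HasPd (fun η => K.ord0 g η Ξ) (grad0 K' g ξ a) a ξ :=
  ((hasPd_mu hg ξ a).comp (hK _ hξ).1).congr_deriv (by rw [grad0]; ring)

theorem hasPd_ord1 (hg : IsLorentzian g) (hΞ : Ξ.IsSymm) (hK : K.HasDerivOn K' J)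
    (hξ : mu g ξ ∈ J) (a : Fin d) :
    HasPd (fun η => K.ord1 g η Ξ) (grad1 K K' g ξ Ξ a) a ξ :=
  (((hasPd_mu hg ξ a).comp (hK _ hξ).2.1).mul (hasPd_nu hg hΞ ξ a)).congr_deriv
    (by rw [grad1]; ring)

theorem hasPd_ord2 (hg : IsLorentzian g) (hΞ : Ξ.IsSymm) (hK : K.HasDerivOn K' J)
    (hξ : mu g ξ ∈ J) (a : Fin d) :
    HasPd (fun η => K.ord2 g η Ξ) (grad2 K K' g ξ Ξ a) a ξ :=
  (((((hasPd_mu hg ξ a).comp (hK _ hξ).2.2.1).mul_const (psi1 g Ξ)).add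
    (((hasPd_mu hg ξ a).comp (hK _ hξ).2.2.2.1).mul (hasPd_psi2 hg hΞ ξ a))).add
    (((hasPd_mu hg ξ a).comp (hK _ hξ).2.2.2.2).mul (hasPd_psi3 hg hΞ ξ a))).congr_deriv
    (by rw [grad2]; ring)

theorem hasPd_chi (hg : IsLorentzian g) (hΞ : Ξ.IsSymm) (hK : K.HasDerivOn K' J)
    (hξ : mu g ξ ∈ J) (a : Fin d) :
    HasPd (fun η => K.chi g η Ξ) (grad0 K' g ξ a + grad1 K K' g ξ Ξ a + grad2 K K' g ξ Ξ a) a ξ :=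
  ((hasPd_ord0 hg hK hξ Ξ a).add (hasPd_ord1 hg hΞ hK hξ a)).add (hasPd_ord2 hg hΞ hK hξ a)

theorem hasPd_grad0 (hg : IsLorentzian g) (hK' : K'.HasDerivOn K'' J) (hξ : mu g ξ ∈ J)
    (a b : Fin d) : HasPd (fun η => grad0 K' g η b) (hess0 K' K'' g ξ a b) a ξ :=
  ((((hasPd_mu hg ξ a).comp (hK' _ hξ).1).const_mul 2).mul (hasPd_up g ξ a b)).congr_deriv (by
    simp only [hess0, Matrix.add_apply, Matrix.smul_apply, Matrix.vecMulVec_apply, smul_eq_mul,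
      hg.inv_isSymm.apply a b]
    ring)

theorem hasPd_grad1 (hg : IsLorentzian g) (hΞ : Ξ.IsSymm) (hK : K.HasDerivOn K' J)
    (hK' : K'.HasDerivOn K'' J) (hξ : mu g ξ ∈ J) (a b : Fin d) :
    HasPd (fun η => grad1 K K' g η Ξ b) (hess1 K K' K'' g ξ Ξ a b) a ξ :=
  ((((((hasPd_mu hg ξ a).comp (hK' _ hξ).2.1).const_mul 2).mul (hasPd_up g ξ a b)).mul
    (hasPd_nu hg hΞ ξ a)).add ((((hasPd_mu hg ξ a).comp (hK _ hξ).2.1).const_mul 2).mul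
      (hasPd_ell g ξ Ξ a b))).congr_deriv (by
    simp only [hess1, Matrix.add_apply, Matrix.smul_apply, Matrix.vecMulVec_apply, smul_eq_mul,
      hg.inv_isSymm.apply a b, (upM_isSymm hg hΞ).apply a b]
    ring)

theorem hasPd_grad2 (hg : IsLorentzian g) (hΞ : Ξ.IsSymm) (hK : K.HasDerivOn K' J)
    (hK' : K'.HasDerivOn K'' J) (hξ : mu g ξ ∈ J) (a b : Fin d) :
    HasPd (fun η => grad2 K K' g η Ξ b) (hess2 K K' K'' g ξ Ξ a b) a ξ := by
  have h1 := (((hasPd_mu hg ξ a).comp (hK' _ hξ).2.2.1).const_mul 2).mul (hasPd_up g ξ a b)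
  have h2 := (((hasPd_mu hg ξ a).comp (hK' _ hξ).2.2.2.1).const_mul 2).mul (hasPd_up g ξ a b)
  have h3 := (((hasPd_mu hg ξ a).comp (hK' _ hξ).2.2.2.2).const_mul 2).mul (hasPd_up g ξ a b)
  have h4 := (((hasPd_mu hg ξ a).comp (hK _ hξ).2.2.2.1).const_mul 2).mul (hasPd_ell2 g ξ Ξ a b)
  have h5 := (((hasPd_mu hg ξ a).comp (hK _ hξ).2.2.2.2).const_mul 4).mul
    ((hasPd_nu hg hΞ ξ a).mul (hasPd_ell g ξ Ξ a b))
  refine (((h1.mul_const (psi1 g Ξ)).add ((h2.mul (hasPd_psi2 hg hΞ ξ a)).add h4)).add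
    ((h3.mul (hasPd_psi3 hg hΞ ξ a)).add h5)).congr_deriv ?_
  simp only [hess2, Matrix.add_apply, Matrix.smul_apply, Matrix.vecMulVec_apply, smul_eq_mul,
    hg.inv_isSymm.apply a b, (upM_isSymm hg hΞ).apply a b, (upM2_isSymm hg hΞ).apply a b]
  ring

/-- The second derivatives of a function are determined by its gradient on `{μ ∈ J}`. -/
theorem stress_eq_of_hasPd (hJ : IsOpen J) {χ : Vec d → Mat d → ℝ} {G : Vec d → Vec d} {H : Mat d}
    (hG : ∀ η, mu g η ∈ J → ∀ b, HasPd (fun ζ => χ ζ Ξ) (G η b) b η) (hξ : mu g ξ ∈ J)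
    (hH : ∀ a b, HasPd (fun η => G η b) (H a b) a ξ) : stress χ ξ Ξ = H := by
  ext a b
  refine ((hH a b).congr_of_eventuallyEq ?_).pd_eq
  -- The inner derivative is known only where μ ∈ J. This set is open, so the outer derivative at ξ
  -- may be computed from the closed formula.
  filter_upwards [(continuous_mu g).continuousAt.preimage_mem_nhds (hJ.mem_nhds hξ)] with η hη
  exact (hG η hη b).pd_eq

theorem stress_ord0 (hJ : IsOpen J) (hg : IsLorentzian g) (hK : K.HasDerivOn K' J)
    (hK' : K'.HasDerivOn K'' J) (hξ : mu g ξ ∈ J) :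
    stress (K.ord0 g) ξ Ξ = hess0 K' K'' g ξ :=
  stress_eq_of_hasPd hJ (fun _ hη b => hasPd_ord0 hg hK hη Ξ b) hξ
    (hasPd_grad0 hg hK' hξ)

theorem stress_ord1 (hJ : IsOpen J) (hg : IsLorentzian g) (hΞ : Ξ.IsSymm) (hK : K.HasDerivOn K' J)
    (hK' : K'.HasDerivOn K'' J) (hξ : mu g ξ ∈ J) :
    stress (K.ord1 g) ξ Ξ = hess1 K K' K'' g ξ Ξ :=
  stress_eq_of_hasPd hJ (fun _ hη b => hasPd_ord1 hg hΞ hK hη b) hξ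
    (hasPd_grad1 hg hΞ hK hK' hξ)

theorem stress_ord2 (hJ : IsOpen J) (hg : IsLorentzian g) (hΞ : Ξ.IsSymm) (hK : K.HasDerivOn K' J)
    (hK' : K'.HasDerivOn K'' J) (hξ : mu g ξ ∈ J) :
    stress (K.ord2 g) ξ Ξ = hess2 K K' K'' g ξ Ξ :=
  stress_eq_of_hasPd hJ (fun _ hη b => hasPd_ord2 hg hΞ hK hη b) hξ
    (hasPd_grad2 hg hΞ hK hK' hξ)

theorem stress_chi (hJ : IsOpen J) (hg : IsLorentzian g) (hΞ : Ξ.IsSymm) (hK : K.HasDerivOn K' J)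
    (hK' : K'.HasDerivOn K'' J) (hξ : mu g ξ ∈ J) :
    stress (K.chi g) ξ Ξ =
      hess0 K' K'' g ξ + hess1 K K' K'' g ξ Ξ + hess2 K K' K'' g ξ Ξ :=
  stress_eq_of_hasPd hJ (fun _ hη b => hasPd_chi hg hΞ hK hη b) hξ
    fun a b => ((hasPd_grad0 hg hK' hξ a b).add (hasPd_grad1 hg hΞ hK hK' hξ a b)).add
      (hasPd_grad2 hg hΞ hK hK' hξ a b)

/-! ### Derivatives with respect to `ξ_bc` -/

/-- Differentiating a function linear in ξ_bc within symmetric trace-free tensors takes the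
symmetric part of its coefficient and removes the trace. -/
theorem contract_stfUnit (S g : Mat d) (b c : Fin d) :
    contract S (stfUnit g b c) = (S b c + S c b) / 2 - contract S g * (g⁻¹ b c / d) := by
  have e : stfUnit g b c = (1 / 2 : ℝ) • (Matrix.single b c 1 + Matrix.single c b 1)
      - (g⁻¹ b c / d) • g := by
    ext p q
    simp only [stfUnit, Matrix.sub_apply, Matrix.smul_apply, Matrix.add_apply, Matrix.single_apply,
      smul_eq_mul, eq_comm (a := p), eq_comm (a := q)]
    ring
  have hs : ∀ p q, contract S (Matrix.single p q 1) = S p q := fun p q => by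
    simp [contract, Matrix.single_apply, ite_and]
  rw [e, contract_sub, contract_smul, contract_smul, contract_add, hs, hs]
  ring

theorem nu_eq_contract (hg : IsLorentzian g) (ξ : Vec d) (E : Mat d) :
    nu g ξ E = contract (Matrix.vecMulVec (up g ξ) (up g ξ)) E := by
  rw [contract_comm, contract_vecMulVec, mulVec_up hg, up_dotProduct_g hg, ell_dotProduct]

/-- At fixed ξ_a, both χ¹ν and the order-two part are polynomials of degree at most two along any
line of tensors ξ_bc, so their derivative is the linear coefficient. -/
theorem hasLineDerivAt_quadratic {f : Mat d → ℝ} {Z E : Mat d} {q p : ℝ}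
    (h : ∀ t : ℝ, f (Z + t • E) = f Z + t * p + t ^ 2 * q) : HasLineDerivAt ℝ f p Z E := by
  have h1 : HasDerivAt (fun t : ℝ => f Z + t * p + t ^ 2 * q) p 0 := by
    simpa using (((hasDerivAt_id (0 : ℝ)).mul_const p).const_add
      (f Z)).fun_add ((hasDerivAt_pow 2 (0 : ℝ)).mul_const q)
  simpa only [HasLineDerivAt, h] using h1

theorem nu_add_smul (hg : IsLorentzian g) (ξ : Vec d) (Z E : Mat d) (t : ℝ) :
    nu g ξ (Z + t • E) = nu g ξ Z + t * nu g ξ E := by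
  simp only [nu_eq_contract hg, contract_add, contract_smul]

theorem psi1_add_smul (hg : IsLorentzian g) (Z E : Mat d) (t : ℝ) :
    psi1 g (Z + t • E) = psi1 g Z + t * (2 * contract (upM g Z) E) + t ^ 2 * psi1 g E := by
  have e : upM g (Z + t • E) = upM g Z + t • upM g E := by
    simp only [upM, Matrix.mul_add, Matrix.add_mul, Matrix.mul_smul, Matrix.smul_mul]
  have h : contract Z (upM g E) = contract (upM g Z) E := by
    rw [contract_eq_trace, contract_eq_trace, upM, upM, Matrix.transpose_mul, Matrix.transpose_mul,
      hg.inv_isSymm, Matrix.trace_mul_comm]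
    simp only [Matrix.mul_assoc]
    rw [Matrix.trace_mul_comm]
    simp only [Matrix.mul_assoc]
    rw [Matrix.trace_mul_comm]
    simp only [Matrix.mul_assoc]
  rw [psi1, e, contract_add, contract_smul, contract_comm _ Z, contract_comm _ E, contract_add,
    contract_add, contract_smul, contract_smul, h, contract_comm Z, contract_comm E,
    contract_comm E (upM g E)]
  simp only [psi1]
  ring

theorem psi2_add_smul (hg : IsLorentzian g) (ξ : Vec d) (Z E : Mat d) (t : ℝ) :
    psi2 g ξ (Z + t • E) = psi2 g ξ Z + t * (2 * contract (Matrix.vecMulVec (ell g ξ Z) (up g ξ)) E)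
      + t ^ 2 * psi2 g ξ E := by
  have e : ell g ξ (Z + t • E) = ell g ξ Z + t • ell g ξ E := by
    simp only [ell, upM, Matrix.mul_add, Matrix.add_mul, Matrix.mul_smul, Matrix.smul_mul,
      Matrix.add_mulVec, Matrix.smul_mulVec]
  rw [psi2_eq hg, psi2_eq hg, psi2_eq hg, contract_comm, contract_vecMulVec, mulVec_up hg, e,
    Matrix.mulVec_add, Matrix.mulVec_smul, dotProduct_add, add_dotProduct, add_dotProduct,
    dotProduct_smul, smul_dotProduct, dotProduct_smul, smul_dotProduct,
    dotProduct_mulVec_comm hg.isSymm (ell g ξ E) (ell g ξ Z)]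
  simp only [smul_eq_mul]
  ring

theorem hasLineDerivAt_ord1 (hg : IsLorentzian g) (K : Coeffs) (ξ : Vec d) (Ξ : Mat d)
    (b c : Fin d) :
    HasLineDerivAt ℝ (K.ord1 g ξ) (stfGrad1 K g ξ b c) Ξ (stfUnit g b c) := by
  refine hasLineDerivAt_quadratic (q := 0) fun t => ?_
  have h : nu g ξ (stfUnit g b c) = up g ξ b * up g ξ c - mu g ξ * (g⁻¹ b c / d) := by
    rw [nu_eq_contract hg, contract_stfUnit, contract_comm, contract_vecMulVec, mulVec_g_up hg,
      up_dotProduct]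
    simp only [Matrix.vecMulVec_apply]
    ring
  rw [Coeffs.ord1, Coeffs.ord1, nu_add_smul hg, h, stfGrad1]
  ring

theorem hasLineDerivAt_ord2 (hg : IsLorentzian g) (hΞ : IsSTF g Ξ) (K : Coeffs) (ξ : Vec d)
    (b c : Fin d) :
    HasLineDerivAt ℝ (K.ord2 g ξ) (stfGrad2 K g ξ Ξ b c) Ξ (stfUnit g b c) := by
  have h1 : nu g ξ (stfUnit g b c) = up g ξ b * up g ξ c - mu g ξ * (g⁻¹ b c / d) := by
    rw [nu_eq_contract hg, contract_stfUnit, contract_comm, contract_vecMulVec, mulVec_g_up hg,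
      up_dotProduct]
    simp only [Matrix.vecMulVec_apply]
    ring
  -- Symmetry and vanishing trace of ξ_bc make its projection onto symmetric trace-free tensors
  -- equal to itself.
  have h2 : contract (upM g Ξ) (stfUnit g b c) = upM g Ξ b c := by
    rw [contract_stfUnit, contract_comm, contract_upM hg, hΞ.2, (upM_isSymm hg hΞ.1).apply b c]
    ring
  have h3 : contract (Matrix.vecMulVec (ell g ξ Ξ) (up g ξ)) (stfUnit g b c) =
      (ell g ξ Ξ b * up g ξ c + ell g ξ Ξ c * up g ξ b) / 2 - nu g ξ Ξ * (g⁻¹ b c / d) := by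
    rw [contract_stfUnit, contract_comm, contract_vecMulVec, mulVec_g_up hg, ell_dotProduct]
    simp only [Matrix.vecMulVec_apply]
  refine hasLineDerivAt_quadratic (q := K.two1 (mu g ξ) * psi1 g (stfUnit g b c)
    + K.two2 (mu g ξ) * psi2 g ξ (stfUnit g b c)
    + K.two3 (mu g ξ) * nu g ξ (stfUnit g b c) ^ 2) fun t => ?_
  rw [Coeffs.ord2, Coeffs.ord2, psi1_add_smul hg, psi2_add_smul hg, psi3, nu_add_smul hg, h2, h3,
    stfGrad2, psi3, h1]
  ring

theorem hasPd_stfGrad1 (hg : IsLorentzian g) (hK : K.HasDerivOn K' J) (hξ : mu g ξ ∈ J)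
    (a b c : Fin d) : HasPd (fun η => stfGrad1 K g η b c) (mixed1 K K' g ξ a b c) a ξ := by
  refine (((hasPd_mu hg ξ a).comp (hK _ hξ).2.1).mul (((hasPd_up g ξ a b).mul
    (hasPd_up g ξ a c)).sub ((hasPd_mu hg ξ a).mul_const (g⁻¹ b c / d)))).congr_deriv ?_
  simp only [mixed1, Matrix.add_apply, Matrix.sub_apply, Matrix.smul_apply, Matrix.vecMulVec_apply,
    smul_eq_mul, hg.inv_isSymm.apply a b, hg.inv_isSymm.apply a c]
  ring

theorem hasPd_stfGrad2 (hg : IsLorentzian g) (hΞ : Ξ.IsSymm) (hK : K.HasDerivOn K' J)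
    (hξ : mu g ξ ∈ J) (a b c : Fin d) :
    HasPd (fun η => stfGrad2 K g η Ξ b c) (mixed2 K K' g ξ Ξ a b c) a ξ := by
  have hu := hasPd_up g ξ a
  have hl := hasPd_ell g ξ Ξ a
  have hν := hasPd_nu hg hΞ ξ a
  have hμ := hasPd_mu hg ξ a
  refine (((hμ.comp (hK _ hξ).2.2.1).mul_const (2 * upM g Ξ b c)).add
    ((hμ.comp (hK _ hξ).2.2.2.1).mul ((((hl b).mul (hu c)).add ((hl c).mul (hu b))).sub
      ((hν.const_mul 2).mul_const (g⁻¹ b c / d)))) |>.add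
    ((hμ.comp (hK _ hξ).2.2.2.2).mul ((hν.const_mul 2).mul (((hu b).mul (hu c)).sub
      (hμ.mul_const (g⁻¹ b c / d)))))).congr_deriv ?_
  simp only [mixed2, Matrix.add_apply, Matrix.sub_apply, Matrix.smul_apply, Matrix.vecMulVec_apply,
    smul_eq_mul, hg.inv_isSymm.apply a b, hg.inv_isSymm.apply a c, (upM_isSymm hg hΞ).apply a b,
    (upM_isSymm hg hΞ).apply a c]
  ring

theorem dissip_ord0 (K : Coeffs) (g : Mat d) (ξ : Vec d) (Ξ : Mat d) (a b c : Fin d) :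
    dissip g (K.ord0 g) ξ Ξ a b c = 0 := by
  have h : ∀ η, lineDeriv ℝ (K.ord0 g η) Ξ (stfUnit g b c) = 0 := fun η =>
    HasLineDerivAt.lineDeriv (hasDerivAt_const (0 : ℝ) (K.zero (mu g η)))
  simp only [dissip, h]
  exact (HasPd.const 0).pd_eq

theorem dissip_ord1 (hg : IsLorentzian g) (Ξ : Mat d) (hK : K.HasDerivOn K' J) (hξ : mu g ξ ∈ J)
    (a b c : Fin d) : dissip g (K.ord1 g) ξ Ξ a b c = mixed1 K K' g ξ a b c := by
  simp only [dissip, fun η => (hasLineDerivAt_ord1 hg K η Ξ b c).lineDeriv]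
  exact (hasPd_stfGrad1 hg hK hξ a b c).pd_eq

theorem dissip_ord2 (hg : IsLorentzian g) (hΞ : IsSTF g Ξ) (hK : K.HasDerivOn K' J)
    (hξ : mu g ξ ∈ J) (a b c : Fin d) :
    dissip g (K.ord2 g) ξ Ξ a b c = mixed2 K K' g ξ Ξ a b c := by
  simp only [dissip, fun η => (hasLineDerivAt_ord2 hg hΞ K η b c).lineDeriv]
  exact (hasPd_stfGrad2 hg hΞ.1 hK hξ a b c).pd_eq

theorem dissip_chi (hg : IsLorentzian g) (hΞ : IsSTF g Ξ) (hK : K.HasDerivOn K' J)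
    (hξ : mu g ξ ∈ J) (a b c : Fin d) : dissip g (K.chi g) ξ Ξ a b c =
      mixed1 K K' g ξ a b c + mixed2 K K' g ξ Ξ a b c := by
  have h : ∀ η, lineDeriv ℝ (K.chi g η) Ξ (stfUnit g b c) =
      stfGrad1 K g η b c + stfGrad2 K g η Ξ b c := fun η => by
    have h0 : HasLineDerivAt ℝ (K.ord0 g η) 0 Ξ (stfUnit g b c) :=
      hasDerivAt_const (0 : ℝ) (K.zero (mu g η))
    have := HasDerivAt.fun_add (HasDerivAt.fun_add h0 (hasLineDerivAt_ord1 hg K η Ξ b c))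
      (hasLineDerivAt_ord2 hg hΞ K η b c)
    rw [zero_add] at this
    exact HasLineDerivAt.lineDeriv this
  simp only [dissip, h]
  exact ((hasPd_stfGrad1 hg hK hξ a b c).add (hasPd_stfGrad2 hg hΞ.1 hK hξ a b c)).pd_eq

/-- The entropy current as a function of gradient, stress and dissipation tensors. -/
theorem entropy_eq {χ : Vec d → Mat d → ℝ} {G : Vec d} {H : Mat d} {A : Fin d → Mat d}
    (hG : ∀ a, HasPd (fun η => χ η Ξ) (G a) a ξ) (hH : stress χ ξ Ξ = H)
    (hA : ∀ a b c, dissip g χ ξ Ξ a b c = A a b c) (a : Fin d) :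
    entropy g χ ξ Ξ a = G a - H.mulVec ξ a - contract Ξ (A a) := by
  simp only [entropy, gradXi, (hG a).pd_eq, hH, hA, contract, Matrix.mulVec, dotProduct,
    mul_comm (ξ _)]

end Derivatives

/-! ### Contractions of the second derivatives -/

section Contractions

variable {g : Mat d} {ξ : Vec d} {Ξ : Mat d}

theorem vecMulVec_mulVec_apply (u w x : Vec d) (a : Fin d) :
    (Matrix.vecMulVec u w).mulVec x a = u a * (w ⬝ᵥ x) := by
  simp only [Matrix.mulVec, dotProduct, Matrix.vecMulVec_apply, Finset.mul_sum, mul_assoc]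

theorem hess0_mulVec (K' K'' : Coeffs) (g : Mat d) (ξ : Vec d) (a : Fin d) :
    (hess0 K' K'' g ξ).mulVec ξ a =
      (4 * K''.zero (mu g ξ) * mu g ξ + 2 * K'.zero (mu g ξ)) * up g ξ a := by
  have hG : g⁻¹.mulVec ξ a = up g ξ a := rfl
  simp only [hess0, Matrix.add_mulVec, Matrix.smul_mulVec, Pi.add_apply, Pi.smul_apply,
    smul_eq_mul, vecMulVec_mulVec_apply, hG, up_dotProduct]
  ring

theorem hess1_mulVec (K K' K'' : Coeffs) (g : Mat d) (ξ : Vec d) (Ξ : Mat d) (a : Fin d) :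
    (hess1 K K' K'' g ξ Ξ).mulVec ξ a =
      (4 * K''.one (mu g ξ) * mu g ξ + 6 * K'.one (mu g ξ)) * nu g ξ Ξ * up g ξ a
      + (4 * K'.one (mu g ξ) * mu g ξ + 2 * K.one (mu g ξ)) * ell g ξ Ξ a := by
  have hG : g⁻¹.mulVec ξ a = up g ξ a := rfl
  have hM : (upM g Ξ).mulVec ξ a = ell g ξ Ξ a := rfl
  simp only [hess1, Matrix.add_mulVec, Matrix.smul_mulVec, Pi.add_apply, Pi.smul_apply,
    smul_eq_mul, vecMulVec_mulVec_apply, hG, hM, up_dotProduct, ell_dotProduct]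
  ring

theorem hess2_mulVec (hg : IsLorentzian g) (hΞ : Ξ.IsSymm) (K K' K'' : Coeffs) (ξ : Vec d)
    (a : Fin d) : (hess2 K K' K'' g ξ Ξ).mulVec ξ a =
      ((4 * K''.two1 (mu g ξ) * mu g ξ + 2 * K'.two1 (mu g ξ)) * psi1 g Ξ
        + (4 * K''.two2 (mu g ξ) * mu g ξ + 6 * K'.two2 (mu g ξ)) * psi2 g ξ Ξ
        + (4 * K''.two3 (mu g ξ) * mu g ξ + 10 * K'.two3 (mu g ξ)) * nu g ξ Ξ ^ 2) * up g ξ a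
      + (4 * K'.two2 (mu g ξ) * mu g ξ + 2 * K.two2 (mu g ξ)) * ell2 g ξ Ξ a
      + (8 * K'.two3 (mu g ξ) * mu g ξ + 12 * K.two3 (mu g ξ)) * nu g ξ Ξ * ell g ξ Ξ a := by
  have hG : g⁻¹.mulVec ξ a = up g ξ a := rfl
  have hM : (upM g Ξ).mulVec ξ a = ell g ξ Ξ a := rfl
  simp only [hess2, Matrix.add_mulVec, Matrix.smul_mulVec, Pi.add_apply, Pi.smul_apply,
    smul_eq_mul, vecMulVec_mulVec_apply, hG, hM, ← ell2_eq, up_dotProduct, ell_dotProduct,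
    ell2_dotProduct hg hΞ, psi3]
  ring

theorem contract_hess0 (hg : IsLorentzian g) (K' K'' : Coeffs) (ξ : Vec d) :
    contract g (hess0 K' K'' g ξ) =
      4 * K''.zero (mu g ξ) * mu g ξ + 2 * d * K'.zero (mu g ξ) := by
  simp only [hess0, contract_add, contract_smul, contract_vecMulVec, contract_inv hg,
    mulVec_g_up hg, up_dotProduct]
  ring

theorem contract_hess1 (hg : IsLorentzian g) (hΞ : IsSTF g Ξ) (K K' K'' : Coeffs) (ξ : Vec d) :
    contract g (hess1 K K' K'' g ξ Ξ) =
      (4 * K''.one (mu g ξ) * mu g ξ + 2 * (d + 4) * K'.one (mu g ξ)) * nu g ξ Ξ := by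
  simp only [hess1, contract_add, contract_smul, contract_vecMulVec, contract_inv hg,
    mulVec_g_up hg, up_dotProduct, up_dotProduct_g hg, ell_dotProduct, contract_upM hg, hΞ.2]
  ring

theorem contract_hess2 (hg : IsLorentzian g) (hΞ : IsSTF g Ξ) (K K' K'' : Coeffs) (ξ : Vec d) :
    contract g (hess2 K K' K'' g ξ Ξ) =
      (4 * K''.two1 (mu g ξ) * mu g ξ + 2 * d * K'.two1 (mu g ξ)
        + 2 * K.two2 (mu g ξ)) * psi1 g Ξ
      + (4 * K''.two2 (mu g ξ) * mu g ξ + 2 * (d + 4) * K'.two2 (mu g ξ)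
        + 8 * K.two3 (mu g ξ)) * psi2 g ξ Ξ
      + (4 * K''.two3 (mu g ξ) * mu g ξ + 2 * (d + 8) * K'.two3 (mu g ξ)) * nu g ξ Ξ ^ 2 := by
  simp only [hess2, contract_add, contract_smul, contract_vecMulVec, contract_inv hg,
    mulVec_g_up hg, up_dotProduct, up_dotProduct_g hg, ell_dotProduct, ell2_dotProduct hg hΞ.1,
    contract_upM hg, hΞ.2, contract_upM2 hg hΞ.1, ← psi2_eq hg, psi3]
  ring

/-- This trace vanishes for arbitrary coefficient functions, because the derivative is taken within
trace-free tensors. It thus imposes no condition on χ; the other traces follow once A^abc is totally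
symmetric. -/
theorem contract_mixed1 (hg : IsLorentzian g) (hd : (d : ℝ) ≠ 0) (K K' : Coeffs) (ξ : Vec d)
    (a : Fin d) : contract g (mixed1 K K' g ξ a) = 0 := by
  have hG : g⁻¹.mulVec ξ a = up g ξ a := rfl
  simp only [mixed1, contract_add, contract_sub, contract_smul, contract_vecMulVec,
    contract_inv hg, mulVec_g_up hg, up_dotProduct, row_dotProduct, up_dotProduct_g hg, hG]
  field_simp
  ring

theorem contract_mixed2 (hg : IsLorentzian g) (hΞ : IsSTF g Ξ) (hd : (d : ℝ) ≠ 0) (K K' : Coeffs)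
    (ξ : Vec d) (a : Fin d) : contract g (mixed2 K K' g ξ Ξ a) = 0 := by
  have hG : g⁻¹ a ⬝ᵥ ξ = up g ξ a := rfl
  have hM : upM g Ξ a ⬝ᵥ ξ = ell g ξ Ξ a := rfl
  have hl : ell g ξ Ξ ⬝ᵥ g.mulVec (g⁻¹ a) = ell g ξ Ξ a := by
    rw [dotProduct_mulVec_comm hg.isSymm, mulVec_inv_row hg]
  simp only [mixed2, contract_add, contract_sub, contract_smul, contract_vecMulVec,
    contract_inv hg, mulVec_g_up hg, up_dotProduct, up_dotProduct_g hg,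
    ell_dotProduct, hG, hM, hl, mulVec_inv_row hg, contract_upM hg, hΞ.2]
  field_simp
  ring

theorem contract_xi_mixed1 (hg : IsLorentzian g) (hΞ : IsSTF g Ξ) (K K' : Coeffs) (ξ : Vec d)
    (a : Fin d) : contract Ξ (mixed1 K K' g ξ a) =
      2 * K'.one (mu g ξ) * nu g ξ Ξ * up g ξ a + 2 * K.one (mu g ξ) * ell g ξ Ξ a := by
  have hl : up g ξ ⬝ᵥ Ξ.mulVec (g⁻¹ a) = ell g ξ Ξ a := by
    rw [dotProduct_mulVec_comm hΞ.1, mulVec_up hg, mulVec_inv_row hg]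
  simp only [mixed1, contract_add, contract_sub, contract_smul, contract_vecMulVec,
    contract_inv_comm, hΞ.2, mulVec_up hg, up_dotProduct_g hg, ell_dotProduct, hl,
    mulVec_inv_row hg]
  ring

theorem contract_xi_mixed2 (hg : IsLorentzian g) (hΞ : IsSTF g Ξ) (K K' : Coeffs) (ξ : Vec d)
    (a : Fin d) : contract Ξ (mixed2 K K' g ξ Ξ a) =
      (4 * K'.two1 (mu g ξ) * psi1 g Ξ + 4 * K'.two2 (mu g ξ) * psi2 g ξ Ξ
        + 4 * K'.two3 (mu g ξ) * nu g ξ Ξ ^ 2) * up g ξ a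
      + 4 * K.two2 (mu g ξ) * ell2 g ξ Ξ a
      + 8 * K.two3 (mu g ξ) * nu g ξ Ξ * ell g ξ Ξ a := by
  have h1 : up g ξ ⬝ᵥ Ξ.mulVec (g⁻¹ a) = ell g ξ Ξ a := by
    rw [dotProduct_mulVec_comm hΞ.1, mulVec_up hg, mulVec_inv_row hg]
  have h2 : ell g ξ Ξ ⬝ᵥ Ξ.mulVec (g⁻¹ a) = ell2 g ξ Ξ a := by
    rw [dotProduct_mulVec_comm hΞ.1, mulVec_ell hg, mulVec_inv_row hg]
  have h3 : up g ξ ⬝ᵥ Ξ.mulVec (upM g Ξ a) = ell2 g ξ Ξ a := by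
    rw [dotProduct_mulVec_comm hΞ.1, mulVec_up hg, upM_row_dotProduct_g]
  simp only [mixed2, contract_add, contract_sub, contract_smul, contract_vecMulVec,
    contract_inv_comm, hΞ.2, mulVec_up hg, mulVec_ell hg, up_dotProduct_g hg, ell_dotProduct,
    ell2_dotProduct hg hΞ.1, h1, h2, h3, mulVec_inv_row hg, upM_row_dotProduct_g,
    contract_upM_self, ← psi2_eq hg]
  ring

end Contractions

/-! ### Splitting of T, A and S into the orders 0, 1, 2 -/

section Orders

variable {g : Mat d} {ξ : Vec d} {Ξ : Mat d} {K K' K'' : Coeffs} {J : Set ℝ}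

theorem entropy_ord0 (hJ : IsOpen J) (hg : IsLorentzian g) (hK : K.HasDerivOn K' J)
    (hK' : K'.HasDerivOn K'' J) (hξ : mu g ξ ∈ J) (a : Fin d) :
    entropy g (K.ord0 g) ξ Ξ a = grad0 K' g ξ a - (hess0 K' K'' g ξ).mulVec ξ a := by
  rw [entropy_eq (A := 0) (hasPd_ord0 hg hK hξ Ξ) (stress_ord0 hJ hg hK hK' hξ)
    (dissip_ord0 K g ξ Ξ)]
  simp [contract]

theorem entropy_ord1 (hJ : IsOpen J) (hg : IsLorentzian g) (hΞ : IsSTF g Ξ)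
    (hK : K.HasDerivOn K' J) (hK' : K'.HasDerivOn K'' J) (hξ : mu g ξ ∈ J) (a : Fin d) :
    entropy g (K.ord1 g) ξ Ξ a = grad1 K K' g ξ Ξ a - (hess1 K K' K'' g ξ Ξ).mulVec ξ a
      - contract Ξ (mixed1 K K' g ξ a) :=
  entropy_eq (hasPd_ord1 hg hΞ.1 hK hξ) (stress_ord1 hJ hg hΞ.1 hK hK' hξ)
    (dissip_ord1 hg Ξ hK hξ) a

theorem entropy_ord2 (hJ : IsOpen J) (hg : IsLorentzian g) (hΞ : IsSTF g Ξ)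
    (hK : K.HasDerivOn K' J) (hK' : K'.HasDerivOn K'' J) (hξ : mu g ξ ∈ J) (a : Fin d) :
    entropy g (K.ord2 g) ξ Ξ a = grad2 K K' g ξ Ξ a - (hess2 K K' K'' g ξ Ξ).mulVec ξ a
      - contract Ξ (mixed2 K K' g ξ Ξ a) :=
  entropy_eq (hasPd_ord2 hg hΞ.1 hK hξ) (stress_ord2 hJ hg hΞ.1 hK hK' hξ)
    (dissip_ord2 hg hΞ hK hξ) a

/-- The stress tensor is the sum of the contributions of orders zero, one and two. -/
theorem stress_chi_eq_add (hJ : IsOpen J) (hg : IsLorentzian g) (hΞ : IsSTF g Ξ)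
    (hK : K.HasDerivOn K' J) (hK' : K'.HasDerivOn K'' J) (hξ : mu g ξ ∈ J) :
    stress (K.chi g) ξ Ξ =
      stress (K.ord0 g) ξ Ξ + stress (K.ord1 g) ξ Ξ + stress (K.ord2 g) ξ Ξ := by
  rw [stress_chi hJ hg hΞ.1 hK hK' hξ, stress_ord0 hJ hg hK hK' hξ,
    stress_ord1 hJ hg hΞ.1 hK hK' hξ, stress_ord2 hJ hg hΞ.1 hK hK' hξ]

theorem dissip_chi_eq_add (hg : IsLorentzian g) (hΞ : IsSTF g Ξ) (hK : K.HasDerivOn K' J)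
    (hξ : mu g ξ ∈ J) : dissip g (K.chi g) ξ Ξ =
      dissip g (K.ord0 g) ξ Ξ + dissip g (K.ord1 g) ξ Ξ + dissip g (K.ord2 g) ξ Ξ := by
  funext a b c
  simp only [Pi.add_apply, dissip_chi hg hΞ hK hξ, dissip_ord0, dissip_ord1 hg Ξ hK hξ,
    dissip_ord2 hg hΞ hK hξ, zero_add]

theorem entropy_chi_eq_add (hJ : IsOpen J) (hg : IsLorentzian g) (hΞ : IsSTF g Ξ)
    (hK : K.HasDerivOn K' J) (hK' : K'.HasDerivOn K'' J) (hξ : mu g ξ ∈ J) :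
    entropy g (K.chi g) ξ Ξ =
      entropy g (K.ord0 g) ξ Ξ + entropy g (K.ord1 g) ξ Ξ + entropy g (K.ord2 g) ξ Ξ := by
  funext a
  rw [entropy_eq (A := fun a => mixed1 K K' g ξ a + mixed2 K K' g ξ Ξ a)
    (hasPd_chi hg hΞ.1 hK hξ) (stress_chi hJ hg hΞ.1 hK hK' hξ) (dissip_chi hg hΞ hK hξ)]
  simp only [Pi.add_apply, entropy_ord0 hJ hg hK hK' hξ, entropy_ord1 hJ hg hΞ hK hK' hξ,
    entropy_ord2 hJ hg hΞ hK hK' hξ, Matrix.add_mulVec, contract_add]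
  ring

end Orders

/-! ### The conformal form of the coefficient functions -/

section ConformalForm

/-- If f behaves like a power of exponent s, then c μ⁻ⁿ f behaves like one of exponent s − n.
Iterating this gives the first and second derivatives of all conformal coefficients without
differentiating real powers again. -/
theorem hasDerivAt_div_pow_mul {f : ℝ → ℝ} {μ s : ℝ} (hf : HasDerivAt f (s / μ * f μ) μ)
    (hμ : μ ≠ 0) (c : ℝ) (n : ℕ) :
    HasDerivAt (fun t => c / t ^ n * f t) (c * (s - n) / μ ^ (n + 1) * f μ) μ := by
  have h := (((hasDerivAt_pow n μ).fun_inv (pow_ne_zero n hμ)).const_mul c).fun_mul hf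
  simp only [← div_eq_mul_inv] at h
  refine h.congr_deriv ?_
  rcases n with _ | n
  · simp
    field_simp
  · simp only [Nat.add_sub_cancel]
    field_simp
    push_cast
    ring

/-- On both half-lines the sign of μ from differentiating |μ| combines with 1/|μ| to 1/μ, so
time-like and space-like ξ^a obey the same equation. -/
theorem hasDerivAt_abs_rpow {μ : ℝ} (hμ : μ ≠ 0) (c s : ℝ) :
    HasDerivAt (fun t => c * |t| ^ s) (s / μ * (c * |μ| ^ s)) μ := by
  have h := ((hasDerivAt_abs hμ).rpow_const (p := s) (Or.inl (abs_ne_zero.2 hμ))).const_mul c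
  refine h.congr_deriv ?_
  rw [Real.rpow_sub_one (abs_ne_zero.2 hμ)]
  rcases lt_or_gt_of_ne hμ with h | h
  · simp only [abs_of_neg h, sign_neg h]
    simp
    field_simp
  · simp only [abs_of_pos h, sign_pos h]
    simp
    field_simp

noncomputable section

/-- The derivatives of coefficient functions of the conformal form. -/
def Coeffs.confDeriv (d : ℕ) (K : Coeffs) (c₀ k : ℝ) : Coeffs where
  zero μ := (1 - d / 2) / μ * (K.zero μ - c₀)
  one μ := -(((d : ℝ) + 2) / 2) / μ * K.one μ
  two1 μ := -D d 1 / μ * (K.two1 μ - k)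
  two2 μ := 4 * D d 1 * D d 2 / μ ^ 2 * (K.two1 μ - k)
  two3 μ := -(2 * D d 1 * D d 2 * D d 3) / μ ^ 3 * (K.two1 μ - k)

/-- The second derivatives of coefficient functions of the conformal form. -/
def Coeffs.confDeriv2 (d : ℕ) (K : Coeffs) (c₀ k : ℝ) : Coeffs where
  zero μ := (1 - d / 2) * (-d / 2) / μ ^ 2 * (K.zero μ - c₀)
  one μ := ((d : ℝ) + 2) * (d + 4) / 4 / μ ^ 2 * K.one μ
  two1 μ := D d 1 * D d 2 / μ ^ 2 * (K.two1 μ - k)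
  two2 μ := -(4 * D d 1 * D d 2 * D d 3) / μ ^ 3 * (K.two1 μ - k)
  two3 μ := 2 * D d 1 * D d 2 * D d 3 * D d 4 / μ ^ 4 * (K.two1 μ - k)

/-- The coefficient functions of the scalar `X`. -/
def xCoeffs (d : ℕ) : Coeffs where
  zero _ := 0
  one _ := 0
  two1 _ := 1
  two2 μ := -(4 * D d 1 / μ)
  two3 μ := 2 * D d 1 * D d 2 / μ ^ 2

/-- The derivatives of the coefficient functions of the scalar `X`. -/
def xCoeffs' (d : ℕ) : Coeffs where
  zero _ := 0
  one _ := 0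
  two1 _ := 0
  two2 μ := 4 * D d 1 / μ ^ 2
  two3 μ := -(4 * D d 1 * D d 2) / μ ^ 3

/-- The second derivatives of the coefficient functions of the scalar `X`. -/
def xCoeffs'' (d : ℕ) : Coeffs where
  zero _ := 0
  one _ := 0
  two1 _ := 0
  two2 μ := -(8 * D d 1) / μ ^ 3
  two3 μ := 12 * D d 1 * D d 2 / μ ^ 4

end

variable {K : Coeffs} {J : Set ℝ} {c₀ a b k e : ℝ}

/-- The Euler equations f' = (s/μ) f, with f itself on the right, are all that the later
calculations use of the power laws. -/
theorem HasConformalForm.hasDerivAt (h : HasConformalForm d K J c₀ a b k e) (hJ : IsOpen J)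
    {μ : ℝ} (hμJ : μ ∈ J) (hμ : μ ≠ 0) :
    HasDerivAt (fun t => K.zero t - c₀) ((1 - d / 2) / μ * (K.zero μ - c₀)) μ ∧
    HasDerivAt K.one (-(((d : ℝ) + 2) / 2) / μ * K.one μ) μ ∧
    HasDerivAt (fun t => K.two1 t - k) (-D d 1 / μ * (K.two1 μ - k)) μ := by
  have hn := hJ.mem_nhds hμJ
  have h0 : ∀ t ∈ J, K.zero t - c₀ = a * |t| ^ (1 - (d : ℝ) / 2) := fun t ht => by
    rw [(h t ht).1]; ring
  have h1 : ∀ t ∈ J, K.one t = b * |t| ^ (-(((d : ℝ) + 2) / 2)) := fun t ht => by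
    rw [(h t ht).2.1, neg_div]
  have h2 : ∀ t ∈ J, K.two1 t - k = e * |t| ^ (-D d 1) := fun t ht => by
    rw [(h t ht).2.2.1]; ring
  refine ⟨?_, ?_, ?_⟩
  · rw [h0 μ hμJ]
    exact (hasDerivAt_abs_rpow hμ a _).congr_of_eventuallyEq (Filter.eventually_of_mem hn h0)
  · rw [h1 μ hμJ]
    exact (hasDerivAt_abs_rpow hμ b _).congr_of_eventuallyEq (Filter.eventually_of_mem hn h1)
  · rw [h2 μ hμJ]
    exact (hasDerivAt_abs_rpow hμ e _).congr_of_eventuallyEq (Filter.eventually_of_mem hn h2)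

theorem HasConformalForm.hasDerivOn (h : HasConformalForm d K J c₀ a b k e) (hJ : IsOpen J)
    (h0 : ∀ μ ∈ J, μ ≠ 0) : K.HasDerivOn (K.confDeriv d c₀ k) J := by
  intro μ hμ
  obtain ⟨d0, d1, d2⟩ := h.hasDerivAt hJ hμ (h0 μ hμ)
  have hn := hJ.mem_nhds hμ
  refine ⟨?_, d1, ?_, ?_, ?_⟩
  · exact (d0.add_const c₀).congr_of_eventuallyEq
      (Filter.Eventually.of_forall fun t => (sub_add_cancel _ _).symm)
  · exact (d2.add_const k).congr_of_eventuallyEq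
      (Filter.Eventually.of_forall fun t => (sub_add_cancel _ _).symm)
  · refine ((hasDerivAt_div_pow_mul d2 (h0 μ hμ) (-(4 * D d 1)) 1).congr_of_eventuallyEq
      (Filter.eventually_of_mem hn fun t ht => ?_)).congr_deriv ?_
    · rw [(h t ht).2.2.2.1]
      ring
    · simp only [Coeffs.confDeriv, D]
      push_cast
      ring
  · refine ((hasDerivAt_div_pow_mul d2 (h0 μ hμ) (2 * D d 1 * D d 2) 2).congr_of_eventuallyEq
      (Filter.eventually_of_mem hn fun t ht => (h t ht).2.2.2.2)).congr_deriv ?_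
    simp only [Coeffs.confDeriv, D]
    push_cast
    ring

theorem HasConformalForm.hasDerivOn_confDeriv (h : HasConformalForm d K J c₀ a b k e)
    (hJ : IsOpen J) (h0 : ∀ μ ∈ J, μ ≠ 0) :
    (K.confDeriv d c₀ k).HasDerivOn (K.confDeriv2 d c₀ k) J := by
  intro μ hμ
  obtain ⟨d0, d1, d2⟩ := h.hasDerivAt hJ hμ (h0 μ hμ)
  refine ⟨?_, ?_, ?_, ?_, ?_⟩
  · have := hasDerivAt_div_pow_mul d0 (h0 μ hμ) (1 - d / 2) 1
    simp only [pow_one] at this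
    refine this.congr_deriv ?_
    simp only [Coeffs.confDeriv2]
    push_cast
    ring
  · have := hasDerivAt_div_pow_mul d1 (h0 μ hμ) (-(((d : ℝ) + 2) / 2)) 1
    simp only [pow_one] at this
    refine this.congr_deriv ?_
    simp only [Coeffs.confDeriv2]
    push_cast
    ring
  · have := hasDerivAt_div_pow_mul d2 (h0 μ hμ) (-D d 1) 1
    simp only [pow_one] at this
    refine this.congr_deriv ?_
    simp only [Coeffs.confDeriv2, D]
    push_cast
    ring
  · refine (hasDerivAt_div_pow_mul d2 (h0 μ hμ) (4 * D d 1 * D d 2) 2).congr_deriv ?_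
    simp only [Coeffs.confDeriv2, D]
    push_cast
    ring
  · refine (hasDerivAt_div_pow_mul d2 (h0 μ hμ) (-(2 * D d 1 * D d 2 * D d 3)) 3).congr_deriv ?_
    simp only [Coeffs.confDeriv2, D]
    push_cast
    ring

theorem hasDerivAt_div_pow {μ : ℝ} (hμ : μ ≠ 0) (c : ℝ) (n : ℕ) :
    HasDerivAt (fun t => c / t ^ n) (-(c * n) / μ ^ (n + 1)) μ := by
  have h1 : HasDerivAt (fun _ : ℝ => (1 : ℝ)) (0 / μ * 1) μ := by
    simpa using hasDerivAt_const μ (1 : ℝ)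
  simpa using hasDerivAt_div_pow_mul h1 hμ c n

theorem xCoeffs_hasDerivOn (h0 : ∀ μ ∈ J, μ ≠ 0) : (xCoeffs d).HasDerivOn (xCoeffs' d) J := by
  intro μ hμ
  refine ⟨hasDerivAt_const _ _, hasDerivAt_const _ _, hasDerivAt_const _ _, ?_, ?_⟩
  · have := hasDerivAt_div_pow (h0 μ hμ) (-(4 * D d 1)) 1
    simp only [pow_one, neg_div] at this
    refine this.congr_deriv ?_
    simp only [xCoeffs']
    push_cast
    ring
  · refine (hasDerivAt_div_pow (h0 μ hμ) (2 * D d 1 * D d 2) 2).congr_deriv ?_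
    simp only [xCoeffs']
    push_cast
    ring

theorem xCoeffs'_hasDerivOn (h0 : ∀ μ ∈ J, μ ≠ 0) :
    (xCoeffs' d).HasDerivOn (xCoeffs'' d) J := by
  intro μ hμ
  refine ⟨hasDerivAt_const _ _, hasDerivAt_const _ _, hasDerivAt_const _ _, ?_, ?_⟩
  · refine (hasDerivAt_div_pow (h0 μ hμ) (4 * D d 1) 2).congr_deriv ?_
    simp only [xCoeffs'']
    push_cast
    ring
  · refine (hasDerivAt_div_pow (h0 μ hμ) (-(4 * D d 1 * D d 2)) 3).congr_deriv ?_
    simp only [xCoeffs'']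
    push_cast
    ring

/-- Since X is itself an order-two generating function, its gradient and Hessian are instances of
`grad2` and `hess2`. -/
theorem xCoeffs_ord2 (g : Mat d) : (xCoeffs d).ord2 g = Xs g := by
  funext ξ Ξ
  simp only [Coeffs.ord2, xCoeffs, Xs]
  ring

end ConformalForm

/-! ### Explicit expressions for coefficient functions of the conformal form -/

section Explicit

variable {g : Mat d} {ξ : Vec d} {Ξ : Mat d} {K : Coeffs} {J : Set ℝ} {c₀ a b k e : ℝ}

theorem hess0_conf (hd : (d : ℝ) ≠ 0) (hμ : mu g ξ ≠ 0) (K : Coeffs) (c₀ k : ℝ) (i j : Fin d) :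
    hess0 (K.confDeriv d c₀ k) (K.confDeriv2 d c₀ k) g ξ i j =
      d * ((d : ℝ) - 2) * (K.zero (mu g ξ) - c₀) / mu g ξ ^ 2 * xixi g ξ i j := by
  simp only [hess0, Coeffs.confDeriv, Coeffs.confDeriv2, Matrix.add_apply, Matrix.smul_apply,
    Matrix.vecMulVec_apply, smul_eq_mul, xixi]
  field_simp
  ring

theorem hess1_conf (hμ : mu g ξ ≠ 0) (K : Coeffs) (c₀ k : ℝ) (Ξ : Mat d) (i j : Fin d) :
    hess1 K (K.confDeriv d c₀ k) (K.confDeriv2 d c₀ k) g ξ Ξ i j = K.one (mu g ξ) *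
      (((d : ℝ) + 2) * (d + 4) / mu g ξ ^ 2 * nu g ξ Ξ * (up g ξ i * up g ξ j)
        - 4 * ((d : ℝ) + 2) / mu g ξ * sprod (up g ξ) (ell g ξ Ξ) i j
        - ((d : ℝ) + 2) / mu g ξ * nu g ξ Ξ * g⁻¹ i j + 2 * upM g Ξ i j) := by
  simp only [hess1, Coeffs.confDeriv, Coeffs.confDeriv2, Matrix.add_apply, Matrix.smul_apply,
    Matrix.vecMulVec_apply, smul_eq_mul, sprod]
  field_simp
  ring

theorem hess1_conf_decomposition (hd : (d : ℝ) ≠ 0) (hd1 : (d : ℝ) - 1 ≠ 0) (hμ : mu g ξ ≠ 0)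
    (K : Coeffs) (c₀ k : ℝ) (Ξ : Mat d) (i j : Fin d) :
    hess1 K (K.confDeriv d c₀ k) (K.confDeriv2 d c₀ k) g ξ Ξ i j =
      K.one (mu g ξ) * (nu g ξ Ξ / mu g ξ ^ 2) * ((d : ℝ) ^ 2 * (d + 1) / ((d : ℝ) - 1))
          * xixi g ξ i j
        - 4 * ((d : ℝ) + 1) * K.one (mu g ξ) / mu g ξ * sprod (up g ξ) (rvec g ξ Ξ) i j
        + 2 * K.one (mu g ξ) * tauT g ξ Ξ i j := by
  rw [hess1_conf hμ]
  simp only [tauT, xixi, sprod, rvec]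
  field_simp
  ring

theorem mixed1_conf (hd : (d : ℝ) ≠ 0) (hμ : mu g ξ ≠ 0) (K : Coeffs) (c₀ k : ℝ)
    (i j m : Fin d) :
    mixed1 K (K.confDeriv d c₀ k) g ξ i j m = K.one (mu g ξ) * (g⁻¹ i j * up g ξ m
      + g⁻¹ i m * up g ξ j + up g ξ i * g⁻¹ j m
      - ((d : ℝ) + 2) / mu g ξ * (up g ξ i * up g ξ j * up g ξ m)) := by
  simp only [mixed1, Coeffs.confDeriv, Matrix.add_apply, Matrix.sub_apply, Matrix.smul_apply,
    Matrix.vecMulVec_apply, smul_eq_mul]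
  field_simp
  ring

theorem HasConformalForm.two2_eq (h : HasConformalForm d K J c₀ a b k e) (hξ : mu g ξ ∈ J) :
    K.two2 (mu g ξ) = -(4 * D d 1 / mu g ξ) * (K.two1 (mu g ξ) - k) := (h _ hξ).2.2.2.1

theorem HasConformalForm.two3_eq (h : HasConformalForm d K J c₀ a b k e) (hξ : mu g ξ ∈ J) :
    K.two3 (mu g ξ) = 2 * D d 1 * D d 2 / mu g ξ ^ 2 * (K.two1 (mu g ξ) - k) := (h _ hξ).2.2.2.2

theorem grad2_xCoeffs (hμ : mu g ξ ≠ 0) (Ξ : Mat d) :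
    grad2 (xCoeffs d) (xCoeffs' d) g ξ Ξ = Xv g ξ Ξ := by
  funext i
  simp only [grad2, xCoeffs, xCoeffs', Xv, rvec, psi3, D]
  field_simp
  ring

theorem hess2_xCoeffs (hμ : mu g ξ ≠ 0) (Ξ : Mat d) :
    hess2 (xCoeffs d) (xCoeffs' d) (xCoeffs'' d) g ξ Ξ = Xt g ξ Ξ := by
  ext i j
  have hN : (upM g Ξ * g * upM g Ξ) i j = upM2 g Ξ i j := rfl
  simp only [hess2, xCoeffs, xCoeffs', xCoeffs'', Xt, hN, psi3, sprod, Matrix.add_apply,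
    Matrix.smul_apply, Matrix.vecMulVec_apply, smul_eq_mul, D]
  field_simp
  ring

theorem gradXi_Xs (hg : IsLorentzian g) (hΞ : Ξ.IsSymm) (hμ : mu g ξ ≠ 0) :
    gradXi (Xs g) ξ Ξ = Xv g ξ Ξ := by
  rw [← grad2_xCoeffs hμ, ← xCoeffs_ord2]
  funext i
  -- The coefficients of X are rational in μ with their only pole at zero, so both signs of μ are
  -- covered by this one open set.
  exact (hasPd_ord2 (J := {0}ᶜ) hg hΞ (xCoeffs_hasDerivOn fun _ h => h) hμ i).pd_eq

theorem stress_Xs (hg : IsLorentzian g) (hΞ : Ξ.IsSymm) (hμ : mu g ξ ≠ 0) :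
    stress (Xs g) ξ Ξ = Xt g ξ Ξ := by
  rw [← hess2_xCoeffs hμ, ← xCoeffs_ord2]
  exact stress_ord2 (J := {0}ᶜ) isOpen_compl_singleton hg hΞ (xCoeffs_hasDerivOn fun _ h => h)
    (xCoeffs'_hasDerivOn fun _ h => h) hμ

/-- This is Euler's identity: ψ₁, ψ₂/μ and ψ₃/μ² are homogeneous of degree zero in ξ_a. -/
theorem Xv_dotProduct (hg : IsLorentzian g) (hΞ : Ξ.IsSymm) (hμ : mu g ξ ≠ 0) :
    Xv g ξ Ξ ⬝ᵥ ξ = 0 := by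
  have e : Xv g ξ Ξ = (8 * D d 1 / mu g ξ ^ 2) •
      (psi2 g ξ Ξ • up g ξ + (D d 2 * nu g ξ Ξ) • (ell g ξ Ξ - (nu g ξ Ξ / mu g ξ) • up g ξ)
        - mu g ξ • ell2 g ξ Ξ) := rfl
  rw [e]
  simp only [smul_dotProduct, add_dotProduct, sub_dotProduct, up_dotProduct, ell_dotProduct,
    ell2_dotProduct hg hΞ, smul_eq_mul]
  field_simp
  ring

theorem Yt_eq (hμ : mu g ξ ≠ 0) (Ξ : Mat d) : Yt g ξ Ξ =
    hess2 (xCoeffs d) (xCoeffs' d) (xCoeffs'' d) g ξ Ξ + (1 / mu g ξ) •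
      (Matrix.vecMulVec (Xv g ξ Ξ) (up g ξ) + Matrix.vecMulVec (up g ξ) (Xv g ξ Ξ)) := by
  ext i j
  rw [hess2_xCoeffs hμ]
  simp only [Yt, sprod, Matrix.add_apply, Matrix.smul_apply, Matrix.vecMulVec_apply, smul_eq_mul]
  ring

/-- Differentiating X^a ξ_a = 0 gives X^ab ξ_b = −X^a, and the term (2/μ) X^(a ξ^b) contributes
+X^a. -/
theorem Yt_mulVec (hg : IsLorentzian g) (hΞ : Ξ.IsSymm) (hμ : mu g ξ ≠ 0) :
    (Yt g ξ Ξ).mulVec ξ = 0 := by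
  funext i
  rw [Yt_eq hμ]
  simp only [Matrix.add_mulVec, Matrix.smul_mulVec, Pi.add_apply, Pi.smul_apply, smul_eq_mul,
    vecMulVec_mulVec_apply, up_dotProduct, Xv_dotProduct hg hΞ hμ, hess2_mulVec hg hΞ,
    Pi.zero_apply]
  simp only [xCoeffs, xCoeffs', xCoeffs'', Xv, rvec, D]
  field_simp
  ring

/-- The added term has no trace because X^a ξ_a = 0, so this is the trace of the Hessian of X, which
is again a multiple of X. -/
theorem contract_Yt (hg : IsLorentzian g) (hΞ : IsSTF g Ξ) (hμ : mu g ξ ≠ 0) :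
    contract g (Yt g ξ Ξ) = -(8 * D d 1 / mu g ξ) * Xs g ξ Ξ := by
  rw [Yt_eq hμ]
  simp only [contract_add, contract_smul, contract_vecMulVec, mulVec_g_up hg, up_dotProduct_g hg,
    Xv_dotProduct hg hΞ.1 hμ, contract_hess2 hg hΞ]
  simp only [xCoeffs, xCoeffs', xCoeffs'', Xs, psi3, D]
  field_simp
  ring

/-- The product rule for the Hessian of f₂X, with f₂' = −(D₁/μ) f₂. The remaining part kψ₁ of χ does
not depend on ξ_a. -/
theorem hess2_conf (hμ : mu g ξ ≠ 0) (h : HasConformalForm d K J c₀ a b k e) (hξ : mu g ξ ∈ J)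
    (Ξ : Mat d) (i j : Fin d) :
    hess2 K (K.confDeriv d c₀ k) (K.confDeriv2 d c₀ k) g ξ Ξ i j =
      2 * D d 1 * Xs g ξ Ξ * (K.two1 (mu g ξ) - k) / mu g ξ ^ 2 *
          (2 * D d 2 * (up g ξ i * up g ξ j) - mu g ξ * g⁻¹ i j)
        - 4 * D d 1 * (K.two1 (mu g ξ) - k) / mu g ξ * sprod (Xv g ξ Ξ) (up g ξ) i j
        + (K.two1 (mu g ξ) - k) * Xt g ξ Ξ i j := by
  have hN : (upM g Ξ * g * upM g Ξ) i j = upM2 g Ξ i j := rfl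
  simp only [hess2, h.two2_eq hξ, h.two3_eq hξ, Coeffs.confDeriv, Coeffs.confDeriv2, Xt, Xv, Xs,
    rvec, hN, psi3, sprod, Matrix.add_apply, Matrix.smul_apply, Matrix.vecMulVec_apply,
    smul_eq_mul, D]
  -- The nonconstant part becomes a single atom; what is left is a rational identity linear in f.
  generalize K.two1 (mu g ξ) - k = f
  field_simp
  ring

/-- The trace of Y^ab is removed by means of h^ab; being proportional to X, it merges with the X
terms into a multiple of ξ^a ξ^b − (μ/d) g^ab. -/
theorem hess2_conf_decomposition (hg : IsLorentzian g) (hΞ : IsSTF g Ξ) (hd : (d : ℝ) ≠ 0)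
    (hd1 : (d : ℝ) - 1 ≠ 0) (hμ : mu g ξ ≠ 0) (h : HasConformalForm d K J c₀ a b k e)
    (hξ : mu g ξ ∈ J) (i j : Fin d) :
    hess2 K (K.confDeriv d c₀ k) (K.confDeriv2 d c₀ k) g ξ Ξ i j =
      (K.two1 (mu g ξ) - k) * Xs g ξ Ξ / mu g ξ ^ 2
          * (d * ((d : ℝ) + 2) * (d + 3) / ((d : ℝ) - 1)) * xixi g ξ i j
        - 2 * ((d : ℝ) + 3) * (K.two1 (mu g ξ) - k) / mu g ξ * sprod (Xv g ξ Ξ) (up g ξ) i j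
        + (K.two1 (mu g ξ) - k) * YtT g ξ Ξ i j := by
  rw [hess2_conf hμ h hξ]
  simp only [YtT, contract_Yt hg hΞ hμ, Yt, hproj, xixi, D]
  generalize K.two1 (mu g ξ) - k = f
  field_simp
  ring

theorem mixed2_conf (hg : IsLorentzian g) (hΞ : Ξ.IsSymm) (hd : (d : ℝ) ≠ 0) (hμ : mu g ξ ≠ 0)
    (h : HasConformalForm d K J c₀ a b k e) (hξ : mu g ξ ∈ J) (i j m : Fin d) :
    mixed2 K (K.confDeriv d c₀ k) g ξ Ξ i j m =
      4 * D d 1 * (K.two1 (mu g ξ) - k) / mu g ξ ^ 3 * up g ξ i * (-(mu g ξ ^ 2 * upM g Ξ j m)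
          + 4 * D d 2 * mu g ξ * (sprod (up g ξ) (ell g ξ Ξ) j m - nu g ξ Ξ / d * g⁻¹ j m)
          - 2 * D d 2 * D d 3 * nu g ξ Ξ * xixi g ξ j m)
        - 8 * D d 1 * (K.two1 (mu g ξ) - k) / mu g ξ *
          ((g⁻¹ i j * ell g ξ Ξ m + g⁻¹ i m * ell g ξ Ξ j) / 2
          + (up g ξ j * upM g Ξ m i + up g ξ m * upM g Ξ j i) / 2
          - 2 / d * g⁻¹ j m * ell g ξ Ξ i)
        + 8 * D d 1 * D d 2 * (K.two1 (mu g ξ) - k) / mu g ξ ^ 2 * (ell g ξ Ξ i * xixi g ξ j m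
          + nu g ξ Ξ * ((g⁻¹ i j * up g ξ m + g⁻¹ i m * up g ξ j) / 2
            - up g ξ i * g⁻¹ j m / d)) := by
  simp only [mixed2, h.two2_eq hξ, h.two3_eq hξ, Coeffs.confDeriv, xixi, sprod, Matrix.add_apply,
    Matrix.sub_apply, Matrix.smul_apply, Matrix.vecMulVec_apply, smul_eq_mul,
    (upM_isSymm hg hΞ).apply i m, (upM_isSymm hg hΞ).apply i j, D]
  generalize K.two1 (mu g ξ) - k = f
  push_cast
  field_simp
  ring

theorem mixed1_conf_symm (hg : IsLorentzian g) (hd : (d : ℝ) ≠ 0) (hμ : mu g ξ ≠ 0) (K : Coeffs)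
    (c₀ k : ℝ) (i j m : Fin d) : mixed1 K (K.confDeriv d c₀ k) g ξ i j m =
      mixed1 K (K.confDeriv d c₀ k) g ξ j i m := by
  rw [mixed1_conf hd hμ, mixed1_conf hd hμ, hg.inv_isSymm.apply i j]
  ring

/-- Here the fixed ratios between χ²₁ − k, χ²₂ and χ²₃ are essential: symmetry in the first two
indices couples the three coefficients. -/
theorem mixed2_conf_symm (hg : IsLorentzian g) (hΞ : Ξ.IsSymm) (hd : (d : ℝ) ≠ 0)
    (hμ : mu g ξ ≠ 0) (h : HasConformalForm d K J c₀ a b k e) (hξ : mu g ξ ∈ J) (i j m : Fin d) :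
    mixed2 K (K.confDeriv d c₀ k) g ξ Ξ i j m = mixed2 K (K.confDeriv d c₀ k) g ξ Ξ j i m := by
  rw [mixed2_conf hg hΞ hd hμ h hξ, mixed2_conf hg hΞ hd hμ h hξ]
  simp only [xixi, sprod, hg.inv_isSymm.apply i j, (upM_isSymm hg hΞ).apply i j,
    (upM_isSymm hg hΞ).apply j m, (upM_isSymm hg hΞ).apply i m, D]
  generalize K.two1 (mu g ξ) - k = f
  push_cast
  field_simp
  ring

theorem contract_hess0_conf (hg : IsLorentzian g) (hμ : mu g ξ ≠ 0) (K : Coeffs) (c₀ k : ℝ) :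
    contract g (hess0 (K.confDeriv d c₀ k) (K.confDeriv2 d c₀ k) g ξ) = 0 := by
  rw [contract_hess0 hg]
  simp only [Coeffs.confDeriv, Coeffs.confDeriv2]
  field_simp
  ring

theorem contract_hess1_conf (hg : IsLorentzian g) (hΞ : IsSTF g Ξ) (hμ : mu g ξ ≠ 0) (K : Coeffs)
    (c₀ k : ℝ) : contract g (hess1 K (K.confDeriv d c₀ k) (K.confDeriv2 d c₀ k) g ξ Ξ) = 0 := by
  rw [contract_hess1 hg hΞ]
  simp only [Coeffs.confDeriv, Coeffs.confDeriv2]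
  field_simp
  ring

theorem contract_hess2_conf (hg : IsLorentzian g) (hΞ : IsSTF g Ξ) (hμ : mu g ξ ≠ 0)
    (h : HasConformalForm d K J c₀ a b k e) (hξ : mu g ξ ∈ J) :
    contract g (hess2 K (K.confDeriv d c₀ k) (K.confDeriv2 d c₀ k) g ξ Ξ) = 0 := by
  rw [contract_hess2 hg hΞ]
  simp only [h.two2_eq hξ, h.two3_eq hξ, Coeffs.confDeriv, Coeffs.confDeriv2, D]
  generalize K.two1 (mu g ξ) - k = f
  push_cast
  field_simp
  ring

theorem hess0_conf_mulVec (hμ : mu g ξ ≠ 0) (K : Coeffs) (c₀ k : ℝ) (i : Fin d) :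
    (hess0 (K.confDeriv d c₀ k) (K.confDeriv2 d c₀ k) g ξ).mulVec ξ i =
      ((d : ℝ) - 1) * (d - 2) * (K.zero (mu g ξ) - c₀) / mu g ξ * up g ξ i := by
  rw [hess0_mulVec]
  simp only [Coeffs.confDeriv, Coeffs.confDeriv2]
  field_simp
  ring

theorem hess1_conf_mulVec (hμ : mu g ξ ≠ 0) (K : Coeffs) (c₀ k : ℝ) (Ξ : Mat d) (i : Fin d) :
    (hess1 K (K.confDeriv d c₀ k) (K.confDeriv2 d c₀ k) g ξ Ξ).mulVec ξ i = K.one (mu g ξ) *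
      (((d : ℝ) + 2) * (d + 1) * nu g ξ Ξ / mu g ξ * up g ξ i - 2 * (d + 1) * ell g ξ Ξ i) := by
  rw [hess1_mulVec]
  simp only [Coeffs.confDeriv, Coeffs.confDeriv2]
  field_simp
  ring

theorem hess2_conf_mulVec (hg : IsLorentzian g) (hΞ : Ξ.IsSymm) (hμ : mu g ξ ≠ 0)
    (h : HasConformalForm d K J c₀ a b k e) (hξ : mu g ξ ∈ J) (i : Fin d) :
    (hess2 K (K.confDeriv d c₀ k) (K.confDeriv2 d c₀ k) g ξ Ξ).mulVec ξ i =
      (K.two1 (mu g ξ) - k) * (((d : ℝ) + 2) * (d + 3) / mu g ξ * Xs g ξ Ξ * up g ξ i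
        - (d + 3) * Xv g ξ Ξ i) := by
  rw [hess2_mulVec hg hΞ]
  simp only [h.two2_eq hξ, h.two3_eq hξ, Coeffs.confDeriv, Coeffs.confDeriv2, Xv, Xs, rvec, psi3, D]
  generalize K.two1 (mu g ξ) - k = f
  push_cast
  field_simp
  ring

theorem entropy0_conf (hμ : mu g ξ ≠ 0) (K : Coeffs) (c₀ k : ℝ) (i : Fin d) :
    grad0 (K.confDeriv d c₀ k) g ξ i
        - (hess0 (K.confDeriv d c₀ k) (K.confDeriv2 d c₀ k) g ξ).mulVec ξ i =
      -(d * ((d : ℝ) - 2) * (K.zero (mu g ξ) - c₀) / mu g ξ) * up g ξ i := by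
  rw [hess0_conf_mulVec hμ, grad0]
  simp only [Coeffs.confDeriv]
  field_simp
  ring

theorem entropy1_conf (hg : IsLorentzian g) (hΞ : IsSTF g Ξ) (hμ : mu g ξ ≠ 0) (K : Coeffs)
    (c₀ k : ℝ) (i : Fin d) : grad1 K (K.confDeriv d c₀ k) g ξ Ξ i
        - (hess1 K (K.confDeriv d c₀ k) (K.confDeriv2 d c₀ k) g ξ Ξ).mulVec ξ i
        - contract Ξ (mixed1 K (K.confDeriv d c₀ k) g ξ i) =
      -(d * ((d : ℝ) + 1) * K.one (mu g ξ) * (nu g ξ Ξ / mu g ξ)) * up g ξ i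
        + 2 * ((d : ℝ) + 1) * K.one (mu g ξ) * rvec g ξ Ξ i := by
  rw [hess1_conf_mulVec hμ, grad1, contract_xi_mixed1 hg hΞ]
  simp only [Coeffs.confDeriv, rvec]
  field_simp
  ring

theorem entropy2_conf (hg : IsLorentzian g) (hΞ : IsSTF g Ξ) (hμ : mu g ξ ≠ 0)
    (h : HasConformalForm d K J c₀ a b k e) (hξ : mu g ξ ∈ J) (i : Fin d) :
    grad2 K (K.confDeriv d c₀ k) g ξ Ξ i
        - (hess2 K (K.confDeriv d c₀ k) (K.confDeriv2 d c₀ k) g ξ Ξ).mulVec ξ i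
        - contract Ξ (mixed2 K (K.confDeriv d c₀ k) g ξ Ξ i) =
      -(((d : ℝ) + 2) ^ 2 * (K.two1 (mu g ξ) - k) / mu g ξ) * Gv g ξ Ξ i := by
  rw [hess2_mulVec hg hΞ.1, grad2, contract_xi_mixed2 hg hΞ]
  simp only [h.two2_eq hξ, h.two3_eq hξ, Coeffs.confDeriv, Coeffs.confDeriv2, Gv, psi3, D]
  generalize K.two1 (mu g ξ) - k = f
  push_cast
  field_simp
  ring

/-! ### The entropy current at order two in terms of the decomposition of `ξ_ab` -/

theorem tauT_eq (hd : (d : ℝ) ≠ 0) (hd1 : (d : ℝ) - 1 ≠ 0) (hμ : mu g ξ ≠ 0) (Ξ : Mat d) :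
    tauT g ξ Ξ = upM g Ξ
      + (((d : ℝ) - 2) / (d - 1) * (nu g ξ Ξ / mu g ξ ^ 2)) • Matrix.vecMulVec (up g ξ) (up g ξ)
      + (1 / ((d : ℝ) - 1) * (nu g ξ Ξ / mu g ξ)) • g⁻¹
      - (1 / mu g ξ) • (Matrix.vecMulVec (up g ξ) (ell g ξ Ξ)
        + Matrix.vecMulVec (ell g ξ Ξ) (up g ξ)) := by
  ext i j
  simp only [tauT, xixi, sprod, rvec, Matrix.add_apply, Matrix.sub_apply,
    Matrix.smul_apply, Matrix.vecMulVec_apply, smul_eq_mul]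
  field_simp
  ring

theorem tauT_mulVec_xi (hd : (d : ℝ) ≠ 0) (hd1 : (d : ℝ) - 1 ≠ 0) (hμ : mu g ξ ≠ 0) (Ξ : Mat d) :
    (tauT g ξ Ξ).mulVec ξ = 0 := by
  funext i
  have hG : g⁻¹.mulVec ξ i = up g ξ i := rfl
  have hM : (upM g Ξ).mulVec ξ i = ell g ξ Ξ i := rfl
  rw [tauT_eq hd hd1 hμ]
  simp only [Matrix.add_mulVec, Matrix.sub_mulVec, Matrix.smul_mulVec, Pi.add_apply, Pi.sub_apply,
    Pi.smul_apply, smul_eq_mul, vecMulVec_mulVec_apply, hG, hM, up_dotProduct, ell_dotProduct,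
    Pi.zero_apply]
  field_simp
  ring

theorem tauT_mulVec_ell (hg : IsLorentzian g) (hd : (d : ℝ) ≠ 0) (hd1 : (d : ℝ) - 1 ≠ 0)
    (hμ : mu g ξ ≠ 0) (Ξ : Mat d) (i : Fin d) :
    (tauT g ξ Ξ).mulVec (g.mulVec (ell g ξ Ξ)) i = ell2 g ξ Ξ i
      + (((d : ℝ) - 2) / (d - 1) * (nu g ξ Ξ / mu g ξ) ^ 2 - psi2 g ξ Ξ / mu g ξ) * up g ξ i
      - (((d : ℝ) - 2) / (d - 1)) * (nu g ξ Ξ / mu g ξ) * ell g ξ Ξ i := by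
  have hG : g⁻¹.mulVec (g.mulVec (ell g ξ Ξ)) i = ell g ξ Ξ i := mulVec_inv_row hg _ _
  have hM : (upM g Ξ).mulVec (g.mulVec (ell g ξ Ξ)) i = ell2 g ξ Ξ i := rfl
  rw [tauT_eq hd hd1 hμ]
  simp only [Matrix.add_mulVec, Matrix.sub_mulVec, Matrix.smul_mulVec, Pi.add_apply, Pi.sub_apply,
    Pi.smul_apply, smul_eq_mul, vecMulVec_mulVec_apply, hG, hM, up_dotProduct_g hg,
    ell_dotProduct, ← psi2_eq hg]
  field_simp
  ring

theorem low_rvec (hg : IsLorentzian g) (ξ : Vec d) (Ξ : Mat d) :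
    low g (rvec g ξ Ξ) = g.mulVec (ell g ξ Ξ) - (nu g ξ Ξ / mu g ξ) • ξ := by
  have e : rvec g ξ Ξ = ell g ξ Ξ - (nu g ξ Ξ / mu g ξ) • up g ξ := rfl
  rw [e, low, Matrix.mulVec_sub, Matrix.mulVec_smul, mulVec_g_up hg]

/-- The covectors r_a and ℓ_a differ by a multiple of ξ_a, which τ̃^ab annihilates. -/
theorem tauT_mulVec_low_rvec (hg : IsLorentzian g) (hd : (d : ℝ) ≠ 0) (hd1 : (d : ℝ) - 1 ≠ 0)
    (hμ : mu g ξ ≠ 0) (Ξ : Mat d) : (tauT g ξ Ξ).mulVec (low g (rvec g ξ Ξ)) =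
      (tauT g ξ Ξ).mulVec (g.mulVec (ell g ξ Ξ)) := by
  rw [low_rvec hg, Matrix.mulVec_sub, Matrix.mulVec_smul, tauT_mulVec_xi hd hd1 hμ, smul_zero,
    sub_zero]

theorem rvec_dotProduct_low (hg : IsLorentzian g) (hμ : mu g ξ ≠ 0) (Ξ : Mat d) :
    rvec g ξ Ξ ⬝ᵥ low g (rvec g ξ Ξ) = psi2 g ξ Ξ - nu g ξ Ξ ^ 2 / mu g ξ := by
  have e : rvec g ξ Ξ = ell g ξ Ξ - (nu g ξ Ξ / mu g ξ) • up g ξ := rfl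
  rw [low_rvec hg, e]
  simp only [dotProduct_sub, sub_dotProduct, dotProduct_smul, smul_dotProduct, up_dotProduct_g hg,
    ell_dotProduct, up_dotProduct, ← psi2_eq hg, smul_eq_mul]
  field_simp
  ring

theorem contract_tauT (hg : IsLorentzian g) (hΞ : IsSTF g Ξ) (hd : (d : ℝ) ≠ 0)
    (hd1 : (d : ℝ) - 1 ≠ 0) (hμ : mu g ξ ≠ 0) : contract g (tauT g ξ Ξ) = 0 := by
  rw [tauT_eq hd hd1 hμ]
  simp only [contract_add, contract_sub, contract_smul, contract_vecMulVec, contract_inv hg,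
    mulVec_g_up hg, up_dotProduct, up_dotProduct_g hg, ell_dotProduct, contract_upM hg, hΞ.2]
  field_simp
  ring

theorem contract_tauT_self (hg : IsLorentzian g) (hΞ : IsSTF g Ξ) (hd : (d : ℝ) ≠ 0)
    (hd1 : (d : ℝ) - 1 ≠ 0) (hμ : mu g ξ ≠ 0) :
    contract (g * tauT g ξ Ξ * g) (tauT g ξ Ξ) = psi1 g Ξ - 2 / mu g ξ * psi2 g ξ Ξ
      + ((d : ℝ) - 2) / (d - 1) * (nu g ξ Ξ / mu g ξ) ^ 2 := by
  have hs : ∀ u w : Vec d, g * Matrix.vecMulVec u w * g =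
      Matrix.vecMulVec (g.mulVec u) (g.mulVec w) := fun u w => by
    rw [Matrix.mul_vecMulVec, Matrix.vecMulVec_mul, ← Matrix.mulVec_transpose, hg.isSymm]
  have hM : g * upM g Ξ * g = Ξ := by
    rw [upM, ← Matrix.mul_assoc, ← Matrix.mul_assoc, hg.mul_inv, Matrix.one_mul, Matrix.mul_assoc,
      hg.inv_mul, Matrix.mul_one]
  have hG : g * g⁻¹ * g = g := by rw [hg.mul_inv, Matrix.one_mul]
  have ht : ∀ u w, contract (tauT g ξ Ξ) (Matrix.vecMulVec u w) =
    u ⬝ᵥ (tauT g ξ Ξ).mulVec w := contract_vecMulVec _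
  have hsym : (tauT g ξ Ξ).IsSymm := by
    rw [tauT_eq hd hd1 hμ, Matrix.IsSymm]
    simp only [Matrix.transpose_add, Matrix.transpose_sub, Matrix.transpose_smul,
      Matrix.transpose_vecMulVec, (upM_isSymm hg hΞ.1).eq, hg.inv_isSymm.eq]
    rw [add_comm (Matrix.vecMulVec (ell g ξ Ξ) (up g ξ))]
  have hξ : ∀ w, ξ ⬝ᵥ (tauT g ξ Ξ).mulVec w = 0 := fun w => by
    rw [dotProduct_mulVec_comm hsym, tauT_mulVec_xi hd hd1 hμ, dotProduct_zero]
  have e : g * tauT g ξ Ξ * g = Ξ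
      + (((d : ℝ) - 2) / (d - 1) * (nu g ξ Ξ / mu g ξ ^ 2)) • Matrix.vecMulVec ξ ξ
      + (1 / ((d : ℝ) - 1) * (nu g ξ Ξ / mu g ξ)) • g
      - (1 / mu g ξ) • (Matrix.vecMulVec ξ (g.mulVec (ell g ξ Ξ))
        + Matrix.vecMulVec (g.mulVec (ell g ξ Ξ)) ξ) := by
    rw [tauT_eq hd hd1 hμ]
    simp only [Matrix.mul_add, Matrix.add_mul, Matrix.mul_sub, Matrix.sub_mul, Matrix.mul_smul,
      Matrix.smul_mul, hs, hM, hG, mulVec_g_up hg]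
  -- Only one of the two factors is expanded. Its terms containing ξ_a or g_ab vanish against τ̃^ab
  -- by orthogonality and trace-freeness, so the square reduces to ξ_ab τ̃^ab.
  rw [e, contract_comm]
  simp only [contract_add, contract_sub, contract_smul, ht, hξ, tauT_mulVec_xi hd hd1 hμ,
    dotProduct_zero, contract_comm _ g, contract_tauT hg hΞ hd hd1 hμ]
  rw [contract_comm, tauT_eq hd hd1 hμ]
  simp only [contract_add, contract_sub, contract_smul, contract_vecMulVec, contract_inv_comm,
    hΞ.2, mulVec_up hg, mulVec_ell hg, up_dotProduct_g hg, ell_dotProduct, ell2_dotProduct hg hΞ.1,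
    contract_upM_self, ← psi2_eq hg]
  field_simp
  ring

theorem Gv_eq (hg : IsLorentzian g) (hΞ : IsSTF g Ξ) (hd : (d : ℝ) ≠ 0)
    (hd1 : (d : ℝ) - 1 ≠ 0) (hμ : mu g ξ ≠ 0) (i : Fin d) :
    Gv g ξ Ξ i = ((d : ℝ) ^ 2 * (d + 1) / (2 * ((d : ℝ) - 1)) * (nu g ξ Ξ ^ 2 / mu g ξ ^ 2)
        - 2 * ((d : ℝ) + 1) / mu g ξ * (∑ j, rvec g ξ Ξ j * low g (rvec g ξ Ξ) j)
        + contract (g * tauT g ξ Ξ * g) (tauT g ξ Ξ)) * up g ξ i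
      - 2 * d * ((d : ℝ) + 1) / ((d : ℝ) - 1) * (nu g ξ Ξ / mu g ξ) * rvec g ξ Ξ i
      + 4 * ∑ j, tauT g ξ Ξ i j * low g (rvec g ξ Ξ) j := by
  have h1 : ∑ j, rvec g ξ Ξ j * low g (rvec g ξ Ξ) j = _ := rvec_dotProduct_low hg hμ Ξ
  have h2 : ∑ j, tauT g ξ Ξ i j * low g (rvec g ξ Ξ) j = _ :=
    congrFun (tauT_mulVec_low_rvec hg hd hd1 hμ Ξ) i
  rw [h1, h2, tauT_mulVec_ell hg hd hd1 hμ, contract_tauT_self hg hΞ hd hd1 hμ]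
  simp only [Gv, rvec, psi3, D]
  push_cast
  field_simp
  ring

/-! ### Thermodynamic variables -/

/-- The square roots drop out of every quantity quadratic in u_a, so densities become rational in μ.
-/
theorem velLow_mul_velLow (hμ : mu g ξ < 0) (i j : Fin d) :
    velLow g ξ i * velLow g ξ j = -(ξ i * ξ j) / mu g ξ := by
  have h : √(-mu g ξ) * √(-mu g ξ) = -mu g ξ := Real.mul_self_sqrt (by linarith)
  rw [velLow, velLow, div_mul_div_comm, h, div_neg, neg_div]

theorem density_eq (hμ : mu g ξ < 0) (T : Mat d) :
    density g ξ T = -(T.mulVec ξ ⬝ᵥ ξ) / mu g ξ := by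
  simp only [density, mul_assoc, velLow_mul_velLow hμ, dotProduct, Matrix.mulVec, Finset.sum_mul,
    ← Finset.sum_neg_distrib, Finset.sum_div]
  exact Finset.sum_congr rfl fun a _ => Finset.sum_congr rfl fun b _ => by ring

theorem pressure_eq (g : Mat d) (ξ : Vec d) (T : Mat d) :
    pressure g ξ T = (contract g T + density g ξ T) / ((d : ℝ) - 1) := by
  simp only [pressure, density, contract, ← Finset.sum_add_distrib]
  congr 1
  exact Finset.sum_congr rfl fun a _ => Finset.sum_congr rfl fun b _ => by ring

theorem heatFlux_eq (g : Mat d) (ξ : Vec d) (T : Mat d) (i : Fin d) :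
    heatFlux g ξ T i =
      -(T.mulVec ξ i + up g ξ i * density g ξ T) / √(-mu g ξ) := by
  have h : ∑ c, T i c * velLow g ξ c = T.mulVec ξ i / √(-mu g ξ) := by
    simp only [velLow, Matrix.mulVec, dotProduct, Finset.sum_div, mul_div_assoc]
  rw [heatFlux, h, vel]
  ring

end Explicit

/-! ### The conformal form implies the conformal conditions -/

section Symmetry

variable {g : Mat d} {ξ : Vec d} {Ξ : Mat d} {K K' K'' : Coeffs} {J : Set ℝ} {c₀ a b k e : ℝ}

theorem mixed1_swap (hg : IsLorentzian g) (K K' : Coeffs) (ξ : Vec d) (i j m : Fin d) :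
    mixed1 K K' g ξ i j m = mixed1 K K' g ξ i m j := by
  simp only [mixed1, Matrix.add_apply, Matrix.sub_apply, Matrix.smul_apply, Matrix.vecMulVec_apply,
    smul_eq_mul, hg.inv_isSymm.apply j m]
  ring

theorem mixed2_swap (hg : IsLorentzian g) (hΞ : Ξ.IsSymm) (K K' : Coeffs) (ξ : Vec d)
    (i j m : Fin d) : mixed2 K K' g ξ Ξ i j m = mixed2 K K' g ξ Ξ i m j := by
  simp only [mixed2, Matrix.add_apply, Matrix.sub_apply, Matrix.smul_apply, Matrix.vecMulVec_apply,
    smul_eq_mul, hg.inv_isSymm.apply j m, (upM_isSymm hg hΞ).apply j m]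
  ring

theorem dissip_chi_swap (hg : IsLorentzian g) (hΞ : IsSTF g Ξ) (hK : K.HasDerivOn K' J)
    (hξ : mu g ξ ∈ J) (i j m : Fin d) :
    dissip g (K.chi g) ξ Ξ i j m = dissip g (K.chi g) ξ Ξ i m j := by
  rw [dissip_chi hg hΞ hK hξ, dissip_chi hg hΞ hK hξ, mixed1_swap hg, mixed2_swap hg hΞ.1]

theorem contract_dissip_chi (hg : IsLorentzian g) (hΞ : IsSTF g Ξ) (hd : (d : ℝ) ≠ 0)
    (hK : K.HasDerivOn K' J) (hξ : mu g ξ ∈ J) (i : Fin d) :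
    contract g (dissip g (K.chi g) ξ Ξ i) = 0 := by
  have e : dissip g (K.chi g) ξ Ξ i = (mixed1 K K' g ξ i + mixed2 K K' g ξ Ξ i : Mat d) :=
    funext fun b => funext fun c => dissip_chi hg hΞ hK hξ i b c
  rw [e, contract_add, contract_mixed1 hg hd, contract_mixed2 hg hΞ hd, add_zero]

theorem stress_chi_isSymm (hJ : IsOpen J) (hg : IsLorentzian g) (hΞ : Ξ.IsSymm)
    (hK : K.HasDerivOn K' J) (hK' : K'.HasDerivOn K'' J) (hξ : mu g ξ ∈ J) :
    (stress (K.chi g) ξ Ξ).IsSymm := by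
  rw [stress_chi hJ hg hΞ hK hK' hξ]
  refine Matrix.IsSymm.ext fun i j => ?_
  simp only [hess0, hess1, hess2, Matrix.add_apply, Matrix.smul_apply, Matrix.vecMulVec_apply,
    smul_eq_mul, hg.inv_isSymm.apply i j, (upM_isSymm hg hΞ).apply i j,
    (upM2_isSymm hg hΞ).apply i j]
  ring

/-- The trace of T^ab vanishes order by order. For A^abc it suffices to exchange the first two
indices: symmetry and the trace in the last two hold for any coefficients, and total symmetry then
gives the other traces. -/
theorem HasConformalForm.conformalConditions (h : HasConformalForm d K J c₀ a b k e)
    (hd : (d : ℝ) ≠ 0) (hJ : IsOpen J) (h0 : ∀ μ ∈ J, μ ≠ 0) (hg : IsLorentzian g) :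
    ConformalConditions K J g := by
  intro ξ Ξ hξ hΞ
  have hK := h.hasDerivOn hJ h0
  have hK' := h.hasDerivOn_confDeriv hJ h0
  have hμ := h0 _ hξ
  have hs := dissip_chi_swap hg hΞ hK hξ
  have hsym : ∀ i j m, dissip g (K.chi g) ξ Ξ i j m = dissip g (K.chi g) ξ Ξ j i m :=
    fun i j m => by
      rw [dissip_chi hg hΞ hK hξ, dissip_chi hg hΞ hK hξ, mixed1_conf_symm hg hd hμ,
        mixed2_conf_symm hg hΞ.1 hd hμ h hξ]
  refine ⟨?_, isTotallyTraceFree_of_symmetric hs hsym (contract_dissip_chi hg hΞ hd hK hξ),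
    (symmetryCondition_iff hs).2 hsym⟩
  rw [stress_chi hJ hg hΞ.1 hK hK' hξ, contract_add, contract_add, contract_hess0_conf hg hμ,
    contract_hess1_conf hg hΞ hμ, contract_hess2_conf hg hΞ hμ h hξ, add_zero, add_zero]

end Symmetry

/-! ### Orthonormal frames -/

/-- Three covectors that are orthogonal with respect to the inverse metric, with squares
`σ, σ₁, σ₂`. -/
structure IsOrthogonalTriple (g : Mat d) (x y z : Vec d) (σ σ₁ σ₂ : ℝ) : Prop where
  xx : x ⬝ᵥ g⁻¹.mulVec x = σ
  yy : y ⬝ᵥ g⁻¹.mulVec y = σ₁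
  zz : z ⬝ᵥ g⁻¹.mulVec z = σ₂
  xy : x ⬝ᵥ g⁻¹.mulVec y = 0
  xz : x ⬝ᵥ g⁻¹.mulVec z = 0
  yz : y ⬝ᵥ g⁻¹.mulVec z = 0
  yx : y ⬝ᵥ g⁻¹.mulVec x = 0
  zx : z ⬝ᵥ g⁻¹.mulVec x = 0
  zy : z ⬝ᵥ g⁻¹.mulVec y = 0
  sigma1 : σ₁ ≠ 0
  sigma2 : σ₂ ≠ 0

/-- If g = PᵀηP, then P g⁻¹ Pᵀ = η⁻¹ = η, so the rows of P are the required covectors. -/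
theorem exists_frame {g : Mat d} (hg : IsLorentzian g) :
    ∃ P : Fin d → Vec d, ∀ i j, P i ⬝ᵥ g⁻¹.mulVec (P j) = minkowski d i j := by
  obtain ⟨P, hP, rfl⟩ := hg
  have hP' : IsUnit P.transpose.det := by rwa [Matrix.det_transpose]
  have hm : (minkowski d)⁻¹ = minkowski d := Matrix.inv_eq_right_inv (minkowski_mul_self d)
  refine ⟨P, fun i j => ?_⟩
  have h : P * (P.transpose * minkowski d * P)⁻¹ * P.transpose = minkowski d := by
    rw [Matrix.mul_inv_rev, Matrix.mul_inv_rev, hm, ← Matrix.mul_assoc, ← Matrix.mul_assoc,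
      Matrix.mul_nonsing_inv _ hP, Matrix.one_mul, Matrix.mul_assoc,
      Matrix.nonsing_inv_mul _ hP', Matrix.mul_one]
  refine Eq.trans ?_ (congrFun (congrFun h i) j)
  rw [Matrix.mul_assoc P]
  rfl

theorem exists_orthogonalTriple {g : Mat d} (hg : IsLorentzian g) (hd : 3 ≤ d) {J : Set ℝ}
    (hJ : J = Set.Iio 0 ∨ J = Set.Ioi 0) :
    ∃ (x y z : Vec d) (σ σ₁ σ₂ : ℝ), IsOrthogonalTriple g x y z σ σ₁ σ₂ ∧
      ∀ μ ∈ J, √|μ| ^ 2 * σ = μ := by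
  obtain ⟨P, hP⟩ := exists_frame hg
  have h01 : (⟨0, by omega⟩ : Fin d) ≠ ⟨1, by omega⟩ := by simp
  have h02 : (⟨0, by omega⟩ : Fin d) ≠ ⟨2, by omega⟩ := by simp
  have h12 : (⟨1, by omega⟩ : Fin d) ≠ ⟨2, by omega⟩ := by simp
  have ho : ∀ i j, i ≠ j → P i ⬝ᵥ g⁻¹.mulVec (P j) = 0 := fun i j hij => by
    rw [hP, minkowski, Matrix.diagonal_apply_ne _ hij]
  have h0 : P ⟨0, by omega⟩ ⬝ᵥ g⁻¹.mulVec (P ⟨0, by omega⟩) = -1 := by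
    rw [hP, minkowski, Matrix.diagonal_apply_eq, if_pos rfl]
  have h1 : P ⟨1, by omega⟩ ⬝ᵥ g⁻¹.mulVec (P ⟨1, by omega⟩) = 1 := by
    rw [hP, minkowski, Matrix.diagonal_apply_eq, if_neg one_ne_zero]
  have h2 : P ⟨2, by omega⟩ ⬝ᵥ g⁻¹.mulVec (P ⟨2, by omega⟩) = 1 := by
    rw [hP, minkowski, Matrix.diagonal_apply_eq, if_neg two_ne_zero]
  rcases hJ with rfl | rfl
  · refine ⟨P ⟨0, by omega⟩, P ⟨1, by omega⟩, P ⟨2, by omega⟩, -1, 1, 1,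
      ⟨h0, h1, h2, ho _ _ h01, ho _ _ h02, ho _ _ h12, ho _ _ h01.symm, ho _ _ h02.symm,
        ho _ _ h12.symm, one_ne_zero, one_ne_zero⟩, fun μ hμ => ?_⟩
    rw [Real.sq_sqrt (abs_nonneg _), abs_of_neg hμ]
    ring
  -- For space-like ξ^a the time-like frame covector serves as the third member; only its nonzero
  -- square matters.
  · refine ⟨P ⟨1, by omega⟩, P ⟨2, by omega⟩, P ⟨0, by omega⟩, 1, 1, -1,
      ⟨h1, h2, h0, ho _ _ h12, ho _ _ h01.symm, ho _ _ h02.symm, ho _ _ h12.symm, ho _ _ h01,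
        ho _ _ h02, one_ne_zero, by norm_num⟩, fun μ hμ => ?_⟩
    rw [Real.sq_sqrt (abs_nonneg _), abs_of_pos hμ]
    ring

/-! ### Evaluation of the dissipation tensor on covectors -/

/-- The contraction `x_a y_b z_c A^abc`. -/
noncomputable def tri (A : Fin d → Mat d) (x y z : Vec d) : ℝ :=
  x ⬝ᵥ fun a => y ⬝ᵥ (A a).mulVec z

theorem tri_add (A B : Fin d → Mat d) (x y z : Vec d) :
    tri (fun a => A a + B a) x y z = tri A x y z + tri B x y z := by
  simp only [tri, Matrix.add_mulVec, dotProduct_add]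
  exact dotProduct_add _ _ _

theorem tri_comm {A : Fin d → Mat d} (h : ∀ a b c, A a b c = A b a c) (x y z : Vec d) :
    tri A x y z = tri A y x z := by
  simp only [tri, dotProduct, Matrix.mulVec, Finset.mul_sum]
  rw [Finset.sum_comm]
  refine Finset.sum_congr rfl fun a _ => Finset.sum_congr rfl fun b _ =>
    Finset.sum_congr rfl fun c _ => ?_
  rw [h]
  ring

theorem dotProduct_vecMulVec_mulVec (p q y z : Vec d) :
    y ⬝ᵥ (Matrix.vecMulVec p q).mulVec z = (y ⬝ᵥ p) * (q ⬝ᵥ z) := by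
  rw [show (Matrix.vecMulVec p q).mulVec z = (q ⬝ᵥ z) • p from funext fun i => by
    rw [vecMulVec_mulVec_apply, Pi.smul_apply, smul_eq_mul, mul_comm], dotProduct_smul,
    smul_eq_mul, mul_comm]

theorem dotProduct_mul_mul (c s : ℝ) (x u : Vec d) :
    (x ⬝ᵥ fun a => c * u a * s) = c * (x ⬝ᵥ u) * s := by
  simp only [dotProduct, Finset.mul_sum, Finset.sum_mul]
  exact Finset.sum_congr rfl fun a _ => by ring

theorem tri_outer_left (c : ℝ) (u : Vec d) (S : Mat d) (x y z : Vec d) :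
    tri (fun a => (c * u a) • S) x y z = c * (x ⬝ᵥ u) * (y ⬝ᵥ S.mulVec z) := by
  simp only [tri, Matrix.smul_mulVec, dotProduct_smul, smul_eq_mul]
  exact dotProduct_mul_mul _ _ _ _

theorem tri_row_left (c : ℝ) (S : Mat d) (w x y z : Vec d) :
    tri (fun a => c • Matrix.vecMulVec (S a) w) x y z =
      c * (x ⬝ᵥ S.mulVec y) * (z ⬝ᵥ w) := by
  have h : ∀ a, y ⬝ᵥ S a = S.mulVec y a := fun a => dotProduct_comm _ _
  simp only [tri, Matrix.smul_mulVec, dotProduct_smul, smul_eq_mul, dotProduct_vecMulVec_mulVec,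
    ← mul_assoc, h, dotProduct_comm w]
  exact dotProduct_mul_mul _ _ _ _

theorem tri_row_right (c : ℝ) (S : Mat d) (w x y z : Vec d) :
    tri (fun a => c • Matrix.vecMulVec w (S a)) x y z =
      c * (x ⬝ᵥ S.mulVec z) * (y ⬝ᵥ w) := by
  simp only [tri, Matrix.smul_mulVec, dotProduct_smul, smul_eq_mul, dotProduct_vecMulVec_mulVec,
    mul_comm (y ⬝ᵥ w), ← mul_assoc, row_dotProduct]
  exact dotProduct_mul_mul _ _ _ _

section Evaluation

variable {g : Mat d} {ξ : Vec d} {Ξ : Mat d}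

/-- The tensor is regrouped into products whose first index sits either on a vector or on a row of a
matrix. Each kind of product has its own evaluation rule, and the same scheme serves order two. -/
theorem tri_mixed1 (K K' : Coeffs) (g : Mat d) (ξ x y z : Vec d) :
    tri (mixed1 K K' g ξ) x y z =
      2 * K'.one (mu g ξ) * (x ⬝ᵥ up g ξ) * ((y ⬝ᵥ up g ξ) * (z ⬝ᵥ up g ξ)
        - mu g ξ / d * (y ⬝ᵥ g⁻¹.mulVec z))
      + K.one (mu g ξ) * ((x ⬝ᵥ g⁻¹.mulVec y) * (z ⬝ᵥ up g ξ)
        + (x ⬝ᵥ g⁻¹.mulVec z) * (y ⬝ᵥ up g ξ)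
        - 2 * (x ⬝ᵥ up g ξ) / d * (y ⬝ᵥ g⁻¹.mulVec z)) := by
  have e : mixed1 K K' g ξ = fun a =>
      (2 * K'.one (mu g ξ) * up g ξ a) • Matrix.vecMulVec (up g ξ) (up g ξ)
      + (-(2 * K'.one (mu g ξ) * (mu g ξ / d) + 2 * K.one (mu g ξ) / d) * up g ξ a) • g⁻¹
      + K.one (mu g ξ) • Matrix.vecMulVec (g⁻¹ a) (up g ξ)
      + K.one (mu g ξ) • Matrix.vecMulVec (up g ξ) (g⁻¹ a) := by
    funext a
    ext b c
    simp only [mixed1, Matrix.add_apply, Matrix.sub_apply, Matrix.smul_apply, smul_eq_mul]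
    ring
  rw [e]
  simp only [tri_add, tri_outer_left, tri_row_left, tri_row_right, dotProduct_vecMulVec_mulVec,
    dotProduct_comm (up g ξ) z]
  ring

theorem tri_mixed2 (K K' : Coeffs) (g : Mat d) (ξ : Vec d) (Ξ : Mat d) (x y z : Vec d) :
    tri (mixed2 K K' g ξ Ξ) x y z =
      4 * K'.two1 (mu g ξ) * (x ⬝ᵥ up g ξ) * (y ⬝ᵥ (upM g Ξ).mulVec z)
      + 2 * K'.two2 (mu g ξ) * (x ⬝ᵥ up g ξ) * ((y ⬝ᵥ ell g ξ Ξ) * (z ⬝ᵥ up g ξ)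
        + (y ⬝ᵥ up g ξ) * (z ⬝ᵥ ell g ξ Ξ) - 2 * nu g ξ Ξ / d * (y ⬝ᵥ g⁻¹.mulVec z))
      + K.two2 (mu g ξ) * ((x ⬝ᵥ g⁻¹.mulVec y) * (z ⬝ᵥ ell g ξ Ξ)
        + (x ⬝ᵥ g⁻¹.mulVec z) * (y ⬝ᵥ ell g ξ Ξ)
        + (x ⬝ᵥ (upM g Ξ).mulVec z) * (y ⬝ᵥ up g ξ)
        + (x ⬝ᵥ (upM g Ξ).mulVec y) * (z ⬝ᵥ up g ξ)
        - 4 * (x ⬝ᵥ ell g ξ Ξ) / d * (y ⬝ᵥ g⁻¹.mulVec z))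
      + (4 * K'.two3 (mu g ξ) * (x ⬝ᵥ up g ξ) * nu g ξ Ξ
          + 4 * K.two3 (mu g ξ) * (x ⬝ᵥ ell g ξ Ξ)) *
        ((y ⬝ᵥ up g ξ) * (z ⬝ᵥ up g ξ) - mu g ξ / d * (y ⬝ᵥ g⁻¹.mulVec z))
      + 2 * K.two3 (mu g ξ) * nu g ξ Ξ * ((x ⬝ᵥ g⁻¹.mulVec y) * (z ⬝ᵥ up g ξ)
        + (x ⬝ᵥ g⁻¹.mulVec z) * (y ⬝ᵥ up g ξ)
        - 2 * (x ⬝ᵥ up g ξ) / d * (y ⬝ᵥ g⁻¹.mulVec z)) := by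
  have e : mixed2 K K' g ξ Ξ = fun a =>
      (4 * K'.two1 (mu g ξ) * up g ξ a) • upM g Ξ
      + (2 * K'.two2 (mu g ξ) * up g ξ a) • Matrix.vecMulVec (ell g ξ Ξ) (up g ξ)
      + (2 * K'.two2 (mu g ξ) * up g ξ a) • Matrix.vecMulVec (up g ξ) (ell g ξ Ξ)
      + (4 * K'.two3 (mu g ξ) * nu g ξ Ξ * up g ξ a) • Matrix.vecMulVec (up g ξ) (up g ξ)
      + (4 * K.two3 (mu g ξ) * ell g ξ Ξ a) • Matrix.vecMulVec (up g ξ) (up g ξ)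
      + (-(2 * K'.two2 (mu g ξ) * (2 * nu g ξ Ξ / d)
        + 4 * K'.two3 (mu g ξ) * nu g ξ Ξ * (mu g ξ / d)
        + 4 * K.two3 (mu g ξ) * nu g ξ Ξ / d) * up g ξ a) • g⁻¹
      + (-(4 * K.two2 (mu g ξ) / d + 4 * K.two3 (mu g ξ) * (mu g ξ / d)) * ell g ξ Ξ a) • g⁻¹
      + K.two2 (mu g ξ) • Matrix.vecMulVec (g⁻¹ a) (ell g ξ Ξ)
      + K.two2 (mu g ξ) • Matrix.vecMulVec (ell g ξ Ξ) (g⁻¹ a)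
      + K.two2 (mu g ξ) • Matrix.vecMulVec (upM g Ξ a) (up g ξ)
      + K.two2 (mu g ξ) • Matrix.vecMulVec (up g ξ) (upM g Ξ a)
      + (2 * K.two3 (mu g ξ) * nu g ξ Ξ) • Matrix.vecMulVec (g⁻¹ a) (up g ξ)
      + (2 * K.two3 (mu g ξ) * nu g ξ Ξ) • Matrix.vecMulVec (up g ξ) (g⁻¹ a) := by
    funext a
    ext b c
    simp only [mixed2, Matrix.add_apply, Matrix.sub_apply, Matrix.smul_apply, smul_eq_mul]
    ring
  rw [e]
  simp only [tri_add, tri_outer_left, tri_row_left, tri_row_right, dotProduct_vecMulVec_mulVec,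
    dotProduct_comm (up g ξ) z, dotProduct_comm (ell g ξ Ξ) z]
  ring

theorem dotProduct_upM_outer (hg : IsLorentzian g) (u w p q : Vec d) :
    p ⬝ᵥ (upM g (Matrix.vecMulVec u w + Matrix.vecMulVec w u)).mulVec q =
      (p ⬝ᵥ g⁻¹.mulVec u) * (w ⬝ᵥ g⁻¹.mulVec q) + (p ⬝ᵥ g⁻¹.mulVec w) * (u ⬝ᵥ g⁻¹.mulVec q) := by
  have h : ∀ u w : Vec d, p ⬝ᵥ (upM g (Matrix.vecMulVec u w)).mulVec q =
      (p ⬝ᵥ g⁻¹.mulVec u) * (w ⬝ᵥ g⁻¹.mulVec q) := fun u w => by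
    rw [upM, Matrix.mul_vecMulVec, Matrix.vecMulVec_mul, ← Matrix.mulVec_transpose, hg.inv_isSymm,
      dotProduct_vecMulVec_mulVec, dotProduct_comm _ q, dotProduct_mulVec_comm hg.inv_isSymm q]
  have e : upM g (Matrix.vecMulVec u w + Matrix.vecMulVec w u) =
      upM g (Matrix.vecMulVec u w) + upM g (Matrix.vecMulVec w u) := by
    simp only [upM, Matrix.mul_add, Matrix.add_mul]
  rw [e, Matrix.add_mulVec, dotProduct_add, h, h]

/-- These are the test values of ξ_ab: symmetrized products of orthogonal covectors have no trace.
-/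
theorem isSTF_outer {u w : Vec d} (huw : u ⬝ᵥ g⁻¹.mulVec w = 0) (hwu : w ⬝ᵥ g⁻¹.mulVec u = 0) :
    IsSTF g (Matrix.vecMulVec u w + Matrix.vecMulVec w u) := by
  refine ⟨?_, ?_⟩
  · rw [Matrix.IsSymm, Matrix.transpose_add, Matrix.transpose_vecMulVec,
      Matrix.transpose_vecMulVec, add_comm]
  · rw [contract_add, contract_vecMulVec, contract_vecMulVec, huw, hwu, add_zero]

theorem isSTF_zero (g : Mat d) : IsSTF g 0 := ⟨Matrix.isSymm_zero, by simp [contract]⟩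

end Evaluation

/-! ### The conformal conditions imply the conformal form -/

section Relations

variable {g : Mat d} {ξ : Vec d} {Ξ : Mat d} {K K' K'' : Coeffs} {J : Set ℝ}

theorem upM_zero (g : Mat d) : upM g 0 = 0 := by simp [upM]

theorem ell_zero (g : Mat d) (ξ : Vec d) : ell g ξ 0 = 0 := by simp [ell, upM_zero]

theorem nu_zero (g : Mat d) (ξ : Vec d) : nu g ξ 0 = 0 := by
  rw [← ell_dotProduct, ell_zero, zero_dotProduct]

theorem psi1_zero (g : Mat d) : psi1 g 0 = 0 := by simp [psi1, contract]

theorem psi2_zero (g : Mat d) (ξ : Vec d) : psi2 g ξ 0 = 0 := by simp [psi2]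

theorem tri_mixed2_zero (K K' : Coeffs) (g : Mat d) (ξ x y z : Vec d) :
    tri (mixed2 K K' g ξ 0) x y z = 0 := by
  rw [tri_mixed2]
  simp [ell_zero, nu_zero, upM_zero]

theorem ConformalConditions.tri_comm (hg : IsLorentzian g)
    (hK : K.HasDerivOn K' J) (h : ConformalConditions K J g) (hξ : mu g ξ ∈ J) (hΞ : IsSTF g Ξ)
    (x y z : Vec d) :
    tri (mixed1 K K' g ξ) x y z + tri (mixed2 K K' g ξ Ξ) x y z =
      tri (mixed1 K K' g ξ) y x z + tri (mixed2 K K' g ξ Ξ) y x z := by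
  rw [← tri_add, ← tri_add]
  refine ConformalFluid.tri_comm (fun a b c => ?_) x y z
  have := (symmetryCondition_iff (dissip_chi_swap hg hΞ hK hξ)).1 (h ξ Ξ hξ hΞ).2.2 a b c
  rwa [dissip_chi hg hΞ hK hξ, dissip_chi hg hΞ hK hξ] at this

/-- At ξ_ab = 0 only order zero survives in the trace of T^ab. No further use of this trace is
needed for necessity. -/
theorem ConformalConditions.relation_zero (hJ : IsOpen J) (hg : IsLorentzian g)
    (hK : K.HasDerivOn K' J) (hK' : K'.HasDerivOn K'' J) (h : ConformalConditions K J g)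
    (hξ : mu g ξ ∈ J) : 4 * K''.zero (mu g ξ) * mu g ξ + 2 * d * K'.zero (mu g ξ) = 0 := by
  have h0 := isSTF_zero g
  have := (h ξ 0 hξ h0).1
  rw [stress_chi hJ hg h0.1 hK hK' hξ, contract_add, contract_add, contract_hess0 hg,
    contract_hess1 hg h0, contract_hess2 hg h0, nu_zero, psi1_zero, psi2_zero] at this
  linarith

/-- The covector ξ = s x has square μ. Symmetry of A^abc in its first two slots is tested with ξ_ab
= 0, with y⊗z + z⊗y and with x⊗y + y⊗x; orthogonality removes most terms, so each test gives a short
linear relation. -/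
theorem ConformalConditions.relations (hg : IsLorentzian g) (hd : (d : ℝ) ≠ 0)
    (hK : K.HasDerivOn K' J) (h : ConformalConditions K J g) {x y z : Vec d} {σ σ₁ σ₂ s μ : ℝ}
    (ht : IsOrthogonalTriple g x y z σ σ₁ σ₂) (hμ : s ^ 2 * σ = μ) (hμJ : μ ∈ J) (hμ0 : μ ≠ 0) :
    2 * μ * K'.one μ = -((d : ℝ) + 2) * K.one μ ∧ 4 * K'.two1 μ = K.two2 μ ∧
      K'.two2 μ = 2 * K.two3 μ ∧ 4 * μ * K.two3 μ = -((d : ℝ) + 4) * K.two2 μ := by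
  have hs : s ≠ 0 := by
    rintro rfl
    exact hμ0 (by rw [← hμ]; ring)
  have hσ : σ ≠ 0 := by
    rintro rfl
    exact hμ0 (by rw [← hμ]; ring)
  have hup : ∀ p : Vec d, p ⬝ᵥ up g (s • x) = s * (p ⬝ᵥ g⁻¹.mulVec x) := fun p => by
    rw [up, Matrix.mulVec_smul, dotProduct_smul, smul_eq_mul]
  have hell : ∀ (Ξ : Mat d) (p : Vec d), p ⬝ᵥ ell g (s • x) Ξ =
      s * (p ⬝ᵥ (upM g Ξ).mulVec x) := fun Ξ p => by
    rw [ell, Matrix.mulVec_smul, dotProduct_smul, smul_eq_mul]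
  have hnu : ∀ Ξ : Mat d, nu g (s • x) Ξ = s ^ 2 * (x ⬝ᵥ (upM g Ξ).mulVec x) := fun Ξ => by
    rw [← ell_dotProduct, dotProduct_comm, hell, smul_dotProduct, smul_eq_mul]
    ring
  have hmu : mu g (s • x) = μ := by
    rw [← up_dotProduct, dotProduct_comm, hup, smul_dotProduct, smul_eq_mul, ht.xx, ← hμ]
    ring
  have hξ : mu g (s • x) ∈ J := hmu ▸ hμJ
  have key1 : ∀ p q r, tri (mixed1 K K' g (s • x)) p q r = tri (mixed1 K K' g (s • x)) q p r :=
    fun p q r => by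
      simpa [tri_mixed2_zero] using h.tri_comm hg hK hξ (isSTF_zero g) p q r
  -- The order-one part of A^abc does not depend on ξ_ab, so its symmetry, already obtained at ξ_ab
  -- = 0, can be subtracted.
  have key2 : ∀ Ξ, IsSTF g Ξ → ∀ p q r, tri (mixed2 K K' g (s • x) Ξ) p q r =
      tri (mixed2 K K' g (s • x) Ξ) q p r := fun Ξ hΞ p q r => by
    have := h.tri_comm hg hK hξ hΞ p q r
    rw [key1 p q r] at this
    exact add_left_cancel this
  have a1 := key1 x z z
  have hyz := isSTF_outer ht.yz ht.zy
  have hxy := isSTF_outer ht.xy ht.yx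
  have a2 := key2 _ hyz x y z
  have a3 := key2 _ hxy z y z
  have a4 := key2 _ hxy x y x
  have hσ₁ := ht.sigma1
  have hσ₂ := ht.sigma2
  simp only [tri_mixed1, hup, hmu, ht.xx, ht.zz, ht.xz, ht.zx, mul_zero, add_zero,
    zero_add, sub_zero, zero_sub] at a1
  simp only [tri_mixed2, hup, hmu, hell, hnu, dotProduct_upM_outer hg, ht.xx, ht.yy, ht.zz, ht.xy,
    ht.xz, ht.yz, ht.yx, ht.zx, ht.zy, mul_zero, zero_mul, add_zero, zero_add, sub_zero, zero_sub,
    zero_div] at a2 a3 a4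
  field_simp at a1 a2 a3 a4
  refine ⟨by linear_combination -a1, a2, ?_, by linear_combination a3⟩
  -- The test `a4` mixes the derivatives of χ²₁ and χ²₂ with χ²₂ and χ²₃; `a2` and `a3` eliminate
  -- the unwanted terms, leaving the relation multiplied by 2dμ.
  refine mul_left_cancel₀ (mul_ne_zero (mul_ne_zero two_ne_zero hd) hμ0) ?_
  linear_combination a4 - (2 * d * K'.two2 μ - 4 * d * K.two3 μ) * hμ - d * a2 - a3

end Relations

/-! ### Integration of the differential equations for the coefficients -/

theorem exists_eq_const_of_hasDerivAt_zero {J : Set ℝ} (hJ : J = Set.Iio 0 ∨ J = Set.Ioi 0)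
    {f : ℝ → ℝ} (hf : ∀ μ ∈ J, HasDerivAt f 0 μ) : ∃ C, ∀ μ ∈ J, f μ = C := by
  obtain ⟨hJo, hJc, x, hx⟩ : IsOpen J ∧ IsPreconnected J ∧ J.Nonempty := by
    rcases hJ with rfl | rfl
    · exact ⟨isOpen_Iio, isPreconnected_Iio, ⟨-1, by simp⟩⟩
    · exact ⟨isOpen_Ioi, isPreconnected_Ioi, ⟨1, by simp⟩⟩
  exact ⟨f x, fun μ hμ => hJo.is_const_of_deriv_eq_zero hJc
    (fun t ht => (hf t ht).differentiableAt.differentiableWithinAt) (fun t ht => (hf t ht).deriv)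
    hμ hx⟩

/-- The product f |μ|^(−s) has zero derivative on the half-line, hence is constant. -/
theorem exists_eq_const_mul_abs_rpow {J : Set ℝ} (hJ : J = Set.Iio 0 ∨ J = Set.Ioi 0)
    (h0 : ∀ μ ∈ J, μ ≠ 0) {f : ℝ → ℝ} {s : ℝ} (hf : ∀ μ ∈ J, HasDerivAt f (s / μ * f μ) μ) :
    ∃ C, ∀ μ ∈ J, f μ = C * |μ| ^ s := by
  obtain ⟨C, hC⟩ := exists_eq_const_of_hasDerivAt_zero hJ
    (f := fun t => f t * (1 * |t| ^ (-s))) fun μ hμ =>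
      ((hf μ hμ).fun_mul (hasDerivAt_abs_rpow (h0 μ hμ) 1 (-s))).congr_deriv (by ring)
  refine ⟨C, fun μ hμ => ?_⟩
  have hp := Real.rpow_pos_of_pos (abs_pos.2 (h0 μ hμ)) s
  rw [← hC μ hμ, Real.rpow_neg (abs_nonneg μ)]
  field_simp

/-- The derivatives of coefficient functions. -/
noncomputable def Coeffs.deriv (K : Coeffs) : Coeffs where
  zero := _root_.deriv K.zero
  one := _root_.deriv K.one
  two1 := _root_.deriv K.two1
  two2 := _root_.deriv K.two2
  two3 := _root_.deriv K.two3

theorem Coeffs.IsC2On.hasDerivOn {K : Coeffs} {J : Set ℝ} (hK : K.IsC2On J) (hJ : IsOpen J) :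
    K.HasDerivOn K.deriv J := by
  have h : ∀ {f : ℝ → ℝ}, ContDiffOn ℝ 2 f J → ∀ μ ∈ J, HasDerivAt f (_root_.deriv f μ) μ :=
    fun hf μ hμ => ((hf.differentiableOn (by simp)).differentiableAt (hJ.mem_nhds hμ)).hasDerivAt
  exact fun μ hμ => ⟨h hK.1 μ hμ, h hK.2.1 μ hμ, h hK.2.2.1 μ hμ, h hK.2.2.2.1 μ hμ,
    h hK.2.2.2.2 μ hμ⟩

theorem Coeffs.IsC2On.hasDerivOn_deriv {K : Coeffs} {J : Set ℝ} (hK : K.IsC2On J)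
    (hJ : IsOpen J) : K.deriv.HasDerivOn K.deriv.deriv J := by
  have h : ∀ {f : ℝ → ℝ}, ContDiffOn ℝ 2 f J →
      ∀ μ ∈ J, HasDerivAt (_root_.deriv f) (_root_.deriv (_root_.deriv f) μ) μ :=
    fun hf μ hμ => (((hf.deriv_of_isOpen hJ (m := 1) (by norm_num)).differentiableOn
      (by simp)).differentiableAt (hJ.mem_nhds hμ)).hasDerivAt
  exact fun μ hμ => ⟨h hK.1 μ hμ, h hK.2.1 μ hμ, h hK.2.2.1 μ hμ, h hK.2.2.2.1 μ hμ,
    h hK.2.2.2.2 μ hμ⟩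

/-- For χ⁰ and χ²₁ an explicit antiderivative of the first derivative is found, namely a multiple of
μχ⁰' and of μχ²₂. The difference from it is the additive constant, and the antiderivative itself
satisfies an Euler equation. -/
theorem exists_conformalForm_of_relations (hd : 3 ≤ d) {J : Set ℝ}
    (hJ : J = Set.Iio 0 ∨ J = Set.Ioi 0) (h0 : ∀ μ ∈ J, μ ≠ 0) {K K' K'' : Coeffs}
    (hK : K.HasDerivOn K' J) (hK' : K'.HasDerivOn K'' J)
    (hrel : ∀ μ ∈ J, 4 * K''.zero μ * μ + 2 * d * K'.zero μ = 0 ∧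
      2 * μ * K'.one μ = -((d : ℝ) + 2) * K.one μ ∧ 4 * K'.two1 μ = K.two2 μ ∧
      K'.two2 μ = 2 * K.two3 μ ∧ 4 * μ * K.two3 μ = -((d : ℝ) + 4) * K.two2 μ) :
    ∃ c₀ a b k e : ℝ, HasConformalForm d K J c₀ a b k e := by
  have hd3 : (3 : ℝ) ≤ d := by exact_mod_cast hd
  have hd2 : (2 : ℝ) - d ≠ 0 := by linarith
  have hdp : (d : ℝ) + 2 ≠ 0 := by linarith
  -- The equation for χ⁰ says (μχ⁰')' = (1 − d/2) χ⁰'; dividing by 1 − d/2 requires d ≠ 2.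
  have hf0 : ∀ μ ∈ J, HasDerivAt (fun t => 2 / (2 - (d : ℝ)) * (t * K'.zero t)) (K'.zero μ) μ :=
    fun μ hμ => by
      refine (((hasDerivAt_id μ).fun_mul (hK' μ hμ).1).const_mul (2 / (2 - (d : ℝ)))).congr_deriv ?_
      have := (hrel μ hμ).1
      simp only [id]
      field_simp
      linear_combination this / 2
  obtain ⟨c₀, hc₀⟩ := exists_eq_const_of_hasDerivAt_zero hJ
    (f := fun t => K.zero t - 2 / (2 - (d : ℝ)) * (t * K'.zero t)) fun μ hμ =>
      ((hK μ hμ).1.fun_sub (hf0 μ hμ)).congr_deriv (sub_self _)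
  obtain ⟨a, ha⟩ := exists_eq_const_mul_abs_rpow hJ h0 (s := 1 - (d : ℝ) / 2) fun μ hμ =>
    (hf0 μ hμ).congr_deriv (by
      have := h0 μ hμ
      field_simp)
  obtain ⟨b, hb⟩ := exists_eq_const_mul_abs_rpow hJ h0 (s := -((d : ℝ) + 2) / 2) fun μ hμ =>
    (hK μ hμ).2.1.congr_deriv (by
      have := h0 μ hμ
      have := (hrel μ hμ).2.1
      field_simp
      linear_combination this)
  -- The last two relations give μχ²₂' = −D₂χ²₂, so (μχ²₂)' = −D₁χ²₂, which is −4D₁χ²₁' by the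
  -- remaining one.
  have hf2 : ∀ μ ∈ J, HasDerivAt (fun t => -(1 / (4 * D d 1)) * (t * K.two2 t)) (K'.two1 μ) μ :=
    fun μ hμ => by
      refine (((hasDerivAt_id μ).fun_mul (hK μ hμ).2.2.2.1).const_mul _).congr_deriv ?_
      obtain ⟨-, -, h1, h2, h3⟩ := hrel μ hμ
      simp only [id, D]
      push_cast
      have : (d : ℝ) / 2 + 1 ≠ 0 := by linarith
      field_simp
      linear_combination (-2 * μ) * h2 - h3 - (d + 2) * h1
  obtain ⟨k, hk⟩ := exists_eq_const_of_hasDerivAt_zero hJ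
    (f := fun t => K.two1 t - -(1 / (4 * D d 1)) * (t * K.two2 t)) fun μ hμ =>
      ((hK μ hμ).2.2.1.fun_sub (hf2 μ hμ)).congr_deriv (sub_self _)
  have hD1 : D d 1 ≠ 0 := by
    simp only [D]
    push_cast
    linarith
  obtain ⟨e, he⟩ := exists_eq_const_mul_abs_rpow hJ h0 (s := -D d 1) fun μ hμ =>
    (hf2 μ hμ).congr_deriv (by
      have := h0 μ hμ
      have := (hrel μ hμ).2.2.1
      field_simp
      linear_combination this)
  refine ⟨c₀, a, b, k, e, fun μ hμ => ?_⟩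
  have hμ0 := h0 μ hμ
  have e0 := hc₀ μ hμ
  have e2 := hk μ hμ
  have ha' := ha μ hμ
  have he' := he μ hμ
  have e3 : K.two1 μ - k = -(1 / (4 * D d 1)) * (μ * K.two2 μ) := by linarith
  refine ⟨by linarith, hb μ hμ, by linarith, ?_, ?_⟩
  · rw [e3]
    field_simp
  · rw [e3]
    have := (hrel μ hμ).2.2.2.2
    have hD2 : D d 2 = (d + 4) / 2 := by
      simp only [D]
      push_cast
      ring
    rw [hD2]
    field_simp
    linear_combination this

/-- The conformal conditions at one metric are equivalent to the conformal form. -/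
theorem conformalConditions_iff (hd : 3 ≤ d) {J : Set ℝ} (hJ : J = Set.Iio 0 ∨ J = Set.Ioi 0)
    {K : Coeffs} (hK : K.IsC2On J) {g : Mat d} (hg : IsLorentzian g) :
    ConformalConditions K J g ↔ ∃ c₀ a b k e : ℝ, HasConformalForm d K J c₀ a b k e := by
  obtain ⟨hJo, h0⟩ : IsOpen J ∧ ∀ μ ∈ J, μ ≠ 0 := by
    rcases hJ with rfl | rfl
    · exact ⟨isOpen_Iio, fun μ hμ => ne_of_lt hμ⟩
    · exact ⟨isOpen_Ioi, fun μ hμ => ne_of_gt hμ⟩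
  have hd0 : (d : ℝ) ≠ 0 := by
    have : (3 : ℝ) ≤ d := by exact_mod_cast hd
    linarith
  constructor
  · intro h
    obtain ⟨x, y, z, σ, σ₁, σ₂, ht, hσ⟩ := exists_orthogonalTriple hg hd hJ
    refine exists_conformalForm_of_relations hd hJ h0 (hK.hasDerivOn hJo)
      (hK.hasDerivOn_deriv hJo) fun μ hμ => ⟨?_, h.relations hg hd0 (hK.hasDerivOn hJo) ht
        (hσ μ hμ) hμ (h0 μ hμ)⟩
    have hmu : mu g (√|μ| • x) = μ := by
      rw [← up_dotProduct, up, Matrix.mulVec_smul, smul_dotProduct, dotProduct_smul,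
        dotProduct_comm, ht.xx]
      simp only [smul_eq_mul]
      linear_combination hσ μ hμ
    have := h.relation_zero (ξ := √|μ| • x) hJo hg (hK.hasDerivOn hJo) (hK.hasDerivOn_deriv hJo)
      (hmu.symm ▸ hμ)
    rwa [hmu] at this
  · rintro ⟨c₀, a, b, k, e, h⟩
    exact h.conformalConditions hd0 hJo h0 hg

/-! ### Behaviour under a constant rescaling -/

section Scaling

variable {g : Mat d} {ξ : Vec d} {Ξ : Mat d} {c : ℝ}

theorem inv_scale (hg : IsLorentzian g) (hc : 0 < c) : (c ^ 2 • g)⁻¹ = (c ^ 2)⁻¹ • g⁻¹ :=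
  inv_smul_of_isLorentzian hg (pow_ne_zero 2 hc.ne')

/-- The weights of ξ_a and ξ_ab are such that ξ^a and ξ^ab are unchanged; the powers of c in the
other scaling laws count the metrics and lowered variables. -/
theorem up_scale (hg : IsLorentzian g) (hc : 0 < c) (ξ : Vec d) :
    up (c ^ 2 • g) (c ^ 2 • ξ) = up g ξ := by
  have hc0 := hc.ne'
  rw [up, inv_scale hg hc, Matrix.smul_mulVec, Matrix.mulVec_smul, smul_smul,
    inv_mul_cancel₀ (pow_ne_zero 2 hc0), one_smul, up]

theorem mu_scale (hg : IsLorentzian g) (hc : 0 < c) (ξ : Vec d) :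
    mu (c ^ 2 • g) (c ^ 2 • ξ) = c ^ 2 * mu g ξ := by
  rw [← up_dotProduct, up_scale hg hc, dotProduct_smul, up_dotProduct, smul_eq_mul]

theorem upM_scale (hg : IsLorentzian g) (hc : 0 < c) (Ξ : Mat d) :
    upM (c ^ 2 • g) (c ^ 4 • Ξ) = upM g Ξ := by
  have hc0 := hc.ne'
  rw [upM, inv_scale hg hc]
  simp only [Matrix.smul_mul, Matrix.mul_smul, smul_smul]
  rw [show (c ^ 2)⁻¹ * (c ^ 4 * (c ^ 2)⁻¹) = 1 by field_simp, one_smul, upM]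

theorem upM2_scale (hg : IsLorentzian g) (hc : 0 < c) (Ξ : Mat d) :
    upM2 (c ^ 2 • g) (c ^ 4 • Ξ) = c ^ 2 • upM2 g Ξ := by
  rw [upM2, upM_scale hg hc, Matrix.mul_smul, Matrix.smul_mul, upM2]

theorem ell_scale (hg : IsLorentzian g) (hc : 0 < c) (ξ : Vec d) (Ξ : Mat d) :
    ell (c ^ 2 • g) (c ^ 2 • ξ) (c ^ 4 • Ξ) = c ^ 2 • ell g ξ Ξ := by
  rw [ell, upM_scale hg hc, Matrix.mulVec_smul, ell]

theorem ell2_scale (hg : IsLorentzian g) (hc : 0 < c) (ξ : Vec d) (Ξ : Mat d) :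
    ell2 (c ^ 2 • g) (c ^ 2 • ξ) (c ^ 4 • Ξ) = c ^ 4 • ell2 g ξ Ξ := by
  rw [ell2_eq, upM2_scale hg hc, Matrix.mulVec_smul, Matrix.smul_mulVec, smul_smul, ell2_eq]
  congr 1
  ring

theorem nu_scale (hg : IsLorentzian g) (hc : 0 < c) (ξ : Vec d) (Ξ : Mat d) :
    nu (c ^ 2 • g) (c ^ 2 • ξ) (c ^ 4 • Ξ) = c ^ 4 * nu g ξ Ξ := by
  rw [← ell_dotProduct, ell_scale hg hc, dotProduct_smul, smul_dotProduct, ell_dotProduct]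
  simp only [smul_eq_mul]
  ring

theorem psi1_scale (hg : IsLorentzian g) (hc : 0 < c) (Ξ : Mat d) :
    psi1 (c ^ 2 • g) (c ^ 4 • Ξ) = c ^ 4 * psi1 g Ξ := by
  rw [psi1, upM_scale hg hc, contract_smul, psi1]

theorem psi2_scale (hg : IsLorentzian g) (hc : 0 < c) (ξ : Vec d) (Ξ : Mat d) :
    psi2 (c ^ 2 • g) (c ^ 2 • ξ) (c ^ 4 • Ξ) = c ^ 6 * psi2 g ξ Ξ := by
  rw [psi2_eq (hg.smul hc), ell_scale hg hc, Matrix.smul_mulVec, Matrix.mulVec_smul,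
    dotProduct_smul, dotProduct_smul, smul_dotProduct, ← psi2_eq hg]
  simp only [smul_eq_mul]
  ring

theorem psi3_scale (hg : IsLorentzian g) (hc : 0 < c) (ξ : Vec d) (Ξ : Mat d) :
    psi3 (c ^ 2 • g) (c ^ 2 • ξ) (c ^ 4 • Ξ) = c ^ 8 * psi3 g ξ Ξ := by
  rw [psi3, nu_scale hg hc, psi3]
  ring

theorem Xs_scale (hg : IsLorentzian g) (hc : 0 < c) (hμ : mu g ξ ≠ 0) (Ξ : Mat d) :
    Xs (c ^ 2 • g) (c ^ 2 • ξ) (c ^ 4 • Ξ) = c ^ 4 * Xs g ξ Ξ := by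
  have hc0 := hc.ne'
  simp only [Xs, mu_scale hg hc, psi1_scale hg hc, psi2_scale hg hc, psi3_scale hg hc]
  field_simp

theorem isSTF_scale (hg : IsLorentzian g) (hc : 0 < c) (hΞ : IsSTF g Ξ) :
    IsSTF (c ^ 2 • g) (c ^ 4 • Ξ) := by
  refine ⟨hΞ.1.smul _, ?_⟩
  rw [inv_scale hg hc, contract_smul_left, contract_smul, hΞ.2, mul_zero, mul_zero]

theorem abs_rpow_scale (hc : 0 < c) (μ s : ℝ) :
    |c ^ 2 * μ| ^ s = c ^ (2 * s) * |μ| ^ s := by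
  rw [abs_mul, Real.mul_rpow (abs_nonneg _) (abs_nonneg _), abs_of_pos (pow_pos hc 2),
    ← Real.rpow_natCast c 2, ← Real.rpow_mul hc.le]
  norm_num

variable {K : Coeffs} {J : Set ℝ} {c₀ a b k e : ℝ}

/-- The behaviour of the three independent coefficient functions under `μ ↦ c² μ`. -/
theorem HasConformalForm.scale (h : HasConformalForm d K J c₀ a b k e) (hc : 0 < c) {μ : ℝ}
    (hμ : μ ∈ J) (hμc : c ^ 2 * μ ∈ J) :
    K.zero (c ^ 2 * μ) - c₀ = c ^ (-(d : ℝ)) * c ^ 2 * (K.zero μ - c₀) ∧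
    K.one (c ^ 2 * μ) = c ^ (-(d : ℝ)) / c ^ 2 * K.one μ ∧
    K.two1 (c ^ 2 * μ) - k = c ^ (-(d : ℝ)) / c ^ 2 * (K.two1 μ - k) := by
  have hp : c ^ (-(d : ℝ)) * c ^ 2 = c ^ (2 * (1 - (d : ℝ) / 2)) := by
    rw [← Real.rpow_natCast c 2, ← Real.rpow_add hc]
    congr 1
    push_cast
    ring
  have hm : c ^ (-(d : ℝ)) / c ^ 2 = c ^ (-(d : ℝ) - 2) := by
    rw [← Real.rpow_natCast c 2, ← Real.rpow_sub hc]
    congr 1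
  obtain ⟨a0, a1, a2, -, -⟩ := h _ hμc
  obtain ⟨b0, b1, b2, -, -⟩ := h _ hμ
  rw [a0, a1, a2, b0, b1, b2, abs_rpow_scale hc, abs_rpow_scale hc, abs_rpow_scale hc, hp, hm]
  refine ⟨by ring, ?_, ?_⟩
  · rw [show 2 * (-((d : ℝ) + 2) / 2) = -(d : ℝ) - 2 by ring]
    ring
  · rw [show 2 * -D d 1 = -(d : ℝ) - 2 by simp only [D]; push_cast; ring]
    ring

theorem smul_mem_of_pos (hJ : J = Set.Iio 0 ∨ J = Set.Ioi 0) (hc : 0 < c) {μ : ℝ} (hμ : μ ∈ J) :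
    c ^ 2 * μ ∈ J := by
  rcases hJ with rfl | rfl
  · exact mul_neg_of_pos_of_neg (pow_pos hc 2) hμ
  · exact mul_pos (pow_pos hc 2) hμ

theorem rpow_neg_add (hc : 0 < c) (x : ℝ) (n : ℕ) : c ^ (-(x + n)) = c ^ (-x) / c ^ n := by
  rw [neg_add, ← sub_eq_add_neg, Real.rpow_sub hc, Real.rpow_natCast]

/-- Since T^ab is formed without derivatives of the fields, a conformal change acts on it at each
point as a constant rescaling by c = Ω(x). The power laws and their derivatives make every term
scale alike. -/
theorem stress_chi_scale (hJ : J = Set.Iio 0 ∨ J = Set.Ioi 0) (hJo : IsOpen J)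
    (h0 : ∀ μ ∈ J, μ ≠ 0) (hg : IsLorentzian g) (hΞ : IsSTF g Ξ)
    (h : HasConformalForm d K J c₀ a b k e) (hξ : mu g ξ ∈ J) (hc : 0 < c) :
    stress (K.chi (c ^ 2 • g)) (c ^ 2 • ξ) (c ^ 4 • Ξ) =
      c ^ (-((d : ℝ) + 2)) • stress (K.chi g) ξ Ξ := by
  have hK := h.hasDerivOn hJo h0
  have hK' := h.hasDerivOn_confDeriv hJo h0
  have hξc : mu (c ^ 2 • g) (c ^ 2 • ξ) ∈ J := mu_scale hg hc ξ ▸ smul_mem_of_pos hJ hc hξ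
  obtain ⟨s0, s1, s2⟩ := h.scale hc hξ (smul_mem_of_pos hJ hc hξ)
  have hμ := h0 _ hξ
  have hc0 := hc.ne'
  rw [stress_chi hJo hg hΞ.1 hK hK' hξ,
    stress_chi hJo (hg.smul hc) (isSTF_scale hg hc hΞ).1 hK hK' hξc]
  have t2 := h.two2_eq hξc
  have t3 := h.two3_eq hξc
  rw [mu_scale hg hc] at t2 t3
  have hw := rpow_neg_add hc d 2
  push_cast at hw
  rw [hw]
  ext i j
  simp only [Matrix.add_apply, Matrix.smul_apply, smul_eq_mul, mul_add]
  congr 1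
  · congr 1
    · simp only [hess0, Coeffs.confDeriv, Coeffs.confDeriv2, Matrix.add_apply, Matrix.smul_apply,
        Matrix.vecMulVec_apply, smul_eq_mul, mu_scale hg hc, up_scale hg hc, inv_scale hg hc, s0]
      field_simp
    · simp only [hess1, Coeffs.confDeriv, Coeffs.confDeriv2, Matrix.add_apply, Matrix.smul_apply,
        Matrix.vecMulVec_apply, Pi.smul_apply, smul_eq_mul, mu_scale hg hc, up_scale hg hc,
        inv_scale hg hc, ell_scale hg hc, nu_scale hg hc, upM_scale hg hc, s1]
      field_simp
  · simp only [hess2, h.two2_eq hξ, h.two3_eq hξ, t2, t3, Coeffs.confDeriv,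
      Coeffs.confDeriv2, Matrix.add_apply, Matrix.smul_apply,
      Matrix.vecMulVec_apply, Pi.smul_apply, smul_eq_mul, mu_scale hg hc, up_scale hg hc,
      inv_scale hg hc, ell_scale hg hc, ell2_scale hg hc, nu_scale hg hc, upM_scale hg hc,
      upM2_scale hg hc, psi1_scale hg hc, psi2_scale hg hc, psi3_scale hg hc, s2]
    generalize K.two1 (mu g ξ) - k = f
    field_simp

theorem dissip_chi_scale (hJ : J = Set.Iio 0 ∨ J = Set.Ioi 0) (hJo : IsOpen J)
    (h0 : ∀ μ ∈ J, μ ≠ 0) (hg : IsLorentzian g) (hΞ : IsSTF g Ξ)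
    (h : HasConformalForm d K J c₀ a b k e) (hξ : mu g ξ ∈ J) (hc : 0 < c) :
    dissip (c ^ 2 • g) (K.chi (c ^ 2 • g)) (c ^ 2 • ξ) (c ^ 4 • Ξ) =
      c ^ (-((d : ℝ) + 4)) • dissip g (K.chi g) ξ Ξ := by
  have hK := h.hasDerivOn hJo h0
  have hξc : mu (c ^ 2 • g) (c ^ 2 • ξ) ∈ J := mu_scale hg hc ξ ▸ smul_mem_of_pos hJ hc hξ
  obtain ⟨s0, s1, s2⟩ := h.scale hc hξ (smul_mem_of_pos hJ hc hξ)
  have hμ := h0 _ hξ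
  have hc0 := hc.ne'
  have t2 := h.two2_eq hξc
  have t3 := h.two3_eq hξc
  rw [mu_scale hg hc] at t2 t3
  have hw := rpow_neg_add hc d 4
  push_cast at hw
  rw [hw]
  funext i j m
  simp only [Pi.smul_apply, smul_eq_mul]
  rw [dissip_chi hg hΞ hK hξ, dissip_chi (hg.smul hc) (isSTF_scale hg hc hΞ) hK hξc, mul_add]
  have hrow : ∀ i, (c ^ 2 • g)⁻¹ i = (c ^ 2)⁻¹ • g⁻¹ i := fun i => by
    rw [inv_scale hg hc]
    rfl
  congr 1
  · simp only [mixed1, Coeffs.confDeriv, Matrix.add_apply, Matrix.sub_apply, Matrix.smul_apply,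
      Matrix.vecMulVec_apply, Pi.smul_apply, smul_eq_mul, mu_scale hg hc, up_scale hg hc, hrow, s1]
    field_simp
  · simp only [mixed2, h.two2_eq hξ, h.two3_eq hξ, t2, t3, Coeffs.confDeriv,
      Matrix.add_apply, Matrix.sub_apply, Matrix.smul_apply,
      Matrix.vecMulVec_apply, Pi.smul_apply, smul_eq_mul, mu_scale hg hc, up_scale hg hc,
      hrow, ell_scale hg hc, nu_scale hg hc, upM_scale hg hc, s2]
    generalize K.two1 (mu g ξ) - k = f
    field_simp

theorem rvec_scale (hg : IsLorentzian g) (hc : 0 < c) (hμ : mu g ξ ≠ 0) (Ξ : Mat d) (i : Fin d) :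
    rvec (c ^ 2 • g) (c ^ 2 • ξ) (c ^ 4 • Ξ) i = c ^ 2 * rvec g ξ Ξ i := by
  have hc0 := hc.ne'
  simp only [rvec, ell_scale hg hc, nu_scale hg hc, mu_scale hg hc, up_scale hg hc, Pi.smul_apply,
    smul_eq_mul]
  field_simp

theorem Gv_scale (hg : IsLorentzian g) (hc : 0 < c) (hμ : mu g ξ ≠ 0) (Ξ : Mat d) (i : Fin d) :
    Gv (c ^ 2 • g) (c ^ 2 • ξ) (c ^ 4 • Ξ) i = c ^ 4 * Gv g ξ Ξ i := by
  have hc0 := hc.ne'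
  simp only [Gv, ell_scale hg hc, ell2_scale hg hc, nu_scale hg hc, mu_scale hg hc,
    up_scale hg hc, psi1_scale hg hc, psi2_scale hg hc, psi3_scale hg hc, Pi.smul_apply,
    smul_eq_mul]
  field_simp

/-! ### Weights of the entropy current and of the generating function -/

theorem entropy_chi_conf (hJ : IsOpen J) (h0 : ∀ μ ∈ J, μ ≠ 0) (hg : IsLorentzian g)
    (hΞ : IsSTF g Ξ) (h : HasConformalForm d K J c₀ a b k e) (hξ : mu g ξ ∈ J) (i : Fin d) :
    entropy g (K.chi g) ξ Ξ i =
      -(d * ((d : ℝ) - 2) * (K.zero (mu g ξ) - c₀) / mu g ξ) * up g ξ i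
      + (-(d * ((d : ℝ) + 1) * K.one (mu g ξ) * (nu g ξ Ξ / mu g ξ)) * up g ξ i
        + 2 * ((d : ℝ) + 1) * K.one (mu g ξ) * rvec g ξ Ξ i)
      + -(((d : ℝ) + 2) ^ 2 * (K.two1 (mu g ξ) - k) / mu g ξ) * Gv g ξ Ξ i := by
  have hK := h.hasDerivOn hJ h0
  have hK' := h.hasDerivOn_confDeriv hJ h0
  have hμ := h0 _ hξ
  rw [entropy_chi_eq_add hJ hg hΞ hK hK' hξ]
  simp only [Pi.add_apply]
  rw [entropy_ord0 hJ hg hK hK' hξ, entropy_ord1 hJ hg hΞ hK hK' hξ,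
    entropy_ord2 hJ hg hΞ hK hK' hξ, entropy0_conf hμ, entropy1_conf hg hΞ hμ,
    entropy2_conf hg hΞ hμ h hξ]

theorem entropy_chi_scale (hJ : J = Set.Iio 0 ∨ J = Set.Ioi 0) (hJo : IsOpen J)
    (h0 : ∀ μ ∈ J, μ ≠ 0) (hg : IsLorentzian g) (hΞ : IsSTF g Ξ)
    (h : HasConformalForm d K J c₀ a b k e) (hξ : mu g ξ ∈ J) (hc : 0 < c) :
    entropy (c ^ 2 • g) (K.chi (c ^ 2 • g)) (c ^ 2 • ξ) (c ^ 4 • Ξ) =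
      c ^ (-(d : ℝ)) • entropy g (K.chi g) ξ Ξ := by
  have hξc : mu (c ^ 2 • g) (c ^ 2 • ξ) ∈ J := mu_scale hg hc ξ ▸ smul_mem_of_pos hJ hc hξ
  obtain ⟨s0, s1, s2⟩ := h.scale hc hξ (smul_mem_of_pos hJ hc hξ)
  have hμ := h0 _ hξ
  have hc0 := hc.ne'
  funext i
  rw [Pi.smul_apply, smul_eq_mul, entropy_chi_conf hJo h0 hg hΞ h hξ,
    entropy_chi_conf hJo h0 (hg.smul hc) (isSTF_scale hg hc hΞ) h hξc, rvec_scale hg hc hμ,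
    Gv_scale hg hc hμ, mu_scale hg hc, nu_scale hg hc, up_scale hg hc, s0, s1, s2]
  field_simp

theorem chi_conf (h : HasConformalForm d K J c₀ a b k e) (hξ : mu g ξ ∈ J) (Ξ : Mat d) :
    K.chi g ξ Ξ = c₀ + k * psi1 g Ξ + ((K.zero (mu g ξ) - c₀) + K.one (mu g ξ) * nu g ξ Ξ
      + (K.two1 (mu g ξ) - k) * Xs g ξ Ξ) := by
  simp only [Coeffs.chi, Coeffs.ord0, Coeffs.ord1, Coeffs.ord2, h.two2_eq hξ, h.two3_eq hξ, Xs]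
  ring

/-- Everything in χ has weight d − 2 except c₀, which does not scale, and kψ₁, which scales by c⁴;
these two make up the error term. -/
theorem chi_scale (hJ : J = Set.Iio 0 ∨ J = Set.Ioi 0) (h0 : ∀ μ ∈ J, μ ≠ 0)
    (hg : IsLorentzian g) (h : HasConformalForm d K J c₀ a b k e) (hξ : mu g ξ ∈ J) (hc : 0 < c)
    (Ξ : Mat d) : K.chi (c ^ 2 • g) (c ^ 2 • ξ) (c ^ 4 • Ξ) = c ^ (-((d : ℝ) - 2)) * K.chi g ξ Ξ
      + (c₀ * (1 - c ^ (-((d : ℝ) - 2))) + k * psi1 g Ξ * (c ^ 4 - c ^ (-((d : ℝ) - 2)))) := by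
  have hξc : mu (c ^ 2 • g) (c ^ 2 • ξ) ∈ J := mu_scale hg hc ξ ▸ smul_mem_of_pos hJ hc hξ
  obtain ⟨s0, s1, s2⟩ := h.scale hc hξ (smul_mem_of_pos hJ hc hξ)
  have hc0 := hc.ne'
  have hp : c ^ (-((d : ℝ) - 2)) = c ^ (-(d : ℝ)) * c ^ 2 := by
    rw [← Real.rpow_natCast c 2, ← Real.rpow_add hc]
    congr 1
    push_cast
    ring
  rw [chi_conf h hξ, chi_conf h hξc, Xs_scale hg hc (h0 _ hξ), mu_scale hg hc, nu_scale hg hc,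
    psi1_scale hg hc, s0, s1, s2, hp]
  field_simp
  ring

/-- The generating function has conformal weight `d - 2` if and only if the additive constants
vanish. -/
theorem chi_weight_iff (hd : 3 ≤ d) (hJ : J = Set.Iio 0 ∨ J = Set.Ioi 0) (h0 : ∀ μ ∈ J, μ ≠ 0)
    (hg : IsLorentzian g) (h : HasConformalForm d K J c₀ a b k e) :
    (∀ ξ Ξ, mu g ξ ∈ J → IsSTF g Ξ → ∀ c : ℝ, 0 < c →
      K.chi (c ^ 2 • g) (c ^ 2 • ξ) (c ^ 4 • Ξ) = c ^ (-((d : ℝ) - 2)) * K.chi g ξ Ξ) ↔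
      (c₀ = 0 ∧ k = 0) := by
  constructor
  · intro hw
    have hd3 : (3 : ℝ) ≤ d := by exact_mod_cast hd
    obtain ⟨x, y, z, σ, σ₁, σ₂, ht, hσ⟩ := exists_orthogonalTriple hg hd hJ
    obtain ⟨μ, hμ⟩ : J.Nonempty := by
      rcases hJ with rfl | rfl
      · exact ⟨-1, by simp⟩
      · exact ⟨1, by simp⟩
    have hmu : mu g (√|μ| • x) = μ := by
      rw [← up_dotProduct, up, Matrix.mulVec_smul, smul_dotProduct, dotProduct_smul,
        dotProduct_comm, ht.xx]
      simp only [smul_eq_mul]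
      linear_combination hσ μ hμ
    have hξ : mu g (√|μ| • x) ∈ J := hmu.symm ▸ hμ
    have hlt : (2 : ℝ) ^ (-((d : ℝ) - 2)) < 1 :=
      Real.rpow_lt_one_of_one_lt_of_neg one_lt_two (by linarith)
    -- The single factor c = 2 suffices: 2^(2−d) < 1 because d > 2, so neither bracket vanishes.
    -- Taking ξ_ab = 0 isolates c₀, and a test tensor with ψ₁ ≠ 0 then isolates k.
    have key : ∀ Ξ, IsSTF g Ξ → c₀ * (1 - (2 : ℝ) ^ (-((d : ℝ) - 2)))
        + k * psi1 g Ξ * (2 ^ 4 - (2 : ℝ) ^ (-((d : ℝ) - 2))) = 0 := fun Ξ hΞ => by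
      have h1 := chi_scale hJ h0 hg h hξ two_pos Ξ
      rw [hw _ Ξ hξ hΞ 2 two_pos] at h1
      linarith
    have hc : c₀ = 0 := by
      have := key 0 (isSTF_zero g)
      rw [psi1_zero, mul_zero, zero_mul, add_zero] at this
      exact (mul_eq_zero.1 this).resolve_right (by linarith)
    refine ⟨hc, ?_⟩
    have := key _ (isSTF_outer ht.yz ht.zy)
    have hψ : psi1 g (Matrix.vecMulVec y z + Matrix.vecMulVec z y) = 2 * (σ₁ * σ₂) := by
      rw [psi1, contract_add, contract_vecMulVec, contract_vecMulVec, dotProduct_upM_outer hg,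
        dotProduct_upM_outer hg, ht.yy, ht.zz, ht.yz, ht.zy]
      ring
    rw [hc, zero_mul, zero_add, hψ] at this
    have h2 := (mul_eq_zero.1 this).resolve_right (by linarith)
    exact (mul_eq_zero.1 h2).resolve_right
      (mul_ne_zero two_ne_zero (mul_ne_zero ht.sigma1 ht.sigma2))
  · rintro ⟨rfl, rfl⟩ ξ Ξ hξ - c hc
    rw [chi_scale hJ h0 hg h hξ hc]
    ring

end Scaling

/-! ### Differentiability of the fluid tensors along differentiable fields -/

section Differentiability

variable {g : Vec d → Mat d} {ξ : Vec d → Vec d} {Ξ : Vec d → Mat d} {x : Vec d}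

theorem differentiableAt_det {n : ℕ} {M : Vec d → Matrix (Fin n) (Fin n) ℝ}
    (hM : ∀ a b, DifferentiableAt ℝ (fun y => M y a b) x) :
    DifferentiableAt ℝ (fun y => (M y).det) x := by
  simp only [Matrix.det_apply']
  exact DifferentiableAt.fun_sum fun σ _ => (differentiableAt_const _).fun_mul
    (HasFDerivAt.finsetProd fun i _ => (hM (σ i) i).hasFDerivAt).differentiableAt

/-- Cramer's rule: the entries are polynomials in the components of g divided by its determinant. -/
theorem differentiableAt_inv_apply (hg : ∀ a b, DifferentiableAt ℝ (fun y => g y a b) x)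
    (hdet : (g x).det ≠ 0) (a b : Fin d) : DifferentiableAt ℝ (fun y => (g y)⁻¹ a b) x := by
  simp only [Matrix.inv_def, Matrix.smul_apply, smul_eq_mul, Ring.inverse_eq_inv',
    Matrix.adjugate_apply]
  refine ((differentiableAt_det hg).inv hdet).fun_mul (differentiableAt_det fun i j => ?_)
  simp only [Matrix.updateRow_apply]
  split_ifs
  · exact differentiableAt_const _
  · exact hg i j

/-- Differentiability of the components of a metric, its inverse and the fluid variables. -/
structure FieldsDifferentiableAt (g : Vec d → Mat d) (ξ : Vec d → Vec d) (Ξ : Vec d → Mat d)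
    (x : Vec d) : Prop where
  metric : ∀ a b, DifferentiableAt ℝ (fun y => g y a b) x
  inv : ∀ a b, DifferentiableAt ℝ (fun y => (g y)⁻¹ a b) x
  vec : ∀ a, DifferentiableAt ℝ (fun y => ξ y a) x
  mat : ∀ a b, DifferentiableAt ℝ (fun y => Ξ y a b) x

theorem differentiableAt_mulVec {M : Vec d → Mat d} {v : Vec d → Vec d}
    (hM : ∀ a b, DifferentiableAt ℝ (fun y => M y a b) x)
    (hv : ∀ a, DifferentiableAt ℝ (fun y => v y a) x) (a : Fin d) :
    DifferentiableAt ℝ (fun y => (M y).mulVec (v y) a) x := by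
  simp only [Matrix.mulVec, dotProduct]
  exact DifferentiableAt.fun_sum fun b _ => (hM a b).fun_mul (hv b)

theorem differentiableAt_mul {M N : Vec d → Mat d}
    (hM : ∀ a b, DifferentiableAt ℝ (fun y => M y a b) x)
    (hN : ∀ a b, DifferentiableAt ℝ (fun y => N y a b) x) (a b : Fin d) :
    DifferentiableAt ℝ (fun y => (M y * N y) a b) x := by
  simp only [Matrix.mul_apply]
  exact DifferentiableAt.fun_sum fun c _ => (hM a c).fun_mul (hN c b)

namespace FieldsDifferentiableAt

theorem up (h : FieldsDifferentiableAt g ξ Ξ x) (a : Fin d) :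
    DifferentiableAt ℝ (fun y => ConformalFluid.up (g y) (ξ y) a) x :=
  differentiableAt_mulVec h.inv h.vec a

theorem upM (h : FieldsDifferentiableAt g ξ Ξ x) (a b : Fin d) :
    DifferentiableAt ℝ (fun y => ConformalFluid.upM (g y) (Ξ y) a b) x :=
  differentiableAt_mul (differentiableAt_mul h.inv h.mat) h.inv a b

theorem upM2 (h : FieldsDifferentiableAt g ξ Ξ x) (a b : Fin d) :
    DifferentiableAt ℝ (fun y => ConformalFluid.upM2 (g y) (Ξ y) a b) x :=
  differentiableAt_mul (differentiableAt_mul h.upM h.metric) h.upM a b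

theorem ell (h : FieldsDifferentiableAt g ξ Ξ x) (a : Fin d) :
    DifferentiableAt ℝ (fun y => ConformalFluid.ell (g y) (ξ y) (Ξ y) a) x :=
  differentiableAt_mulVec h.upM h.vec a

theorem ell2 (h : FieldsDifferentiableAt g ξ Ξ x) (a : Fin d) :
    DifferentiableAt ℝ (fun y => ConformalFluid.ell2 (g y) (ξ y) (Ξ y) a) x :=
  differentiableAt_mulVec h.upM (differentiableAt_mulVec h.metric h.ell) a

theorem mu (h : FieldsDifferentiableAt g ξ Ξ x) :
    DifferentiableAt ℝ (fun y => ConformalFluid.mu (g y) (ξ y)) x :=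
  DifferentiableAt.fun_sum fun a _ => (h.up a).fun_mul (h.vec a)

theorem nu (h : FieldsDifferentiableAt g ξ Ξ x) :
    DifferentiableAt ℝ (fun y => ConformalFluid.nu (g y) (ξ y) (Ξ y)) x :=
  DifferentiableAt.fun_sum fun a _ => DifferentiableAt.fun_sum fun b _ =>
    ((h.upM a b).fun_mul (h.vec a)).fun_mul (h.vec b)

theorem psi1 (h : FieldsDifferentiableAt g ξ Ξ x) :
    DifferentiableAt ℝ (fun y => ConformalFluid.psi1 (g y) (Ξ y)) x := by
  simp only [ConformalFluid.psi1, contract]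
  exact DifferentiableAt.fun_sum fun a _ => DifferentiableAt.fun_sum fun b _ =>
    (h.upM a b).fun_mul (h.mat a b)

theorem psi2 (h : FieldsDifferentiableAt g ξ Ξ x) :
    DifferentiableAt ℝ (fun y => ConformalFluid.psi2 (g y) (ξ y) (Ξ y)) x :=
  DifferentiableAt.fun_sum fun a _ =>
    (h.ell a).fun_mul (differentiableAt_mulVec h.mat h.up a)

theorem psi3 (h : FieldsDifferentiableAt g ξ Ξ x) :
    DifferentiableAt ℝ (fun y => ConformalFluid.psi3 (g y) (ξ y) (Ξ y)) x :=
  h.nu.fun_pow 2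

end FieldsDifferentiableAt

/-- Differentiability of all coefficient functions at a point. -/
def Coeffs.DifferentiableAt (K : Coeffs) (μ : ℝ) : Prop :=
  _root_.DifferentiableAt ℝ K.zero μ ∧ _root_.DifferentiableAt ℝ K.one μ ∧
    _root_.DifferentiableAt ℝ K.two1 μ ∧ _root_.DifferentiableAt ℝ K.two2 μ ∧
    _root_.DifferentiableAt ℝ K.two3 μ

theorem Coeffs.HasDerivOn.differentiableAt {K K' : Coeffs} {J : Set ℝ} (h : K.HasDerivOn K' J)
    {μ : ℝ} (hμ : μ ∈ J) : K.DifferentiableAt μ := by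
  obtain ⟨h0, h1, h2, h3, h4⟩ := h μ hμ
  exact ⟨h0.differentiableAt, h1.differentiableAt, h2.differentiableAt, h3.differentiableAt,
    h4.differentiableAt⟩

/-- The second derivatives are expressed through the coefficients themselves, so differentiability
of T^ab along the fields needs no third derivative as a hypothesis. -/
theorem Coeffs.DifferentiableAt.confDeriv2 {K : Coeffs} {μ : ℝ} (h : K.DifferentiableAt μ)
    (hμ : μ ≠ 0) (c₀ k : ℝ) : (K.confDeriv2 d c₀ k).DifferentiableAt μ := by
  obtain ⟨h0, h1, h2, -, -⟩ := h
  simp only [Coeffs.DifferentiableAt, Coeffs.confDeriv2]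
  refine ⟨?_, ?_, ?_, ?_, ?_⟩ <;> fun_prop (disch := exact pow_ne_zero _ hμ)

variable {K K' K'' : Coeffs}

theorem differentiableAt_hess0 (h : FieldsDifferentiableAt g ξ Ξ x)
    (hK' : K'.DifferentiableAt (mu (g x) (ξ x))) (hK'' : K''.DifferentiableAt (mu (g x) (ξ x)))
    (a b : Fin d) : DifferentiableAt ℝ (fun y => hess0 K' K'' (g y) (ξ y) a b) x := by
  have k1 := hK'.1.comp x h.mu
  have k2 := hK''.1.comp x h.mu
  simp only [Function.comp_def] at k1 k2
  have ua := h.up a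
  have ub := h.up b
  have iab := h.inv a b
  simp only [hess0, Matrix.add_apply, Matrix.smul_apply, Matrix.vecMulVec_apply, smul_eq_mul]
  -- The listed scalars and components are kept atomic: leaf goals close by the facts above at
  -- reducible transparency, and only sums and products are split.
  repeat' first
    | with_reducible assumption
    | with_reducible apply DifferentiableAt.fun_add
    | with_reducible apply DifferentiableAt.fun_sub
    | with_reducible apply DifferentiableAt.fun_mul
    | exact differentiableAt_const _

theorem differentiableAt_hess1 (h : FieldsDifferentiableAt g ξ Ξ x)
    (hK : K.DifferentiableAt (mu (g x) (ξ x)))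
    (hK' : K'.DifferentiableAt (mu (g x) (ξ x))) (hK'' : K''.DifferentiableAt (mu (g x) (ξ x)))
    (a b : Fin d) : DifferentiableAt ℝ (fun y => hess1 K K' K'' (g y) (ξ y) (Ξ y) a b) x := by
  have k := hK.2.1.comp x h.mu
  have k1 := hK'.2.1.comp x h.mu
  have k2 := hK''.2.1.comp x h.mu
  simp only [Function.comp_def] at k k1 k2
  have ua := h.up a
  have ub := h.up b
  have iab := h.inv a b
  have la := h.ell a
  have lb := h.ell b
  have n := h.nu
  have Mab := h.upM a b
  simp only [hess1, Matrix.add_apply, Matrix.smul_apply, Matrix.vecMulVec_apply, smul_eq_mul]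
  repeat' first
    | with_reducible assumption
    | with_reducible apply DifferentiableAt.fun_add
    | with_reducible apply DifferentiableAt.fun_sub
    | with_reducible apply DifferentiableAt.fun_mul
    | exact differentiableAt_const _

theorem differentiableAt_hess2 (h : FieldsDifferentiableAt g ξ Ξ x)
    (hK : K.DifferentiableAt (mu (g x) (ξ x)))
    (hK' : K'.DifferentiableAt (mu (g x) (ξ x))) (hK'' : K''.DifferentiableAt (mu (g x) (ξ x)))
    (a b : Fin d) : DifferentiableAt ℝ (fun y => hess2 K K' K'' (g y) (ξ y) (Ξ y) a b) x := by
  obtain ⟨-, -, k1, k2, k3⟩ := hK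
  obtain ⟨-, -, k1', k2', k3'⟩ := hK'
  obtain ⟨-, -, k1'', k2'', k3''⟩ := hK''
  replace k2 := k2.comp x h.mu
  replace k3 := k3.comp x h.mu
  replace k1' := k1'.comp x h.mu
  replace k2' := k2'.comp x h.mu
  replace k3' := k3'.comp x h.mu
  replace k1'' := k1''.comp x h.mu
  replace k2'' := k2''.comp x h.mu
  replace k3'' := k3''.comp x h.mu
  simp only [Function.comp_def] at k2 k3 k1' k2' k3' k1'' k2'' k3''
  have ua := h.up a
  have ub := h.up b
  have iab := h.inv a b
  have la := h.ell a
  have lb := h.ell b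
  have ea := h.ell2 a
  have eb := h.ell2 b
  have n := h.nu
  have p1 := h.psi1
  have p2 := h.psi2
  have p3 := h.psi3
  have Mab := h.upM a b
  have Nab := h.upM2 a b
  simp only [hess2, Matrix.add_apply, Matrix.smul_apply, Matrix.vecMulVec_apply, smul_eq_mul]
  repeat' first
    | with_reducible assumption
    | with_reducible apply DifferentiableAt.fun_add
    | with_reducible apply DifferentiableAt.fun_sub
    | with_reducible apply DifferentiableAt.fun_mul
    | exact differentiableAt_const _

theorem differentiableAt_mixed1 (h : FieldsDifferentiableAt g ξ Ξ x)
    (hK : K.DifferentiableAt (mu (g x) (ξ x))) (hK' : K'.DifferentiableAt (mu (g x) (ξ x)))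
    (a b c : Fin d) : DifferentiableAt ℝ (fun y => mixed1 K K' (g y) (ξ y) a b c) x := by
  have k := hK.2.1.comp x h.mu
  have k1 := hK'.2.1.comp x h.mu
  simp only [Function.comp_def] at k k1
  have ua := h.up a
  have ub := h.up b
  have uc := h.up c
  have m := h.mu
  have iab := h.inv a b
  have iac := h.inv a c
  have ibc := h.inv b c
  simp only [mixed1, Matrix.add_apply, Matrix.sub_apply, Matrix.smul_apply,
    Matrix.vecMulVec_apply, smul_eq_mul, div_eq_mul_inv]
  repeat' first
    | with_reducible assumption
    | with_reducible apply DifferentiableAt.fun_add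
    | with_reducible apply DifferentiableAt.fun_sub
    | with_reducible apply DifferentiableAt.fun_mul
    | exact differentiableAt_const _

theorem differentiableAt_mixed2 (h : FieldsDifferentiableAt g ξ Ξ x)
    (hK : K.DifferentiableAt (mu (g x) (ξ x))) (hK' : K'.DifferentiableAt (mu (g x) (ξ x)))
    (a b c : Fin d) : DifferentiableAt ℝ (fun y => mixed2 K K' (g y) (ξ y) (Ξ y) a b c) x := by
  obtain ⟨-, -, -, k2, k3⟩ := hK
  obtain ⟨-, -, k1', k2', k3'⟩ := hK'
  replace k2 := k2.comp x h.mu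
  replace k3 := k3.comp x h.mu
  replace k1' := k1'.comp x h.mu
  replace k2' := k2'.comp x h.mu
  replace k3' := k3'.comp x h.mu
  simp only [Function.comp_def] at k2 k3 k1' k2' k3'
  have ua := h.up a
  have ub := h.up b
  have uc := h.up c
  have m := h.mu
  have iab := h.inv a b
  have iac := h.inv a c
  have ibc := h.inv b c
  have la := h.ell a
  have lb := h.ell b
  have lc := h.ell c
  have n := h.nu
  have Mab := h.upM a b
  have Mac := h.upM a c
  have Mbc := h.upM b c
  simp only [mixed2, Matrix.add_apply, Matrix.sub_apply, Matrix.smul_apply,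
    Matrix.vecMulVec_apply, smul_eq_mul, div_eq_mul_inv]
  repeat' first
    | with_reducible assumption
    | with_reducible apply DifferentiableAt.fun_add
    | with_reducible apply DifferentiableAt.fun_sub
    | with_reducible apply DifferentiableAt.fun_mul
    | exact differentiableAt_const _

end Differentiability

/-! ### Conformal invariance of the fluid equations -/

section Fluid

variable {K : Coeffs} {J : Set ℝ}

theorem isLorentzian_minkowski (d : ℕ) : IsLorentzian (minkowski d) :=
  ⟨1, by simp, by simp⟩

theorem isMetricOn_const {g : Mat d} (hg : IsLorentzian g) :
    IsMetricOn Set.univ fun _ : Vec d => g := ⟨fun _ _ => contDiffOn_const, fun _ _ => hg⟩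

theorem contract_eq_zero_of_conformallyInvariantT {g T : Mat d} (hg : IsLorentzian g)
    (hs : T.IsSymm) (h : ConformallyInvariantT Set.univ (fun _ => g) (fun _ => T)
      (-((d : ℝ) + 2))) : contract g T = 0 :=
  ConformallyInvariantT.traceFree (T := fun _ => T) isOpen_univ (isMetricOn_const hg)
    (fun a b => differentiableOn_const (T a b)) (fun _ _ => hs) h 0 (Set.mem_univ _)

theorem symmetric_of_conformallyInvariantA {g : Mat d} {A : Ten d} (hg : IsLorentzian g)
    (hs : ∀ a b c, A a b c = A a c b) (htr : ∀ a, contract g (A a) = 0)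
    (h : ConformallyInvariantA Set.univ (fun _ => g) (fun _ => A) (-((d : ℝ) + 4))) :
    IsTotallyTraceFree g A ∧ SymmetryCondition A :=
  ConformallyInvariantA.traceFree (A := fun _ => A) isOpen_univ (isMetricOn_const hg)
    (fun a b c => differentiableOn_const (A a b c)) (fun _ _ => hs) (fun _ _ => htr) h 0
    (Set.mem_univ _)

/-- Constant fields on the whole coordinate space, with the given values, are tested against
arbitrary Ω. The weights of T and A turn the weights of their divergences into the invariance
studied in the first part, and differentiability is trivial for constants. -/
theorem IsConformalFluid.conformalConditions (h : IsConformalFluid d K J) (hd : (d : ℝ) ≠ 0)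
    (hJ : IsOpen J) (hK : K.IsC2On J) {g : Mat d} (hg : IsLorentzian g) :
    ConformalConditions K J g := by
  intro ξ Ξ hξ hΞ
  have hD := hK.hasDerivOn hJ
  have hD' := hK.hasDerivOn_deriv hJ
  have hfluid := fun Ω (hΩ : IsConformalFactor Set.univ Ω) =>
    h Set.univ (fun _ => g) (fun _ => ξ) (fun _ => Ξ) Ω isOpen_univ (isMetricOn_const hg) hΩ
      (fun _ => contDiffOn_const) (fun _ _ => contDiffOn_const) fun _ _ => ⟨hξ, hΞ⟩
  have hT : ConformallyInvariantT Set.univ (fun _ => g) (fun _ => stress (K.chi g) ξ Ξ)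
      (-((d : ℝ) + 2)) := fun Ω hΩ x hx b => by
    rw [← (hfluid Ω hΩ x hx).2.2.1 b]
    congr 1
    exact funext fun y => ((hfluid Ω hΩ y (Set.mem_univ y)).1).symm
  have hA : ConformallyInvariantA Set.univ (fun _ => g) (fun _ => dissip g (K.chi g) ξ Ξ)
      (-((d : ℝ) + 4)) := fun Ω hΩ x hx b c => by
    rw [← (hfluid Ω hΩ x hx).2.2.2 b c]
    congr 1
    exact funext fun y => ((hfluid Ω hΩ y (Set.mem_univ y)).2.1).symm
  have hs : ∀ i j m, dissip g (K.chi g) ξ Ξ i j m = dissip g (K.chi g) ξ Ξ i m j :=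
    dissip_chi_swap hg hΞ hD hξ
  have htr : ∀ i, contract g (dissip g (K.chi g) ξ Ξ i) = 0 := contract_dissip_chi hg hΞ hd hD hξ
  exact ⟨contract_eq_zero_of_conformallyInvariantT hg (stress_chi_isSymm hJ hg hΞ.1 hD hD' hξ) hT,
    symmetric_of_conformallyInvariantA hg hs htr hA⟩

/-- The scaling law for T is available only on U; openness lets it be used under the derivative. -/
theorem divT_congr {U : Set (Vec d)} (hU : IsOpen U) (g : Vec d → Mat d) {T T' : Vec d → Mat d}
    (h : ∀ x ∈ U, T x = T' x) {x : Vec d} (hx : x ∈ U) (b : Fin d) :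
    divT g T x b = divT g T' x b := by
  have hp : ∀ a, pd (fun y => T y a b) a x = pd (fun y => T' y a b) a x := fun a =>
    pd_congr (Filter.eventually_of_mem (hU.mem_nhds hx) fun y hy => by rw [h y hy]) a
  simp only [divT, hp, h x hx]

theorem divA_congr {U : Set (Vec d)} (hU : IsOpen U) (g : Vec d → Mat d) {A A' : Vec d → Ten d}
    (h : ∀ x ∈ U, A x = A' x) {x : Vec d} (hx : x ∈ U) (b c : Fin d) :
    divA g A x b c = divA g A' x b c := by
  have hp : ∀ a, pd (fun y => A y a b c) a x = pd (fun y => A' y a b c) a x := fun a =>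
    pd_congr (Filter.eventually_of_mem (hU.mem_nhds hx) fun y hy => by rw [h y hy]) a
  simp only [divA, hp, h x hx]

variable {c₀ a b k e : ℝ}

/-- The weights of T and A come from constant rescaling at each point. Their divergences then have
the same weights because both tensors satisfy the algebraic requirements and are differentiable
along smooth fields. -/
theorem HasConformalForm.isConformalFluid (h : HasConformalForm d K J c₀ a b k e)
    (hd : (d : ℝ) ≠ 0) (hJ : J = Set.Iio 0 ∨ J = Set.Ioi 0) (hJo : IsOpen J)
    (h0 : ∀ μ ∈ J, μ ≠ 0) : IsConformalFluid d K J := by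
  intro U g ξ Ξ Ω hU hg hΩ hξs hΞs hf T A g' T' A'
  have hK := h.hasDerivOn hJo h0
  have hK' := h.hasDerivOn_confDeriv hJo h0
  have hTs : ∀ x ∈ U, T' x = Ω x ^ (-((d : ℝ) + 2)) • T x := fun x hx =>
    stress_chi_scale hJ hJo h0 (hg.2 x hx) (hf x hx).2 h (hf x hx).1 (hΩ.2 x hx)
  have hAs : ∀ x ∈ U, A' x = Ω x ^ (-((d : ℝ) + 4)) • A x := fun x hx =>
    dissip_chi_scale hJ hJo h0 (hg.2 x hx) (hf x hx).2 h (hf x hx).1 (hΩ.2 x hx)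
  have hfields : ∀ x ∈ U, FieldsDifferentiableAt g ξ Ξ x := fun x hx =>
    have hgx := hg.differentiableAt hU hx
    ⟨hgx, differentiableAt_inv_apply hgx (hg.2 x hx).isUnit_det.ne_zero,
      fun a => ((hξs a).differentiableOn (by simp)).differentiableAt (hU.mem_nhds hx),
      fun a b => ((hΞs a b).differentiableOn (by simp)).differentiableAt (hU.mem_nhds hx)⟩
  have hTd : ∀ a b, DifferentiableOn ℝ (fun x => T x a b) U := fun a b x hx => by
    have k0 := hK.differentiableAt (hf x hx).1
    have k1 := hK'.differentiableAt (hf x hx).1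
    have k2 := k0.confDeriv2 (d := d) (h0 _ (hf x hx).1) c₀ k
    refine (DifferentiableAt.congr_of_eventuallyEq
      (((differentiableAt_hess0 (hfields x hx) k1 k2 a b).fun_add
      (differentiableAt_hess1 (hfields x hx) k0 k1 k2 a b)).fun_add
      (differentiableAt_hess2 (hfields x hx) k0 k1 k2 a b))
      (Filter.eventually_of_mem (hU.mem_nhds hx) fun y hy => ?_)).differentiableWithinAt
    exact congrFun (congrFun
      (stress_chi hJo (hg.2 y hy) (hf y hy).2.1 hK hK' (hf y hy).1) a) b
  have hAd : ∀ a b c, DifferentiableOn ℝ (fun x => A x a b c) U := fun a b c x hx => by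
    have k0 := hK.differentiableAt (hf x hx).1
    have k1 := hK'.differentiableAt (hf x hx).1
    exact (DifferentiableAt.congr_of_eventuallyEq
      ((differentiableAt_mixed1 (hfields x hx) k0 k1 a b c).fun_add
      (differentiableAt_mixed2 (hfields x hx) k0 k1 a b c))
      (Filter.eventually_of_mem (hU.mem_nhds hx) fun y hy =>
        dissip_chi (hg.2 y hy) (hf y hy).2 hK (hf y hy).1 a b c)).differentiableWithinAt
  have hcond := fun x hx =>
    h.conformalConditions hd hJo h0 (hg.2 x hx) (ξ x) (Ξ x) (hf x hx).1 (hf x hx).2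
  refine fun x hx => ⟨hTs x hx, hAs x hx, fun b => ?_, fun b c => ?_⟩
  · rw [divT_congr hU g' hTs hx]
    exact conformallyInvariantT_of_traceFree hU hg hTd
      (fun y hy => stress_chi_isSymm hJo (hg.2 y hy) (hf y hy).2.1 hK hK' (hf y hy).1) rfl
      (fun y hy => (hcond y hy).1) Ω hΩ x hx b
  · rw [divA_congr hU g' hAs hx]
    exact conformallyInvariantA_of_traceFree hU hg hAd
      (fun y hy => dissip_chi_swap (hg.2 y hy) (hf y hy).2 hK (hf y hy).1) rfl
      (fun y hy => (hcond y hy).2) Ω hΩ x hx b c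

/-- The fluid equations are conformally invariant if and only if the coefficient functions have
the conformal form. -/
theorem isConformalFluid_iff (hd : 3 ≤ d) (hJ : J = Set.Iio 0 ∨ J = Set.Ioi 0) (hJo : IsOpen J)
    (h0 : ∀ μ ∈ J, μ ≠ 0) (hK : K.IsC2On J) :
    IsConformalFluid d K J ↔ ∃ c₀ a b k e : ℝ, HasConformalForm d K J c₀ a b k e := by
  have hd0 : (d : ℝ) ≠ 0 := by
    have : (3 : ℝ) ≤ d := by exact_mod_cast hd
    linarith
  constructor
  · intro h
    exact (conformalConditions_iff hd hJ hK (isLorentzian_minkowski d)).1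
      (h.conformalConditions hd0 hJo hK (isLorentzian_minkowski d))
  · rintro ⟨c₀, a, b, k, e, h⟩
    exact h.isConformalFluid hd0 hJ hJo h0

end Fluid

/-! ### Thermodynamic variables of a conformal fluid -/

section ConformalThermodynamics

variable {g : Mat d} {ξ : Vec d} {Ξ : Mat d} {K : Coeffs} {J : Set ℝ} {c₀ a b k e : ℝ}

theorem pressure_of_traceFree {T : Mat d} (h : contract g T = 0) :
    pressure g ξ T = density g ξ T / ((d : ℝ) - 1) := by
  rw [pressure_eq, h, zero_add]

theorem density_hess0_conf (hμ : mu g ξ < 0) (K : Coeffs) (c₀ k : ℝ) :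
    density g ξ (hess0 (K.confDeriv d c₀ k) (K.confDeriv2 d c₀ k) g ξ) =
      -((d : ℝ) - 1) * (d - 2) * (K.zero (mu g ξ) - c₀) / mu g ξ := by
  have hμ0 := hμ.ne
  have e : (hess0 (K.confDeriv d c₀ k) (K.confDeriv2 d c₀ k) g ξ).mulVec ξ =
      (((d : ℝ) - 1) * (d - 2) * (K.zero (mu g ξ) - c₀) / mu g ξ) • up g ξ :=
    funext fun i => hess0_conf_mulVec hμ0 K c₀ k i
  rw [density_eq hμ, e, smul_dotProduct, up_dotProduct, smul_eq_mul]
  field_simp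

theorem density_hess1_conf (hμ : mu g ξ < 0) (K : Coeffs) (c₀ k : ℝ) (Ξ : Mat d) :
    density g ξ (hess1 K (K.confDeriv d c₀ k) (K.confDeriv2 d c₀ k) g ξ Ξ) =
      -(d * ((d : ℝ) + 1) * K.one (mu g ξ) * (nu g ξ Ξ / mu g ξ)) := by
  have hμ0 := hμ.ne
  have e : (hess1 K (K.confDeriv d c₀ k) (K.confDeriv2 d c₀ k) g ξ Ξ).mulVec ξ =
      K.one (mu g ξ) • ((((d : ℝ) + 2) * (d + 1) * nu g ξ Ξ / mu g ξ) • up g ξ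
        - (2 * ((d : ℝ) + 1)) • ell g ξ Ξ) :=
    funext fun i => hess1_conf_mulVec hμ0 K c₀ k Ξ i
  rw [density_eq hμ, e, smul_dotProduct, sub_dotProduct, smul_dotProduct, smul_dotProduct,
    up_dotProduct, ell_dotProduct]
  simp only [smul_eq_mul]
  field_simp
  ring

theorem density_hess2_conf (hg : IsLorentzian g) (hΞ : Ξ.IsSymm) (hμ : mu g ξ < 0)
    (h : HasConformalForm d K J c₀ a b k e) (hξ : mu g ξ ∈ J) :
    density g ξ (hess2 K (K.confDeriv d c₀ k) (K.confDeriv2 d c₀ k) g ξ Ξ) =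
      -(((d : ℝ) + 2) * (d + 3) * (K.two1 (mu g ξ) - k) * Xs g ξ Ξ / mu g ξ) := by
  have hμ0 := hμ.ne
  have e : (hess2 K (K.confDeriv d c₀ k) (K.confDeriv2 d c₀ k) g ξ Ξ).mulVec ξ =
      (K.two1 (mu g ξ) - k) • ((((d : ℝ) + 2) * (d + 3) / mu g ξ * Xs g ξ Ξ) • up g ξ
        - ((d : ℝ) + 3) • Xv g ξ Ξ) :=
    funext fun i => hess2_conf_mulVec hg hΞ hμ0 h hξ i
  rw [density_eq hμ, e, smul_dotProduct, sub_dotProduct, smul_dotProduct, smul_dotProduct,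
    up_dotProduct, Xv_dotProduct hg hΞ hμ0]
  simp only [smul_eq_mul]
  field_simp
  ring

theorem heatFlux_hess1_conf (hμ : mu g ξ < 0) (K : Coeffs) (c₀ k : ℝ) (Ξ : Mat d) (i : Fin d) :
    heatFlux g ξ (hess1 K (K.confDeriv d c₀ k) (K.confDeriv2 d c₀ k) g ξ Ξ) i =
      2 * ((d : ℝ) + 1) * K.one (mu g ξ) / √(-mu g ξ) * rvec g ξ Ξ i := by
  rw [heatFlux_eq, hess1_conf_mulVec hμ.ne, density_hess1_conf hμ, rvec]
  ring

theorem vel_mul_vel (hμ : mu g ξ < 0) (i j : Fin d) :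
    vel g ξ i * vel g ξ j = -(up g ξ i * up g ξ j) / mu g ξ := by
  rw [vel, vel, div_mul_div_comm, Real.mul_self_sqrt (neg_nonneg.2 hμ.le), div_neg, neg_div]

/-- The covector ξ_a is the inverse-temperature covector: u^a/Θ = ξ^a. -/
theorem div_temperature_mul_vel (hμ : mu g ξ < 0) (ρ : ℝ) (i : Fin d) :
    ρ / temperature g ξ * vel g ξ i = ρ * up g ξ i := by
  have : √(-mu g ξ) ≠ 0 := (Real.sqrt_pos.2 (neg_pos.2 hμ)).ne'
  rw [temperature, vel]
  field_simp

end ConformalThermodynamics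

end ConformalFluid

/-! ### The main theorem -/

theorem mainTheorem2 (d : ℕ) :
    -- requirements of conformal invariance on the tensor fields
    (∀ (U : Set (ConformalFluid.Vec d)) (g : ConformalFluid.Vec d → ConformalFluid.Mat d),
      IsOpen U → ConformalFluid.IsMetricOn U g →
      (∀ (T : ConformalFluid.Vec d → ConformalFluid.Mat d) (α : ℝ),
        (∀ a b, DifferentiableOn ℝ (fun x => T x a b) U) → (∀ x ∈ U, (T x).IsSymm) →
        ((α = -((d : ℝ) + 2) ∧ ∀ x ∈ U, ConformalFluid.contract (g x) (T x) = 0) →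
          ConformalFluid.ConformallyInvariantT U g T α) ∧
        (ConformalFluid.ConformallyInvariantT U g T α →
          (∃ x ∈ U, ¬ ∃ φ : ℝ, T x = φ • (g x)⁻¹) →
          α = -((d : ℝ) + 2) ∧ ∀ x ∈ U, ConformalFluid.contract (g x) (T x) = 0)) ∧
      (∀ (A : ConformalFluid.Vec d → ConformalFluid.Ten d) (β : ℝ),
        (∀ a b c, DifferentiableOn ℝ (fun x => A x a b c) U) →
        (∀ x ∈ U, ∀ a b c, A x a b c = A x a c b) →
        (∀ x ∈ U, ∀ a, ConformalFluid.contract (g x) (A x a) = 0) →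
        ((β = -((d : ℝ) + 4) ∧ ∀ x ∈ U, ConformalFluid.IsTotallyTraceFree (g x) (A x) ∧
            ConformalFluid.SymmetryCondition (A x)) →
          ConformalFluid.ConformallyInvariantA U g A β) ∧
        (ConformalFluid.ConformallyInvariantA U g A β →
          (∃ x ∈ U, ¬ ∃ w : ConformalFluid.Vec d, ∀ a b c,
            A x a b c + A x b c a + A x c a b =
              (g x)⁻¹ a b * w c + (g x)⁻¹ b c * w a + (g x)⁻¹ c a * w b) →
          β = -((d : ℝ) + 4) ∧ ∀ x ∈ U, ConformalFluid.IsTotallyTraceFree (g x) (A x) ∧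
            ConformalFluid.SymmetryCondition (A x)))) ∧
    -- the generating function; `J` is the range of `μ` for time-like or for space-like `ξ^a`
    (3 ≤ d → ∀ J : Set ℝ, (J = Set.Iio 0 ∨ J = Set.Ioi 0) →
      ∀ K : ConformalFluid.Coeffs, K.IsC2On J →
      (∀ g : ConformalFluid.Mat d, ConformalFluid.IsLorentzian g →
        (ConformalFluid.ConformalConditions K J g ↔
          ∃ c₀ a b k e : ℝ, ConformalFluid.HasConformalForm d K J c₀ a b k e)) ∧
      (ConformalFluid.IsConformalFluid d K J ↔
        ∃ c₀ a b k e : ℝ, ConformalFluid.HasConformalForm d K J c₀ a b k e) ∧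
      -- consequences
      (∀ c₀ a b k e : ℝ, ConformalFluid.HasConformalForm d K J c₀ a b k e →
        ∀ g : ConformalFluid.Mat d, ConformalFluid.IsLorentzian g →
        -- the generating function has conformal weight `d - 2` iff both additive constants vanish
        ((∀ ξ Ξ, ConformalFluid.mu g ξ ∈ J → ConformalFluid.IsSTF g Ξ → ∀ c : ℝ, 0 < c →
          K.chi (c ^ 2 • g) (c ^ 2 • ξ) (c ^ 4 • Ξ) =
            c ^ (-((d : ℝ) - 2)) * K.chi g ξ Ξ) ↔ (c₀ = 0 ∧ k = 0)) ∧
        (∀ (ξ : ConformalFluid.Vec d) (Ξ : ConformalFluid.Mat d),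
          ConformalFluid.mu g ξ ∈ J → ConformalFluid.IsSTF g Ξ →
          let μ := ConformalFluid.mu g ξ
          let ν := ConformalFluid.nu g ξ Ξ
          let D := ConformalFluid.D d
          let v := ConformalFluid.up g ξ
          let gi := g⁻¹
          let xx := ConformalFluid.xixi g ξ
          let M := ConformalFluid.upM g Ξ
          let l := ConformalFluid.ell g ξ Ξ
          let r := ConformalFluid.rvec g ξ Ξ
          let τ := ConformalFluid.tauT g ξ Ξ
          let X := ConformalFluid.Xs g ξ Ξ
          let Xv := ConformalFluid.Xv g ξ Ξ
          let Xt := ConformalFluid.Xt g ξ Ξ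
          let Y := ConformalFluid.Yt g ξ Ξ
          let Y' := ConformalFluid.YtT g ξ Ξ
          let s := ConformalFluid.sprod
          -- the non-constant part of `χ⁰`, the function `χ¹`, the non-constant part of `χ²₁`
          let f₀ := a * |μ| ^ (1 - (d : ℝ) / 2)
          let f₁ := K.one μ
          let f₂ := K.two1 μ - k
          let T₀ := ConformalFluid.stress (K.ord0 g) ξ Ξ
          let T₁ := ConformalFluid.stress (K.ord1 g) ξ Ξ
          let T₂ := ConformalFluid.stress (K.ord2 g) ξ Ξ
          let T := ConformalFluid.stress (K.chi g) ξ Ξ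
          let A₀ := ConformalFluid.dissip g (K.ord0 g) ξ Ξ
          let A₁ := ConformalFluid.dissip g (K.ord1 g) ξ Ξ
          let A₂ := ConformalFluid.dissip g (K.ord2 g) ξ Ξ
          let S₀ := ConformalFluid.entropy g (K.ord0 g) ξ Ξ
          let S₁ := ConformalFluid.entropy g (K.ord1 g) ξ Ξ
          let S₂ := ConformalFluid.entropy g (K.ord2 g) ξ Ξ
          let ρ := ConformalFluid.density g ξ
          let p := ConformalFluid.pressure g ξ
          let u := ConformalFluid.vel g ξ
          let Θ := ConformalFluid.temperature g ξ
          -- the orders add up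
          (T = T₀ + T₁ + T₂ ∧
            ConformalFluid.dissip g (K.chi g) ξ Ξ = A₀ + A₁ + A₂ ∧
            ConformalFluid.entropy g (K.chi g) ξ Ξ = S₀ + S₁ + S₂) ∧
          -- the entropy current has conformal weight `d`
          (∀ c : ℝ, 0 < c →
            ConformalFluid.entropy (c ^ 2 • g) (K.chi (c ^ 2 • g)) (c ^ 2 • ξ) (c ^ 4 • Ξ) =
              c ^ (-(d : ℝ)) • ConformalFluid.entropy g (K.chi g) ξ Ξ) ∧
          -- order zero
          ((∀ i j, T₀ i j = d * ((d : ℝ) - 2) * f₀ / μ ^ 2 * xx i j) ∧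
            (∀ i j m, A₀ i j m = 0) ∧
            (∀ i, S₀ i = -(d * ((d : ℝ) - 2) * f₀ / μ) * v i)) ∧
          -- order one
          ((∀ i j, T₁ i j = f₁ * (((d : ℝ) + 2) * (d + 4) / μ ^ 2 * ν * (v i * v j)
              - 4 * ((d : ℝ) + 2) / μ * s v l i j - ((d : ℝ) + 2) / μ * ν * gi i j
              + 2 * M i j)) ∧
            (∀ i j, T₁ i j =
              f₁ * (ν / μ ^ 2) * ((d : ℝ) ^ 2 * (d + 1) / ((d : ℝ) - 1)) * xx i j
              - 4 * ((d : ℝ) + 1) * f₁ / μ * s v r i j + 2 * f₁ * τ i j) ∧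
            (∀ i j m, A₁ i j m = f₁ * (gi i j * v m + gi i m * v j + v i * gi j m
              - ((d : ℝ) + 2) / μ * (v i * v j * v m))) ∧
            (∀ i, S₁ i = -(d * ((d : ℝ) + 1) * f₁ * (ν / μ)) * v i
              + 2 * ((d : ℝ) + 1) * f₁ * r i)) ∧
          -- order two
          (ConformalFluid.gradXi (fun η Z => ConformalFluid.Xs g η Z) ξ Ξ = Xv ∧
            ConformalFluid.stress (fun η Z => ConformalFluid.Xs g η Z) ξ Ξ = Xt ∧
            (∀ i, ∑ j, Y i j * ξ j = 0) ∧
            (∀ i j, T₂ i j = 2 * D 1 * X * f₂ / μ ^ 2 * (2 * D 2 * (v i * v j) - μ * gi i j)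
              - 4 * D 1 * f₂ / μ * s Xv v i j + f₂ * Xt i j) ∧
            (∀ i j, T₂ i j =
              f₂ * X / μ ^ 2 * (d * ((d : ℝ) + 2) * (d + 3) / ((d : ℝ) - 1)) * xx i j
              - 2 * ((d : ℝ) + 3) * f₂ / μ * s Xv v i j + f₂ * Y' i j) ∧
            (∀ i j m, A₂ i j m =
              4 * D 1 * f₂ / μ ^ 3 * v i * (-(μ ^ 2 * M j m)
                + 4 * D 2 * μ * (s v l j m - ν / d * gi j m)
                - 2 * D 2 * D 3 * ν * xx j m)
              - 8 * D 1 * f₂ / μ * ((gi i j * l m + gi i m * l j) / 2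
                + (v j * M m i + v m * M j i) / 2 - 2 / d * gi j m * l i)
              + 8 * D 1 * D 2 * f₂ / μ ^ 2 * (l i * xx j m
                + ν * ((gi i j * v m + gi i m * v j) / 2 - v i * gi j m / d))) ∧
            (∀ i, S₂ i = -(((d : ℝ) + 2) ^ 2 * f₂ / μ) * ConformalFluid.Gv g ξ Ξ i) ∧
            (∀ i, S₂ i = -(((d : ℝ) + 2) ^ 2 * f₂ / μ) *
              (((d : ℝ) ^ 2 * (d + 1) / (2 * ((d : ℝ) - 1)) * (ν ^ 2 / μ ^ 2)
                  - 2 * ((d : ℝ) + 1) / μ * (∑ j, r j * ConformalFluid.low g r j)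
                  + ConformalFluid.contract (g * τ * g) τ) * v i
                - 2 * d * ((d : ℝ) + 1) / ((d : ℝ) - 1) * (ν / μ) * r i
                + 4 * ∑ j, τ i j * ConformalFluid.low g r j))) ∧
          -- thermodynamics for time-like `ξ^a`
          (μ < 0 →
            (p T = ρ T / ((d : ℝ) - 1) ∧ p T₀ = ρ T₀ / ((d : ℝ) - 1) ∧
              p T₁ = ρ T₁ / ((d : ℝ) - 1) ∧ p T₂ = ρ T₂ / ((d : ℝ) - 1)) ∧
            (p T₀ = 2 * deriv K.zero μ ∧ ρ T₀ = -((d : ℝ) - 1) * (d - 2) * f₀ / μ ∧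
              ρ T₁ = -(d * ((d : ℝ) + 1) * f₁ * (ν / μ)) ∧
              ρ T₂ = -(((d : ℝ) + 2) * (d + 3) * f₂ * X / μ)) ∧
            (∀ i j, T₀ i j = (ρ T₀ + p T₀) * (u i * u j) + p T₀ * gi i j) ∧
            (∀ i, ConformalFluid.heatFlux g ξ T₁ i =
              2 * ((d : ℝ) + 1) * f₁ / √(-μ) * r i) ∧
            (∀ i, S₀ i = d / ((d : ℝ) - 1) * (ρ T₀ / Θ) * u i) ∧
            (∀ i, S₁ i = ρ T₁ / Θ * u i + ConformalFluid.heatFlux g ξ T₁ i / Θ))))) := by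
  refine ⟨fun U g hU hg => ⟨fun T α hT hs => ⟨fun h => ?_, fun h hne => ?_⟩,
    fun A β hA hs htr => ⟨fun h => ?_, fun h hne => ?_⟩⟩, fun hd J hJ K hK => ?_⟩
  · exact ConformalFluid.conformallyInvariantT_of_traceFree hU hg hT hs h.1 h.2
  -- One point where T is not proportional to g^ab fixes α; with α known, the trace vanishes at
  -- every point of U.
  · obtain rfl := ConformalFluid.ConformallyInvariantT.weight hU hg hT hs h hne
    exact ⟨rfl, ConformalFluid.ConformallyInvariantT.traceFree hU hg hT hs h⟩
  · exact ConformalFluid.conformallyInvariantA_of_traceFree hU hg hA hs h.1 h.2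
  · obtain rfl := ConformalFluid.ConformallyInvariantA.weight hU hg hA hs h hne
    exact ⟨rfl, ConformalFluid.ConformallyInvariantA.traceFree hU hg hA hs htr h⟩
  obtain ⟨hJo, h0⟩ : IsOpen J ∧ ∀ μ ∈ J, μ ≠ 0 := by
    rcases hJ with rfl | rfl
    · exact ⟨isOpen_Iio, fun μ hμ => ne_of_lt hμ⟩
    · exact ⟨isOpen_Ioi, fun μ hμ => ne_of_gt hμ⟩
  have hd3 : (3 : ℝ) ≤ d := by exact_mod_cast hd
  have hd0 : (d : ℝ) ≠ 0 := by linarith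
  have hd1 : (d : ℝ) - 1 ≠ 0 := by linarith
  refine ⟨fun g hg => ConformalFluid.conformalConditions_iff hd hJ hK hg,
    ConformalFluid.isConformalFluid_iff hd hJ hJo h0 hK, fun c₀ a b k e h g hg =>
    ⟨ConformalFluid.chi_weight_iff hd hJ h0 hg h, fun ξ Ξ hξ hΞ => ?_⟩⟩
  intro μ ν D v gi xx M l r τ X Xv Xt Y Y' s f₀ f₁ f₂ T₀ T₁ T₂ T A₀ A₁ A₂ S₀ S₁ S₂ ρ p u Θ
  have hD := h.hasDerivOn hJo h0
  have hD' := h.hasDerivOn_confDeriv hJo h0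
  have hμ : ConformalFluid.mu g ξ ≠ 0 := h0 _ hξ
  -- The derivative formulas are phrased with χ⁰ − c₀, the statement with the explicit power of |μ|.
  have hf₀ : K.zero (ConformalFluid.mu g ξ) - c₀ = f₀ := by
    rw [(h _ hξ).1, add_sub_cancel_left]
  have hT₀ : T₀ = _ := ConformalFluid.stress_ord0 hJo hg hD hD' hξ
  have hT₁ : T₁ = _ := ConformalFluid.stress_ord1 hJo hg hΞ.1 hD hD' hξ
  have hT₂ : T₂ = _ := ConformalFluid.stress_ord2 hJo hg hΞ.1 hD hD' hξ
  have hS₀ : ∀ i, S₀ i = -(d * ((d : ℝ) - 2) * f₀ / μ) * v i := fun i => by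
    rw [← hf₀]
    exact (ConformalFluid.entropy_ord0 hJo hg hD hD' hξ i).trans
      (ConformalFluid.entropy0_conf hμ K c₀ k i)
  have hS₁ : ∀ i, S₁ i = -(d * ((d : ℝ) + 1) * f₁ * (ν / μ)) * v i
      + 2 * ((d : ℝ) + 1) * f₁ * r i := fun i =>
    (ConformalFluid.entropy_ord1 hJo hg hΞ hD hD' hξ i).trans
      (ConformalFluid.entropy1_conf hg hΞ hμ K c₀ k i)
  have hS₂ : ∀ i, S₂ i = -(((d : ℝ) + 2) ^ 2 * f₂ / μ) * ConformalFluid.Gv g ξ Ξ i := fun i =>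
    (ConformalFluid.entropy_ord2 hJo hg hΞ hD hD' hξ i).trans
      (ConformalFluid.entropy2_conf hg hΞ hμ h hξ i)
  have hT₀xx : ∀ i j, T₀ i j = d * ((d : ℝ) - 2) * f₀ / μ ^ 2 * xx i j := fun i j => by
    rw [hT₀, ← hf₀]
    exact ConformalFluid.hess0_conf hd0 hμ K c₀ k i j
  refine ⟨⟨ConformalFluid.stress_chi_eq_add hJo hg hΞ hD hD' hξ,
    ConformalFluid.dissip_chi_eq_add hg hΞ hD hξ,
    ConformalFluid.entropy_chi_eq_add hJo hg hΞ hD hD' hξ⟩,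
    fun c hc => ConformalFluid.entropy_chi_scale hJ hJo h0 hg hΞ h hξ hc,
    ⟨hT₀xx, ConformalFluid.dissip_ord0 K g ξ Ξ, hS₀⟩,
    ⟨fun i j => ?_, fun i j => ?_, fun i j m => ?_, hS₁⟩,
    ⟨ConformalFluid.gradXi_Xs hg hΞ.1 hμ, ConformalFluid.stress_Xs hg hΞ.1 hμ,
      congrFun (ConformalFluid.Yt_mulVec hg hΞ.1 hμ), fun i j => ?_, fun i j => ?_,
      fun i j m => ?_, hS₂, fun i => ?_⟩, fun hneg => ?_⟩
  · rw [hT₁]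
    exact ConformalFluid.hess1_conf hμ K c₀ k Ξ i j
  · rw [hT₁]
    exact ConformalFluid.hess1_conf_decomposition hd0 hd1 hμ K c₀ k Ξ i j
  · exact (ConformalFluid.dissip_ord1 hg Ξ hD hξ i j m).trans
      (ConformalFluid.mixed1_conf hd0 hμ K c₀ k i j m)
  · rw [hT₂]
    exact ConformalFluid.hess2_conf hμ h hξ Ξ i j
  · rw [hT₂]
    exact ConformalFluid.hess2_conf_decomposition hg hΞ hd0 hd1 hμ h hξ i j
  · exact (ConformalFluid.dissip_ord2 hg hΞ hD hξ i j m).trans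
      (ConformalFluid.mixed2_conf hg hΞ.1 hd0 hμ h hξ i j m)
  · rw [hS₂ i, ConformalFluid.Gv_eq hg hΞ hd0 hd1 hμ i]
  have hρ₀ : ρ T₀ = -((d : ℝ) - 1) * (d - 2) * f₀ / μ := by
    rw [hT₀, ← hf₀]
    exact ConformalFluid.density_hess0_conf hneg K c₀ k
  have hρ₁ : ρ T₁ = -(d * ((d : ℝ) + 1) * f₁ * (ν / μ)) := by
    rw [hT₁]
    exact ConformalFluid.density_hess1_conf hneg K c₀ k Ξ
  have hρ₂ : ρ T₂ = -(((d : ℝ) + 2) * (d + 3) * f₂ * X / μ) := by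
    rw [hT₂]
    exact ConformalFluid.density_hess2_conf hg hΞ.1 hneg h hξ
  have hp : p T = ρ T / ((d : ℝ) - 1) := ConformalFluid.pressure_of_traceFree
    (h.conformalConditions hd0 hJo h0 hg ξ Ξ hξ hΞ).1
  have hp₀ : p T₀ = ρ T₀ / ((d : ℝ) - 1) := ConformalFluid.pressure_of_traceFree
    (hT₀ ▸ ConformalFluid.contract_hess0_conf hg hμ K c₀ k)
  have hp₁ : p T₁ = ρ T₁ / ((d : ℝ) - 1) := ConformalFluid.pressure_of_traceFree
    (hT₁ ▸ ConformalFluid.contract_hess1_conf hg hΞ hμ K c₀ k)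
  have hp₂ : p T₂ = ρ T₂ / ((d : ℝ) - 1) := ConformalFluid.pressure_of_traceFree
    (hT₂ ▸ ConformalFluid.contract_hess2_conf hg hΞ hμ h hξ)
  have hq : ∀ i, ConformalFluid.heatFlux g ξ T₁ i = 2 * ((d : ℝ) + 1) * f₁ / √(-μ) * r i :=
    fun i => by
      rw [hT₁]
      exact ConformalFluid.heatFlux_hess1_conf hneg K c₀ k Ξ i
  have hμ' : μ ≠ 0 := hμ
  have hderiv : deriv K.zero μ = (1 - d / 2) / μ * f₀ := by
    rw [← hf₀]
    exact (hD _ hξ).1.deriv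
  have hu : ∀ i j, u i * u j = -(v i * v j) / μ := ConformalFluid.vel_mul_vel hneg
  have hΘ : ∀ (x : ℝ) (i : Fin d), x / Θ * u i = x * v i :=
    ConformalFluid.div_temperature_mul_vel hneg
  refine ⟨⟨hp, hp₀, hp₁, hp₂⟩, ⟨?_, hρ₀, hρ₁, hρ₂⟩, fun i j => ?_, hq, fun i => ?_, fun i => ?_⟩
  · rw [hp₀, hρ₀, hderiv]
    field_simp
    ring
  · rw [hT₀xx, hp₀, hρ₀, hu, show xx i j = v i * v j - μ / d * gi i j from rfl]
    field_simp
    ring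
  · rw [mul_assoc, hΘ, hρ₀, hS₀]
    field_simp
  · have hsq : √(-μ) ≠ 0 := (Real.sqrt_pos.2 (neg_pos.2 hneg)).ne'
    rw [hΘ, hρ₁, hS₁, hq, show Θ = 1 / √(-μ) from rfl]
    field_simp
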